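/- Let $\hbar,m,\omega,\beta>0$, $\gamma_N=\ln N/N$ and $V(x)=\frac12 m\omega^2x^2$. For $N\ge 2$ let \[ H^0_N=\sum_{i=1}^N\Big[-\frac{\hbar^2}{2m}\frac{d^2}{dx_i^2}+\gamma_N V(\sqrt{\gamma_N}\,x_i)\Big],\qquad H_N=H^0_N+U_N , \] on the symmetric (bosonic) subspace of $L^2(\mathbb R^N)$, where $U_N(x_1,\dots,x_N)$ is a real measurable function and, for $U_N$ bounded from below, $H_N$ is the operator of the quadratic form sum. Write $\langle A\rangle_{\beta H}=\mathrm{Tr}\,A e^{-\beta H}/\mathrm{Tr}\,e^{-\beta H}$, traces being taken in the bosonic subspace, and let $n_j$ be the occupation number operator of the $j$-th eigenvector $\varphi_j$ ($j=0,1,2,\dots$, in increasing order of the eigenvalues) of the one-particle Hamiltonian $-\frac{\hbar^2}{2m}\frac{d^2}{dx^2}+\gamma_NV(\sqrt{\gamma_N}\,x)$. (i) Suppose that for some constant $B$ independent of $N$ one has $U_N\ge -BN$ (almost everywhere) for all $N\ge 2$, that $\langle U_N\rangle_{\beta H^0_N}$ is finite for all $N\ge2$, and that $\langle U_N\rangle_{\beta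 H^0_N}=o(N\ln N)$ as $N\to\infty$. Then $e^{-\beta H_N}$ is trace class for all $N\ge2$, and the gas undergoes a complete generalized Bose-Einstein condensation: \[ \lim_{s\to 0+}\ \lim_{N\to\infty}\frac1N\sum_{0\le j\le sN}\langle n_j\rangle_{\beta H_N}=1 ,\tag{$*$} \] where the inner limit exists for every $s>0$. (ii) Let $U_N=\sum_{i<j}u_N(x_i-x_j)$ with integrable $u_N:\mathbb R\to\mathbb R$ be a stable pair interaction, that is, $U_N\ge -BN$ for all $N\ge 2$ with a constant $B$. If $\|u_N\|_1=\int|u_N(x)|\,dx=o(\gamma_N)$, then $\langle U_N\rangle_{\beta H^0_N}$ is finite for all $N\ge 2$ and $o(N\ln N)$, and thus the conclusions of (i) hold. (iii) Let $u_N(x)=b_Nu(\alpha_Nx)$ with $b_N\in\mathbb R$, $\alpha_N>0$ and $\|u\|_1<\infty$. If $\|u\|_1\neq0$, then $\|u_N\|_1=o(\gamma_N)$ if and only if $b_N=o(\alpha_N\ln N/N)$. If $U_N=\sum_{i<j}u_N(x_i-x_j)$ is stable as in (ii) and $b_N=o(\alpha_N\ln N/N)$, then the conclusions of (ii) hold.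 -/

import Mathlib

open MeasureTheory Filter Topology Asymptotics
open scoped ENNReal InnerProductSpace

noncomputable section

namespace TrappedBose

/-- Positions of `N` particles on the line. -/
abbrev Conf (N : ℕ) : Type := Fin N → ℝ

/-- The full `N`-particle Hilbert space `L²(ℝ^N; ℂ)`. -/
abbrev L2 (N : ℕ) : Type := Lp ℂ 2 (volume : Measure (Conf N))

/-- `ψ` belongs to the symmetric (bosonic) subspace of `L²(ℝ^N)`. -/
def IsBosonic {N : ℕ} (ψ : L2 N) : Prop :=
  ∀ σ : Equiv.Perm (Fin N), ∀ᵐ x : Conf N, ψ (x ∘ σ) = ψ x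

/-- `g i ∈ L²` is the weak (distributional) partial derivative of `ψ` in the `i`-th coordinate,
for every `i`; in particular `ψ` is in the Sobolev space `H¹`. -/
def HasWeakGrad {N : ℕ} (ψ : L2 N) (g : Fin N → L2 N) : Prop :=
  ∀ i : Fin N, ∀ η : Conf N → ℝ, ContDiff ℝ ((⊤ : ℕ∞) : WithTop ℕ∞) η → HasCompactSupport η →
    ∫ x, fderiv ℝ η x (Pi.single i 1) • ψ x = -∫ x, η x • g i x

/-- `ψ` has a finite potential energy in the potential `W`. -/
def FinitePotential {N : ℕ} (W : Conf N → ℝ) (ψ : L2 N) : Prop :=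
  Integrable fun x => W x * ‖ψ x‖ ^ 2

/-- The graph of the Hamiltonian `H = -(ħ²/2m) ∑ ∂ᵢ² + W` on the bosonic subspace, for a potential
`W` that is bounded from below. `H` is the self-adjoint operator of the closed quadratic form
`(ħ²/2m) ∑ ‖∂ᵢψ‖² + ∫ W |ψ|²` on its maximal domain; the predicate says that `ψ` is in the domain
of `H` and that `H ψ = χ`. -/
def IsHamiltonian {N : ℕ} (ħ m : ℝ) (W : Conf N → ℝ) (ψ χ : L2 N) : Prop :=
  IsBosonic ψ ∧ IsBosonic χ ∧ FinitePotential W ψ ∧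
    ∃ g : Fin N → L2 N, HasWeakGrad ψ g ∧
      ∀ (φ : L2 N) (h : Fin N → L2 N), IsBosonic φ → HasWeakGrad φ h → FinitePotential W φ →
        ((ħ ^ 2 / (2 * m) : ℝ) : ℂ) * ∑ i, ⟪h i, g i⟫_ℂ
          + ∫ x, (W x : ℂ) * (starRingEnd ℂ (φ x) * ψ x) = ⟪φ, χ⟫_ℂ

/-- A spectral resolution of the Hamiltonian with potential `W` on the bosonic subspace:
a complete orthonormal sequence of eigenvectors `ψ k`, with eigenvalues `E k`. -/
structure IsSpectralResolution {N : ℕ} (ħ m : ℝ) (W : Conf N → ℝ)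
    (ψ : ℕ → L2 N) (E : ℕ → ℝ) : Prop where
  bosonic : ∀ k, IsBosonic (ψ k)
  orthonormal : Orthonormal ℂ ψ
  complete : ∀ χ : L2 N, IsBosonic χ → (∀ k, ⟪ψ k, χ⟫_ℂ = 0) → χ = 0
  eigen : ∀ k, IsHamiltonian ħ m W (ψ k) ((E k : ℂ) • ψ k)

/-- `exp (-β H)` is trace class on the bosonic subspace, so that the thermal state
`exp (-β H) / Tr exp (-β H)` exists. -/
def HasThermalState {N : ℕ} (ħ m β : ℝ) (W : Conf N → ℝ) : Prop :=
  ∃ p : (ℕ → L2 N) × (ℕ → ℝ), IsSpectralResolution ħ m W p.1 p.2 ∧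
    Summable fun k => Real.exp (-β * p.2 k)

open Classical in
/-- A spectral resolution of `H` (the traces below do not depend on which one it is). -/
def spectralPair {N : ℕ} (ħ m β : ℝ) (W : Conf N → ℝ) : (ℕ → L2 N) × (ℕ → ℝ) :=
  if h : HasThermalState ħ m β W then h.choose else (0, 0)

/-- The eigenvalue `exp (-β E k) / Tr exp (-β H)` of the thermal density matrix. -/
def thermalWeight {N : ℕ} (ħ m β : ℝ) (W : Conf N → ℝ) (k : ℕ) : ℝ :=
  Real.exp (-β * (spectralPair ħ m β W).2 k) /
    ∑' l, Real.exp (-β * (spectralPair ħ m β W).2 l)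

/-- The law of the positions in the thermal state: for a function `f` of the positions,
`∫ f ∂(positionLaw …) = ∑ₖ wₖ ∫ f |ψₖ|² = Tr (f exp (-β H)) / Tr exp (-β H)`. -/
def positionLaw {N : ℕ} (ħ m β : ℝ) (W : Conf N → ℝ) : Measure (Conf N) :=
  Measure.sum fun k => ENNReal.ofReal (thermalWeight ħ m β W k) •
    (volume : Measure (Conf N)).withDensity fun x => ‖(spectralPair ħ m β W).1 k x‖ₑ ^ 2

/-- The occupation number operator of a one-particle state `φ`,
`n[φ] = ∑ᵢ 1 ⊗ ⋯ ⊗ |φ⟩⟨φ| ⊗ ⋯ ⊗ 1`, applied to `ψ`. -/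
def numberOp {N : ℕ} (φ : L2 1) (ψ : L2 N) (x : Conf N) : ℂ :=
  ∑ i, φ (fun _ => x i) *
    ∫ y : ℝ, starRingEnd ℂ (φ fun _ => y) * ψ (Function.update x i y)

/-- The quantum mechanical mean `(ψ, n[φ] ψ)`. -/
def occupation {N : ℕ} (φ : L2 1) (ψ : L2 N) : ℝ :=
  (∫ x, starRingEnd ℂ (ψ x) * numberOp φ ψ x).re

/-- The thermal mean `⟨n[φ]⟩ = Tr (n[φ] exp (-β H)) / Tr exp (-β H)`. -/
def thermalOccupation {N : ℕ} (ħ m β : ℝ) (W : Conf N → ℝ) (φ : L2 1) : ℝ :=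
  ∑' k, thermalWeight ħ m β W k * occupation φ ((spectralPair ħ m β W).1 k)

/-- The scaled harmonic trap `∑ᵢ γ V(√γ xᵢ)` with `V(x) = m om² x² / 2` (`om` is the frequency). -/
def trap (m om γ : ℝ) (N : ℕ) (x : Conf N) : ℝ :=
  ∑ i, γ * (m * om ^ 2 * (Real.sqrt γ * x i) ^ 2 / 2)

open Classical in
/-- The eigenvector `φ_j` of the one-particle Hamiltonian `H⁰ = -(ħ²/2m) d²/dx² + γ V(√γ x)`, the
eigenvalues being numbered in increasing order from `j = 0`. -/
def trapMode (ħ m om γ : ℝ) (j : ℕ) : L2 1 :=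
  if h : ∃ p : (ℕ → L2 1) × (ℕ → ℝ),
      IsSpectralResolution ħ m (trap m om γ 1) p.1 p.2 ∧ Monotone p.2
  then h.choose.1 j else 0

/-- The scaling `γ_N = ln N / N`. -/
def gam (N : ℕ) : ℝ := Real.log N / N

/-- The total potential in `H_N = H⁰_N + U_N`, in the trap scaled with `γ_N = ln N / N`. -/
def potential (m om : ℝ) (U : (N : ℕ) → Conf N → ℝ) (N : ℕ) (x : Conf N) : ℝ :=
  trap m om (gam N) N x + U N x

/-- `⟨n_j⟩` in the thermal state of `H_N = H⁰_N + U_N`. -/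
def meanOccupation (ħ m om β : ℝ) (U : (N : ℕ) → Conf N → ℝ) (N j : ℕ) : ℝ :=
  thermalOccupation ħ m β (potential m om U N) (trapMode ħ m om (gam N) j)

/-- The law of the positions in the thermal state of the noninteracting gas `H⁰_N`. -/
def freeLaw (ħ m om β : ℝ) (N : ℕ) : Measure (Conf N) :=
  positionLaw ħ m β (trap m om (gam N) N)

/-- `⟨U_N⟩` in the thermal state of `H⁰_N` is finite for `N ≥ 2`, and is `o(N ln N)`. -/
def SmallFreeMean (ħ m om β : ℝ) (U : (N : ℕ) → Conf N → ℝ) : Prop :=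
  (∀ N, 2 ≤ N → Integrable (U N) (freeLaw ħ m om β N)) ∧
    (fun N : ℕ => ∫ x, U N x ∂(freeLaw ħ m om β N)) =o[atTop] fun N : ℕ => (N : ℝ) * Real.log N

/-- The uniform lower bound `U_N ≥ -B N`. -/
def BoundedBelow (B : ℝ) (U : (N : ℕ) → Conf N → ℝ) : Prop :=
  ∀ N, 2 ≤ N → ∀ᵐ x : Conf N, -(B * N) ≤ U N x

/-- Complete generalized Bose-Einstein condensation of the gas with the Hamiltonians
`H_N = H⁰_N + U_N`: the thermal states exist and
`lim_{s → 0} lim_{N → ∞} (1/N) ∑_{0 ≤ j ≤ s N} ⟨n_j⟩ = 1`. -/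
def CompleteGBEC (ħ m om β : ℝ) (U : (N : ℕ) → Conf N → ℝ) : Prop :=
  (∀ N, 2 ≤ N → HasThermalState ħ m β (potential m om U N)) ∧
    ∃ L : ℝ → ℝ,
      (∀ s : ℝ, 0 < s → Tendsto
        (fun N : ℕ => (1 / (N : ℝ)) *
          ∑ j ∈ Finset.range (⌊s * N⌋₊ + 1), meanOccupation ħ m om β U N j)
        atTop (𝓝 (L s))) ∧
      Tendsto L (𝓝[>] 0) (𝓝 1)

/-- The pair interaction `U_N(x₁, …, x_N) = ∑_{i < j} u_N(xᵢ - xⱼ)`. -/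
def pairInteraction (u : ℕ → ℝ → ℝ) (N : ℕ) (x : Conf N) : ℝ :=
  ∑ i, ∑ j ∈ Finset.Ioi i, u N (x i - x j)

/-- The scaled pair interaction `u_N(x) = b_N u(α_N x)`. -/
def scaledPair (u : ℝ → ℝ) (b α : ℕ → ℝ) (N : ℕ) (x : ℝ) : ℝ := b N * u (α N * x)

end TrappedBose

end

/-!
# Complete generalized condensation in a slowly opening trap

The one-particle levels of the trap are `ħ ω γ_N (j + 1/2)`, with `γ_N = log N / N`, so a particle
in a mode `j > s N` costs at least the excitation energy `ħ ω s log N`. If the mean excitation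
energy of the `N` particles is `o(N log N)`, then the fraction of the particles in these modes tends
to `0` for every fixed `s > 0` (`sum_occupation_bounds`), and the inner limit is already `1`
(`completeGBEC_of_smallFreeMean`). It remains to bound the mean excitation energy
`⟨h⟩` of the interacting thermal state, where `h ≥ 0` is the energy of the kinetic term and the trap
above the ground state energy `e₀` of the ideal gas (`mean_excitation_le`).

Let `U ≥ -L`. Jensen's inequality for the exponential function gives
`exp (β/2 ⟨h⟩) ≤ Z⁻¹ ∑ exp (-β E_k + β/2 h_k)`, where `h_k` is the mean of `h` in the
`k`-th eigenvector, and `E_k ≥ e₀ + h_k - L` leaves half of the Boltzmann factor: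
the sum is at most `exp (β (L - e₀)) ∑ exp (-β/2 h_k)`. By Peierls' inequality the last sum is at
most the partition function of the ideal gas at half the inverse temperature, hence at most
`∏_{k ≤ N} (1 - r^k)⁻¹` with `r = exp (-β/2 ħ ω γ_N)`, whose logarithm is at most
`(1 + log N) / (β/2 ħ ω γ_N) = O(N)` (`tsum_monotone_exp_le`, `tsum_exp_energy_le`). In the other
direction, `Z ≥ exp (-β (e₀ + ⟨U⟩₀))`, by Peierls' inequality with the eigenvectors of the ideal gas
and Jensen's inequality in its thermal state (`partition_lower_bound`). Altogether
`⟨h⟩ ≤ (2/β) (O(N) + β L + β ⟨U⟩₀)`, which is `o(N log N)` for `L = B N` and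
`⟨U⟩₀ = o(N log N)`.

The thermal state exists because the form domain, with the norm of the form, is a Hilbert space
that embeds compactly into the bosonic subspace: the form dominates that of the oscillator,
whose levels tend to infinity (`exists_form_eigenbasis`). The form domain is dense because the
finiteness of `⟨U⟩₀` puts the eigenvectors of the ideal gas into it. The only explicit
diagonalisation is that of the oscillator: the products of Hermite functions (`hermL2`) are
orthonormal, complete, and weak eigenvectors.

For a pair interaction, the density of a wave function `F` along the line of one coordinate is at
most `∫ |∂ᵢ |F|²| ≤ 2 ∫ |F| |∂ᵢF|`, so `∫ |u(xᵢ - xⱼ)| |F|² ≤ 2 ‖u‖₁ ‖F‖ ‖∂ᵢF‖`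
(`lintegral_pair_gComb_le`). This is applied only to the eigenvectors of the ideal gas, which are
finite combinations of Hermite functions. As the kinetic energy per particle of the ideal gas
stays bounded, the free mean of `|U_N|` is at most a constant times `N² ‖u_N‖₁`, which is
`o(N log N)` for `‖u_N‖₁ = o(γ_N)` (`smallFreeMean_pairInteraction`).
-/

noncomputable section

namespace TrappedBose

variable {N : ℕ}

/-! ### Hermite functions of one variable -/

open Polynomial in
/-- The polynomial `p` in the variable `κ x`, times the Gaussian `exp (-(κ x)² / 4)`. -/
def gpoly (κ : ℝ) (p : ℝ[X]) (x : ℝ) : ℝ := p.eval (κ * x) * Real.exp (-(κ * x) ^ 2 / 4)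

open Polynomial in
/-- The action of `κ⁻¹ d/dx` on the polynomial prefactor of a Gaussian `exp (-(κ x)² / 4)`. -/
def gderiv : ℝ[X] →ₗ[ℝ] ℝ[X] :=
  Polynomial.derivative - LinearMap.mulLeft ℝ (C (1 / 2 : ℝ) * X)

open Polynomial in
theorem gderiv_apply (p : ℝ[X]) : gderiv p = derivative p - C (1 / 2 : ℝ) * X * p := rfl

open Polynomial in
/-- The probabilists' Hermite polynomials, over the reals. -/
def herm (n : ℕ) : ℝ[X] := (hermite n).map (Int.castRingHom ℝ)

open Polynomial in
theorem herm_succ (n : ℕ) : herm (n + 1) = X * herm n - derivative (herm n) := by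
  simp [herm, hermite_succ, derivative_map]

open Polynomial in
theorem derivative_herm_succ (n : ℕ) :
    derivative (herm (n + 1)) = ((n : ℝ[X]) + 1) * herm n := by
  induction n with
  | zero => simp [herm]
  | succ k ih =>
    rw [herm_succ (k + 1), derivative_sub, derivative_mul, ih, herm_succ k]
    simp only [derivative_mul, derivative_add, derivative_natCast, derivative_one, derivative_X]
    push_cast
    ring

open Polynomial in
/-- The Hermite equation, in the form of the equation of the harmonic oscillator. -/
theorem gderiv_gderiv_herm (n : ℕ) :
    gderiv (gderiv (herm n)) = C (1 / 4 : ℝ) * (X * (X * herm n)) - C (n + 1 / 2 : ℝ) * herm n := by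
  have key : derivative (derivative (herm n)) - X * derivative (herm n) =
      - ((n : ℝ[X]) * herm n) := by
    cases n with
    | zero => simp [herm]
    | succ k =>
      rw [derivative_herm_succ, herm_succ k]
      simp only [derivative_mul, derivative_add, derivative_natCast, derivative_one]
      push_cast
      ring
  have h2 : (C (1 / 2 : ℝ) : ℝ[X]) * C (1 / 2 : ℝ) = C (1 / 4 : ℝ) := by
    rw [← C_mul]; norm_num
  have h3 : (C (1 / 2 : ℝ) : ℝ[X]) * 2 = 1 := by
    have : (2 : ℝ[X]) = C 2 := rfl
    rw [this, ← C_mul]; norm_num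
  have h4 : (C ((n : ℝ) + 1 / 2) : ℝ[X]) = n + C (1 / 2 : ℝ) := by simp
  rw [h4]
  simp only [gderiv_apply, derivative_sub, derivative_mul, derivative_C, derivative_X]
  linear_combination key + X * (X * herm n) * h2 - X * derivative (herm n) * h3

theorem hasDerivAt_gpoly (κ : ℝ) (p : Polynomial ℝ) (x : ℝ) :
    HasDerivAt (gpoly κ p) (κ * gpoly κ (gderiv p) x) x := by
  have h1 : HasDerivAt (fun x : ℝ => κ * x) κ x := by simpa using (hasDerivAt_id x).const_mul κ
  have h2 : HasDerivAt (fun x : ℝ => p.eval (κ * x)) (p.derivative.eval (κ * x) * κ) x :=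
    (p.hasDerivAt (κ * x)).comp x h1
  have h3 : HasDerivAt (fun x : ℝ => -(κ * x) ^ 2 / 4) (-(2 * (κ * x) * κ) / 4) x := by
    simpa using ((h1.pow 2).neg).div_const 4
  refine (h2.mul h3.exp).congr_deriv ?_
  simp only [gpoly, gderiv_apply, Polynomial.eval_sub, Polynomial.eval_mul, Polynomial.eval_C,
    Polynomial.eval_X]
  ring

theorem contDiff_gpoly (κ : ℝ) (p : Polynomial ℝ) {n : WithTop ℕ∞} : ContDiff ℝ n (gpoly κ p) := by
  unfold gpoly
  refine ContDiff.mul ?_ ?_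
  · have h : ContDiff ℝ n fun y : ℝ => p.eval y := by
      simpa using p.contDiff_aeval (𝕜 := ℝ) n
    exact h.comp (contDiff_const.mul contDiff_id)
  · exact ((contDiff_const.mul contDiff_id).pow 2).neg.div_const 4 |>.exp

theorem integrable_poly_mul_gauss (p : Polynomial ℝ) :
    Integrable fun x : ℝ => p.eval x * Real.exp (-(1 / 2) * x ^ 2) := by
  induction p using Polynomial.induction_on' with
  | add p q hp hq =>
    refine (hp.add hq).congr (ae_of_all _ fun x => ?_)
    simp [add_mul]
  | monomial n a =>
    have := (integrable_rpow_mul_exp_neg_mul_sq (b := 1 / 2) (by norm_num) (s := n)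
      (by have : (0 : ℝ) ≤ n := n.cast_nonneg
          linarith)).const_mul a
    simpa [Polynomial.eval_monomial, mul_assoc] using this

theorem integrable_gpoly_mul {κ : ℝ} (hκ : κ ≠ 0) (p q : Polynomial ℝ) :
    Integrable fun x : ℝ => gpoly κ p x * gpoly κ q x := by
  have := (integrable_poly_mul_gauss (p * q)).comp_mul_left' hκ
  refine this.congr (ae_of_all _ fun x => ?_)
  simp only [gpoly, Polynomial.eval_mul]
  rw [show -(1 / 2) * (κ * x) ^ 2 = -(κ * x) ^ 2 / 4 + -(κ * x) ^ 2 / 4 by ring, Real.exp_add]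
  ring

/-- The `L²` inner product of two polynomials times a Gaussian. -/
def ginner (κ : ℝ) (p q : Polynomial ℝ) : ℝ := ∫ x, gpoly κ p x * gpoly κ q x

theorem gpoly_add (κ : ℝ) (p q : Polynomial ℝ) (x : ℝ) :
    gpoly κ (p + q) x = gpoly κ p x + gpoly κ q x := by
  simp [gpoly, add_mul]

theorem gpoly_sub (κ : ℝ) (p q : Polynomial ℝ) (x : ℝ) :
    gpoly κ (p - q) x = gpoly κ p x - gpoly κ q x := by
  simp [gpoly, sub_mul]

theorem gpoly_smul (κ a : ℝ) (p : Polynomial ℝ) (x : ℝ) :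
    gpoly κ (a • p) x = a * gpoly κ p x := by
  simp [gpoly, mul_assoc]

theorem gpoly_C_mul (κ a : ℝ) (p : Polynomial ℝ) (x : ℝ) :
    gpoly κ (Polynomial.C a * p) x = a * gpoly κ p x := by
  simp [gpoly, mul_assoc]

theorem gpoly_X_mul (κ : ℝ) (p : Polynomial ℝ) (x : ℝ) :
    gpoly κ (Polynomial.X * p) x = κ * x * gpoly κ p x := by
  simp [gpoly, mul_assoc]

theorem ginner_comm (κ : ℝ) (p q : Polynomial ℝ) : ginner κ p q = ginner κ q p := by
  simp [ginner, mul_comm]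

theorem ginner_smul_left (κ a : ℝ) (p q : Polynomial ℝ) :
    ginner κ (a • p) q = a * ginner κ p q := by
  simp only [ginner, gpoly_smul, mul_assoc]
  exact integral_const_mul _ _

/-- The derivative is antisymmetric. -/
theorem ginner_gderiv {κ : ℝ} (hκ : κ ≠ 0) (p q : Polynomial ℝ) :
    ginner κ p (gderiv q) = - ginner κ (gderiv p) q := by
  have := integral_mul_deriv_eq_deriv_mul_of_integrable
    (u := gpoly κ p) (v := gpoly κ q) (u' := fun x => κ * gpoly κ (gderiv p) x)
    (v' := fun x => κ * gpoly κ (gderiv q) x)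
    (fun x _ => hasDerivAt_gpoly κ p x) (fun x _ => hasDerivAt_gpoly κ q x)
    (by simpa [Pi.mul_def, mul_left_comm] using (integrable_gpoly_mul hκ p (gderiv q)).const_mul κ)
    (by simpa [Pi.mul_def, mul_assoc] using (integrable_gpoly_mul hκ (gderiv p) q).const_mul κ)
    (integrable_gpoly_mul hκ p q)
  simp only [mul_left_comm _ κ, mul_assoc, integral_const_mul] at this
  have h2 : κ * ginner κ p (gderiv q) = κ * (- ginner κ (gderiv p) q) := by
    rw [mul_neg]; exact this
  exact mul_left_cancel₀ hκ h2

theorem ginner_herm {κ : ℝ} (hκ : κ ≠ 0) {m n : ℕ} (hmn : m ≠ n) :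
    ginner κ (herm m) (herm n) = 0 := by
  have h1 : ginner κ (herm m) (gderiv (gderiv (herm n))) =
      ginner κ (gderiv (gderiv (herm m))) (herm n) := by
    rw [ginner_gderiv hκ, ginner_gderiv hκ (gderiv (herm m)) (herm n) |> neg_eq_iff_eq_neg.2]
  have e : ∀ m n : ℕ, ginner κ (herm m) (gderiv (gderiv (herm n))) =
      1 / 4 * ginner κ (Polynomial.X * herm m) (Polynomial.X * herm n)
        - (n + 1 / 2) * ginner κ (herm m) (herm n) := by
    intro m n
    rw [gderiv_gderiv_herm]
    unfold ginner
    rw [← integral_const_mul, ← integral_const_mul, ← integral_sub]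
    · congr 1
      ext x
      simp only [gpoly_sub, gpoly_C_mul, gpoly_X_mul]
      ring
    · exact (integrable_gpoly_mul hκ _ _).const_mul _
    · exact (integrable_gpoly_mul hκ _ _).const_mul _
  rw [ginner_comm κ (gderiv _), e, e, ginner_comm κ (herm n),
    ginner_comm κ (Polynomial.X * herm n)] at h1
  have h3 : ((m : ℝ) - n) * ginner κ (herm m) (herm n) = 0 := by linarith
  rcases mul_eq_zero.1 h3 with h | h
  · exact absurd (Nat.cast_injective (sub_eq_zero.1 h)) hmn
  · exact h

theorem ginner_herm_self_pos {κ : ℝ} (hκ : κ ≠ 0) (n : ℕ) : 0 < ginner κ (herm n) (herm n) := by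
  have hne : herm n ≠ 0 := ((Polynomial.hermite_monic n).map (Int.castRingHom ℝ)).ne_zero
  obtain ⟨x, hx⟩ : ∃ x : ℝ, (herm n).eval x ≠ 0 := by
    by_contra! h
    exact hne (Polynomial.funext (by simpa using h))
  have hc : Continuous fun x => gpoly κ (herm n) x * gpoly κ (herm n) x :=
    ((contDiff_gpoly κ (herm n) (n := 0)).continuous).mul
      ((contDiff_gpoly κ (herm n) (n := 0)).continuous)
  refine (integral_pos_iff_support_of_nonneg (fun x => mul_self_nonneg _)
    (integrable_gpoly_mul hκ _ _)).2 ?_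
  refine hc.isOpen_support.measure_pos _ ⟨κ⁻¹ * x, ?_⟩
  simp [gpoly, hκ, hx, Real.exp_ne_zero]

/-- The Hermite polynomials, normalised so that the Hermite functions have unit norm. -/
def hermN (κ : ℝ) (n : ℕ) : Polynomial ℝ := (Real.sqrt (ginner κ (herm n) (herm n)))⁻¹ • herm n

theorem ginner_hermN {κ : ℝ} (hκ : κ ≠ 0) (m n : ℕ) :
    ginner κ (hermN κ m) (hermN κ n) = if m = n then 1 else 0 := by
  unfold hermN
  rw [ginner_smul_left, ginner_comm κ (herm m) (_ • _), ginner_smul_left]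
  split_ifs with h
  · subst h
    have h0 := ginner_herm_self_pos hκ m
    rw [← mul_assoc, ← mul_inv, Real.mul_self_sqrt h0.le, inv_mul_cancel₀ h0.ne']
  · rw [ginner_herm hκ (Ne.symm h)]; simp

theorem gderiv_gderiv_hermN (κ : ℝ) (n : ℕ) :
    gderiv (gderiv (hermN κ n)) = (1 / 4 : ℝ) • (Polynomial.X * (Polynomial.X * hermN κ n))
      - (n + 1 / 2 : ℝ) • hermN κ n := by
  unfold hermN
  rw [map_smul, map_smul, gderiv_gderiv_herm, smul_sub, Polynomial.smul_eq_C_mul,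
    Polynomial.smul_eq_C_mul, Polynomial.smul_eq_C_mul, Polynomial.smul_eq_C_mul,
    Polynomial.smul_eq_C_mul]
  ring

/-- The normalised Hermite polynomials are a basis of the polynomials. -/
def hermBasis {κ : ℝ} (hκ : κ ≠ 0) : Module.Basis ℕ ℝ (Polynomial ℝ) :=
  Polynomial.Sequence.basis
    { elems' := hermN κ
      degree_eq' := fun n => by
        have h0 := ginner_herm_self_pos hκ n
        have : (Real.sqrt (ginner κ (herm n) (herm n)))⁻¹ ≠ 0 := by positivity
        rw [hermN, Polynomial.smul_eq_C_mul, Polynomial.degree_C_mul this, herm,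
          (Polynomial.hermite_monic n).degree_map, Polynomial.degree_hermite] }
    (fun n => by
      rw [isUnit_iff_ne_zero, Ne, Polynomial.leadingCoeff_eq_zero]
      exact Polynomial.Sequence.ne_zero _ n)

theorem hermBasis_apply {κ : ℝ} (hκ : κ ≠ 0) (n : ℕ) : hermBasis hκ n = hermN κ n :=
  Polynomial.Sequence.basis_eq_self (S := _) _ n

/-! ### Hermite functions of several variables -/

/-- The product of the functions `gpoly κ (P i)` of the coordinates. -/
def gprod (κ : ℝ) (P : Fin N → Polynomial ℝ) (x : Conf N) : ℝ := ∏ i, gpoly κ (P i) (x i)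

theorem contDiff_gprod (κ : ℝ) (P : Fin N → Polynomial ℝ) {n : WithTop ℕ∞} :
    ContDiff ℝ n (gprod κ P) :=
  contDiff_prod fun i _ => (contDiff_gpoly κ (P i)).comp (contDiff_apply ℝ ℝ i)

theorem gprod_update (κ : ℝ) (P : Fin N → Polynomial ℝ) (i : Fin N) (p : Polynomial ℝ)
    (x : Conf N) : gprod κ (Function.update P i p) x =
      gpoly κ p (x i) * ∏ j ∈ Finset.univ.erase i, gpoly κ (P j) (x j) := by
  rw [gprod, ← Finset.mul_prod_erase _ _ (Finset.mem_univ i), Function.update_self]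
  congr 1
  refine Finset.prod_congr rfl fun j hj => ?_
  rw [Function.update_of_ne (Finset.ne_of_mem_erase hj)]

theorem gprod_eq_mul_erase (κ : ℝ) (P : Fin N → Polynomial ℝ) (i : Fin N) (x : Conf N) :
    gprod κ P x = gpoly κ (P i) (x i) * ∏ j ∈ Finset.univ.erase i, gpoly κ (P j) (x j) := by
  rw [gprod, ← Finset.mul_prod_erase _ _ (Finset.mem_univ i)]

theorem gprod_update_X_mul (κ : ℝ) (P : Fin N → Polynomial ℝ) (i : Fin N) (x : Conf N) :
    gprod κ (Function.update P i (Polynomial.X * P i)) x = κ * x i * gprod κ P x := by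
  rw [gprod_update, gprod_eq_mul_erase κ P i, gpoly_X_mul]
  ring

theorem fderiv_gprod (κ : ℝ) (P : Fin N → Polynomial ℝ) (i : Fin N) (x : Conf N) :
    fderiv ℝ (gprod κ P) x (Pi.single i 1) =
      κ * gprod κ (Function.update P i (gderiv (P i))) x := by
  have hd : HasFDerivAt (gprod κ P) (fderiv ℝ (gprod κ P) x) x :=
    ((contDiff_gprod κ P (n := 1)).differentiable (by norm_num) x).hasFDerivAt
  have h1 : HasDerivAt (fun t : ℝ => Function.update x i t) (Pi.single i 1) (x i) :=
    hasDerivAt_update x i (x i)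
  have h2 : HasDerivAt (fun t : ℝ => gprod κ P (Function.update x i t))
      (fderiv ℝ (gprod κ P) x (Pi.single i 1)) (x i) := by
    refine HasFDerivAt.comp_hasDerivAt (x i) (l := gprod κ P) ?_ h1
    rwa [Function.update_eq_self]
  have h3 : HasDerivAt (fun t : ℝ => gprod κ P (Function.update x i t))
      ((κ * gpoly κ (gderiv (P i)) (x i)) *
        ∏ j ∈ Finset.univ.erase i, gpoly κ (P j) (x j)) (x i) := by
    refine ((hasDerivAt_gpoly κ (P i) (x i)).mul_const _).congr_of_eventuallyEq
      (Eventually.of_forall fun t => ?_)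
    show gprod κ P (Function.update x i t) = _
    rw [gprod_eq_mul_erase κ P i, Function.update_self]
    congr 1
    refine Finset.prod_congr rfl fun j hj => ?_
    rw [Function.update_of_ne (Finset.ne_of_mem_erase hj)]
  rw [h2.unique h3, gprod_update, mul_assoc]

theorem integrable_gprod_mul {κ : ℝ} (hκ : κ ≠ 0) (P Q : Fin N → Polynomial ℝ) :
    Integrable fun x : Conf N => gprod κ P x * gprod κ Q x := by
  have := Integrable.fintype_prod (𝕜 := ℝ) (μ := fun _ : Fin N => (volume : Measure ℝ))
    (f := fun i x => gpoly κ (P i) x * gpoly κ (Q i) x)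
    fun i => integrable_gpoly_mul hκ (P i) (Q i)
  refine this.congr (ae_of_all _ fun x => ?_)
  simp [gprod, Finset.prod_mul_distrib]

theorem memLp_gprod {κ : ℝ} (hκ : κ ≠ 0) (P : Fin N → Polynomial ℝ) :
    MemLp (gprod κ P) 2 := by
  rw [memLp_two_iff_integrable_sq (contDiff_gprod κ P (n := 0)).continuous.aestronglyMeasurable]
  simpa [sq] using integrable_gprod_mul hκ P P

open Classical in
/-- The `L²` element of `gprod κ P`, which is square integrable for `κ ≠ 0`. At `κ = 0`, where the
Gaussian is constant, the value is `0`. -/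
def gL2 (κ : ℝ) (P : Fin N → Polynomial ℝ) : L2 N :=
  if hκ : κ ≠ 0 then ((memLp_gprod hκ P).ofReal (K := ℂ)).toLp _ else 0

theorem coeFn_gL2 {κ : ℝ} (hκ : κ ≠ 0) (P : Fin N → Polynomial ℝ) :
    gL2 κ P =ᵐ[volume] fun x => (gprod κ P x : ℂ) := by
  rw [gL2, dif_pos hκ]
  exact MemLp.coeFn_toLp _

theorem inner_gL2_left {κ : ℝ} (hκ : κ ≠ 0) (P : Fin N → Polynomial ℝ) (ψ : L2 N) :
    ⟪gL2 κ P, ψ⟫_ℂ = ∫ x, (gprod κ P x : ℂ) * ψ x := by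
  rw [L2.inner_def]
  refine integral_congr_ae ?_
  filter_upwards [coeFn_gL2 hκ P] with x hx
  rw [hx, RCLike.inner_apply, Complex.conj_ofReal, mul_comm]

theorem integrable_gprod_mul_L2 {κ : ℝ} (hκ : κ ≠ 0) (P : Fin N → Polynomial ℝ) (ψ : L2 N) :
    Integrable fun x => (gprod κ P x : ℂ) * ψ x := by
  refine (L2.integrable_inner (𝕜 := ℂ) (gL2 κ P) ψ).congr ?_
  filter_upwards [coeFn_gL2 hκ P] with x hx
  rw [hx, RCLike.inner_apply, Complex.conj_ofReal, mul_comm]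

theorem inner_gL2_gL2 {κ : ℝ} (hκ : κ ≠ 0) (P Q : Fin N → Polynomial ℝ) :
    ⟪gL2 κ P, gL2 κ Q⟫_ℂ = ((∏ i, ginner κ (P i) (Q i) : ℝ) : ℂ) := by
  rw [inner_gL2_left hκ]
  have : ∫ x, (gprod κ P x : ℂ) * gL2 κ Q x = ∫ x, ((gprod κ P x * gprod κ Q x : ℝ) : ℂ) := by
    refine integral_congr_ae ?_
    filter_upwards [coeFn_gL2 hκ Q] with x hx
    rw [hx]; push_cast; rfl
  rw [this, integral_complex_ofReal]
  congr 1
  simp only [gprod, ← Finset.prod_mul_distrib, ginner]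
  exact integral_fintype_prod_volume_eq_prod fun i x => gpoly κ (P i) x * gpoly κ (Q i) x

/-- The Hermite functions on `ℝ^N`: the products of normalised Hermite functions of the
coordinates, indexed by the quantum numbers of the particles. -/
def hermL2 (κ : ℝ) (a : Fin N → ℕ) : L2 N := gL2 κ fun i => hermN κ (a i)

theorem orthonormal_hermL2 {κ : ℝ} (hκ : κ ≠ 0) :
    Orthonormal ℂ (hermL2 κ : (Fin N → ℕ) → L2 N) := by
  rw [orthonormal_iff_ite]
  intro a b
  rw [hermL2, hermL2, inner_gL2_gL2 hκ]
  simp only [ginner_hermN hκ]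
  rw [Finset.prod_ite_zero]
  by_cases hab : a = b
  · simp [hab]
  · simp [hab, ← funext_iff]

/-! ### Completeness of the Hermite functions -/

/-- The `L²` pairing with a fixed function, as a multilinear map of the polynomial factors. -/
def gPairing {κ : ℝ} (hκ : κ ≠ 0) (ψ : L2 N) :
    MultilinearMap ℝ (fun _ : Fin N => Polynomial ℝ) ℂ where
  toFun P := ∫ x, (gprod κ P x : ℂ) * ψ x
  map_update_add' P i p q := by
    rename_i inst
    have : inst = instDecidableEqFin N := Subsingleton.elim _ _
    subst this
    rw [← integral_add (integrable_gprod_mul_L2 hκ _ ψ) (integrable_gprod_mul_L2 hκ _ ψ)]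
    congr 1
    ext x
    rw [gprod_update, gprod_update, gprod_update, gpoly_add]
    push_cast
    ring
  map_update_smul' P i a p := by
    rename_i inst
    have : inst = instDecidableEqFin N := Subsingleton.elim _ _
    subst this
    rw [← integral_smul]
    congr 1
    ext x
    rw [gprod_update, gprod_update, gpoly_smul, Complex.real_smul]
    push_cast
    ring

theorem gPairing_eq_zero {κ : ℝ} (hκ : κ ≠ 0) {ψ : L2 N}
    (h : ∀ a : Fin N → ℕ, ⟪hermL2 κ a, ψ⟫_ℂ = 0) (P : Fin N → Polynomial ℝ) :
    ∫ x, (gprod κ P x : ℂ) * ψ x = 0 := by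
  have : gPairing hκ ψ = 0 := by
    refine Module.Basis.ext_multilinear (fun _ => hermBasis hκ) fun a => ?_
    simp only [hermBasis_apply, zero_apply]
    have := h a
    rwa [hermL2, inner_gL2_left hκ] at this
  exact congrFun (congrArg DFunLike.coe this) P

/-- The moments, in any direction `t`, of a polynomial times a Gaussian times `ψ` vanish if `ψ` is
orthogonal to the Hermite functions. -/
theorem integral_pow_mul_gprod_eq_zero {κ : ℝ} (hκ : κ ≠ 0) {ψ : L2 N}
    (h : ∀ a : Fin N → ℕ, ⟪hermL2 κ a, ψ⟫_ℂ = 0) (t : Fin N → ℝ) (n : ℕ) :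
    ∀ P : Fin N → Polynomial ℝ,
      Integrable (fun x => ((∑ i, t i * x i : ℝ) : ℂ) ^ n * ((gprod κ P x : ℂ) * ψ x)) ∧
      ∫ x, ((∑ i, t i * x i : ℝ) : ℂ) ^ n * ((gprod κ P x : ℂ) * ψ x) = 0 := by
  induction n with
  | zero =>
    intro P
    simpa using ⟨integrable_gprod_mul_L2 hκ P ψ, gPairing_eq_zero hκ h P⟩
  | succ n ih =>
    intro P
    -- each factor `κ xᵢ` is absorbed into the `i`-th polynomial
    have e : (fun x : Conf N => ((∑ i, t i * x i : ℝ) : ℂ) ^ (n + 1) * ((gprod κ P x : ℂ) * ψ x)) =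
        fun x => ∑ i, ((t i / κ : ℝ) : ℂ) * (((∑ i, t i * x i : ℝ) : ℂ) ^ n *
          ((gprod κ (Function.update P i (Polynomial.X * P i)) x : ℂ) * ψ x)) := by
      ext x
      have : ∀ i, ((t i / κ : ℝ) : ℂ) * (((∑ i, t i * x i : ℝ) : ℂ) ^ n *
          ((gprod κ (Function.update P i (Polynomial.X * P i)) x : ℂ) * ψ x)) =
          ((t i * x i : ℝ) : ℂ) * (((∑ i, t i * x i : ℝ) : ℂ) ^ n * ((gprod κ P x : ℂ) * ψ x)) := by
        intro i
        rw [gprod_update_X_mul]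
        have : (κ : ℂ) ≠ 0 := by exact_mod_cast hκ
        push_cast
        field_simp
      simp_rw [this]
      rw [← Finset.sum_mul, pow_succ']
      push_cast
      ring
    rw [e]
    have hi : ∀ i ∈ Finset.univ, Integrable fun x => ((t i / κ : ℝ) : ℂ) *
        (((∑ i, t i * x i : ℝ) : ℂ) ^ n *
          ((gprod κ (Function.update P i (Polynomial.X * P i)) x : ℂ) * ψ x)) :=
      fun i _ => (ih _).1.const_mul _
    refine ⟨integrable_finsetSum _ hi, ?_⟩
    rw [integral_finsetSum _ hi]
    refine Finset.sum_eq_zero fun i _ => ?_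
    rw [integral_const_mul, (ih _).2, mul_zero]

theorem memLp_exp_mul_gprod_one {κ : ℝ} (hκ : κ ≠ 0) (t : Fin N → ℝ) :
    MemLp (fun x : Conf N => Real.exp (∑ i, t i * x i) * gprod κ (fun _ => 1) x) 2 := by
  have hc : Continuous fun x : Conf N => Real.exp (∑ i, t i * x i) * gprod κ (fun _ => 1) x := by
    have := (contDiff_gprod (N := N) κ (fun _ => 1) (n := 0)).continuous
    fun_prop
  rw [memLp_two_iff_integrable_sq hc.aestronglyMeasurable]
  have h1 : ∀ s : ℝ, Integrable fun y : ℝ => Real.exp (2 * s * y - (κ * y) ^ 2 / 2) := by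
    intro s
    have hb : 0 < κ ^ 2 / 2 := by positivity
    have := ((integrable_exp_neg_mul_sq hb).comp_sub_right (2 * s / κ ^ 2)).const_mul
      (Real.exp (2 * s ^ 2 / κ ^ 2))
    refine this.congr (ae_of_all _ fun y => ?_)
    simp only
    rw [← Real.exp_add]
    congr 1
    field_simp
    ring
  have := Integrable.fintype_prod (𝕜 := ℝ) (μ := fun _ : Fin N => (volume : Measure ℝ))
    (f := fun i y => Real.exp (2 * t i * y - (κ * y) ^ 2 / 2)) fun i => h1 (t i)
  refine this.congr (ae_of_all _ fun x => ?_)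
  simp only [gprod, gpoly, Polynomial.eval_one, one_mul]
  rw [← Real.exp_sum, ← Real.exp_sum, ← Real.exp_add, ← Real.exp_nat_mul]
  congr 1
  rw [← Finset.sum_add_distrib, Finset.mul_sum]
  refine Finset.sum_congr rfl fun i _ => ?_
  push_cast
  ring

theorem integrable_exp_abs_mul_gprod {κ : ℝ} (hκ : κ ≠ 0) (t : Fin N → ℝ) (ψ : L2 N) :
    Integrable fun x : Conf N =>
      Real.exp |∑ i, t i * x i| * ‖(gprod κ (fun _ => 1) x : ℂ) * ψ x‖ := by
  have h1 : ∀ t : Fin N → ℝ, Integrable fun x : Conf N =>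
      (Real.exp (∑ i, t i * x i) * gprod κ (fun _ => 1) x) * ‖ψ x‖ := fun t =>
    (memLp_exp_mul_gprod_one hκ t).integrable_mul (Lp.memLp ψ).norm
  have hnn : ∀ x : Conf N, 0 ≤ gprod κ (fun _ => 1) x := fun x =>
    Finset.prod_nonneg fun i _ => by simp [gpoly, Real.exp_nonneg]
  have hm : AEStronglyMeasurable (fun x : Conf N =>
      Real.exp |∑ i, t i * x i| * ‖(gprod κ (fun _ => 1) x : ℂ) * ψ x‖) volume := by
    have hg := (contDiff_gprod (N := N) κ (fun _ => 1) (n := 0)).continuous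
    have hc : Continuous fun x : Conf N => Real.exp |∑ i, t i * x i| := by fun_prop
    have hg' : Continuous fun x : Conf N => (gprod κ (fun _ => 1) x : ℂ) := by fun_prop
    exact hc.aestronglyMeasurable.mul
      (hg'.aestronglyMeasurable.mul (Lp.aestronglyMeasurable ψ)).norm
  refine ((h1 t).add (h1 (-t))).mono' hm (ae_of_all _ fun x => ?_)
  rw [Real.norm_of_nonneg (by positivity), norm_mul, Complex.norm_real,
    Real.norm_of_nonneg (hnn x), Pi.add_apply, ← add_mul, ← add_mul, mul_assoc]
  refine mul_le_mul_of_nonneg_right ?_ (mul_nonneg (hnn x) (norm_nonneg _))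
  simp only [Pi.neg_apply, neg_mul, Finset.sum_neg_distrib]
  rcases abs_cases (∑ i, t i * x i) with h | h <;> rw [h.1]
  · linarith [Real.exp_pos (-∑ i, t i * x i)]
  · linarith [Real.exp_pos (∑ i, t i * x i)]

/-- If all moments `∫ sⁿ g` vanish and `exp |s| g` is integrable, then `∫ exp (i s) g` vanishes. -/
theorem integral_cexp_mul_eq_zero_of_moments {X : Type*} [MeasurableSpace X] {μ : Measure X}
    {s : X → ℝ} {g : X → ℂ} (hn : ∀ n : ℕ, Integrable (fun x => (s x : ℂ) ^ n * g x) μ)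
    (h0 : ∀ n : ℕ, ∫ x, (s x : ℂ) ^ n * g x ∂μ = 0)
    (hb : Integrable (fun x => Real.exp |s x| * ‖g x‖) μ) :
    ∫ x, Complex.exp (s x * Complex.I) * g x ∂μ = 0 := by
  have e : ∀ (n : ℕ) (x : X), ((s x : ℂ) * Complex.I) ^ n / (n.factorial : ℂ) * g x =
      (Complex.I ^ n / (n.factorial : ℂ)) * ((s x : ℂ) ^ n * g x) := by
    intro n x
    rw [mul_pow]
    ring
  have hexp : ∀ z : ℂ, HasSum (fun n : ℕ => z ^ n / (n.factorial : ℂ)) (Complex.exp z) := by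
    intro z
    rw [Complex.exp_eq_exp_ℂ]
    exact NormedSpace.expSeries_div_hasSum_exp z
  have h1 : ∀ n : ℕ, AEStronglyMeasurable
      (fun x => ((s x : ℂ) * Complex.I) ^ n / (n.factorial : ℂ) * g x) μ := by
      intro n
      simp only [e]
      exact ((hn n).const_mul _).aestronglyMeasurable
  have h2 : ∀ x, HasSum (fun n : ℕ => |s x| ^ n / n.factorial * ‖g x‖)
      (Real.exp |s x| * ‖g x‖) := by
    intro x
    refine HasSum.mul_right _ ?_
    rw [Real.exp_eq_exp_ℝ]
    exact NormedSpace.expSeries_div_hasSum_exp |s x|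
  have key : HasSum (fun n : ℕ => ∫ x, ((s x : ℂ) * Complex.I) ^ n / (n.factorial : ℂ) * g x ∂μ)
     (∫ x, Complex.exp (s x * Complex.I) * g x ∂μ) := by
    refine hasSum_integral_of_dominated_convergence (fun n x => |s x| ^ n / n.factorial * ‖g x‖)
      h1 ?_ ?_ ?_ ?_
    · exact fun n => ae_of_all _ fun x => by
       rw [norm_mul, norm_div, norm_pow, norm_mul, Complex.norm_I, mul_one, Complex.norm_real,
        Real.norm_eq_abs, Complex.norm_natCast]
    · exact (ae_of_all _ fun x => (h2 x).summable)
    · simp only [(h2 _).tsum_eq]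
      exact hb
    · exact (ae_of_all _ fun x => (hexp _).mul_right _)
  simp only [e, integral_const_mul, h0, mul_zero] at key
  exact key.unique hasSum_zero

theorem integral_cexp_mul_gprod_eq_zero {κ : ℝ} (hκ : κ ≠ 0) {ψ : L2 N}
    (h : ∀ a : Fin N → ℕ, ⟪hermL2 κ a, ψ⟫_ℂ = 0) (t : Fin N → ℝ) :
    ∫ x : Conf N, Complex.exp ((∑ i, t i * x i : ℝ) * Complex.I) *
      ((gprod κ (fun _ => 1) x : ℂ) * ψ x) = 0 :=
  integral_cexp_mul_eq_zero_of_moments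
    (fun n => (integral_pow_mul_gprod_eq_zero hκ h t n _).1)
    (fun n => (integral_pow_mul_gprod_eq_zero hκ h t n _).2)
    (integrable_exp_abs_mul_gprod hκ t ψ)

/-- A real integrable function with vanishing Fourier transform vanishes. -/
theorem ae_eq_zero_of_fourier_real {f : Conf N → ℝ} (hf : Integrable f)
    (h : ∀ t : Fin N → ℝ, ∫ x : Conf N, Complex.exp ((∑ i, t i * x i : ℝ) * Complex.I) * f x = 0) :
    f =ᵐ[volume] 0 := by
  have hfin : ∀ {g : Conf N → ℝ}, Integrable g →
      IsFiniteMeasure ((volume : Measure (Conf N)).withDensity fun x => ENNReal.ofReal (g x)) :=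
    fun hg => isFiniteMeasure_withDensity_ofReal hg.2
  have hneg : Integrable fun x => -f x := hf.neg
  have := hfin hf
  have : IsFiniteMeasure ((volume : Measure (Conf N)).withDensity fun x =>
    ENNReal.ofReal (-f x)) := hfin hf.neg
  have hexp : ∀ t : Fin N → ℝ, Continuous fun x : Conf N =>
    Complex.exp ((∑ i, t i * x i : ℝ) * Complex.I) := fun t => by fun_prop
  have hint : ∀ {g : Conf N → ℝ}, Integrable g → ∀ t : Fin N → ℝ, Integrable fun x : Conf N =>
      Complex.exp ((∑ i, t i * x i : ℝ) * Complex.I) * g x := by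
    intro g hg t
    refine hg.ofReal.bdd_mul (c := 1) (hexp t).aestronglyMeasurable (ae_of_all _ fun x => ?_)
    rw [Complex.norm_exp_ofReal_mul_I]
  have hchar : ∀ {g : Conf N → ℝ}, Integrable g → ∀ t : Fin N → ℝ,
      ∫ x : Conf N, Complex.exp ((∑ i, t i * x i : ℝ) * Complex.I)
        ∂((volume : Measure (Conf N)).withDensity fun x => ENNReal.ofReal (g x)) =
      ∫ x : Conf N, Complex.exp ((∑ i, t i * x i : ℝ) * Complex.I) * (max (g x) 0 : ℝ) := by
    intro g hg t
    rw [integral_withDensity_eq_integral_toReal_smul₀ hg.aemeasurable.ennreal_ofReal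
      (ae_of_all _ fun x => ENNReal.ofReal_lt_top)]
    refine integral_congr_ae (ae_of_all _ fun x => ?_)
    simp only
    rw [ENNReal.toReal_ofReal', Complex.real_smul, mul_comm]
  have heq : ((volume : Measure (Conf N)).withDensity fun x => ENNReal.ofReal (f x)) =
      (volume : Measure (Conf N)).withDensity fun x => ENNReal.ofReal (-f x) := by
    refine Measure.ext_of_charFunDual (funext fun L => ?_)
    have hL : ∀ x : Conf N, L x = ∑ i, L (Pi.single i 1) * x i := by
      intro x
      conv_lhs => rw [← Finset.univ_sum_single x, map_sum]
      refine Finset.sum_congr rfl fun i _ => ?_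
      have : (Pi.single i (x i) : Conf N) = x i • Pi.single i (1 : ℝ) := by
        rw [← Pi.single_smul]; simp
      rw [this, map_smul, smul_eq_mul, mul_comm]
    have hL' : (fun x : Conf N => Complex.exp (L x * Complex.I)) = fun x =>
        Complex.exp ((∑ i, L (Pi.single i 1) * x i : ℝ) * Complex.I) := by
      funext x
      rw [hL x]
    rw [charFunDual_apply, charFunDual_apply, hL']
    rw [hchar hf, hchar hneg, ← sub_eq_zero, ← integral_sub, ← h fun i => L (Pi.single i 1)]
    · refine integral_congr_ae (ae_of_all _ fun x => ?_)
      simp only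
      rw [← mul_sub, ← Complex.ofReal_sub]
      congr 2
      rcases le_total (f x) 0 with hx | hx
      · rw [max_eq_right hx, max_eq_left (by linarith)]; ring
      · rw [max_eq_left hx, max_eq_right (by linarith)]; ring
    · exact hint hf.pos_part _
    · exact hint hneg.pos_part _
  rw [withDensity_eq_iff hf.aemeasurable.ennreal_ofReal
    (show AEMeasurable (fun x => ENNReal.ofReal (-f x)) from hf.neg.aemeasurable.ennreal_ofReal)]
    at heq
  · filter_upwards [heq] with x hx
    have hx' := congrArg ENNReal.toReal hx
    rw [ENNReal.toReal_ofReal', ENNReal.toReal_ofReal'] at hx'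
    rcases le_total (f x) 0 with h0 | h0
    · rw [max_eq_right h0, max_eq_left (by linarith)] at hx'
      simpa using by linarith
    · rw [max_eq_left h0, max_eq_right (by linarith)] at hx'
      simpa using by linarith
  · have := hf.lintegral_lt_top
    exact this.ne

/-- An integrable function with vanishing Fourier transform vanishes. -/
theorem ae_eq_zero_of_fourier {g : Conf N → ℂ} (hg : Integrable g)
    (h : ∀ t : Fin N → ℝ, ∫ x : Conf N, Complex.exp ((∑ i, t i * x i : ℝ) * Complex.I) * g x = 0) :
    g =ᵐ[volume] 0 := by
  have hre : ∀ {g : Conf N → ℂ}, Integrable g →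
      (∀ t : Fin N → ℝ, ∫ x : Conf N,
        Complex.exp ((∑ i, t i * x i : ℝ) * Complex.I) * g x = 0) →
      (fun x => (g x).re) =ᵐ[volume] 0 := by
    intro g hg h
    refine ae_eq_zero_of_fourier_real hg.re fun t => ?_
    have hint : ∀ {g : Conf N → ℂ}, Integrable g → Integrable fun x : Conf N =>
        Complex.exp ((∑ i, t i * x i : ℝ) * Complex.I) * g x := by
      intro g hg
      have hexp : Continuous fun x : Conf N =>
        Complex.exp ((∑ i, t i * x i : ℝ) * Complex.I) := by fun_prop
      refine hg.bdd_mul (c := 1) hexp.aestronglyMeasurable (ae_of_all _ fun x => ?_)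
      rw [Complex.norm_exp_ofReal_mul_I]
    have h2 : ∫ x : Conf N, Complex.exp ((∑ i, t i * x i : ℝ) * Complex.I) *
        starRingEnd ℂ (g x) = 0 := by
      have := congrArg (starRingEnd ℂ) (h (-t))
      rw [map_zero, ← integral_conj] at this
      rw [← this]
      refine integral_congr_ae (ae_of_all _ fun x => ?_)
      simp only [map_mul, ← Complex.exp_conj, Complex.conj_ofReal, Complex.conj_I]
      congr 2
      simp
    have h3 := congrArg₂ (· + ·) (h t) h2
    simp only [add_zero] at h3
    have hconj : Integrable fun x => starRingEnd ℂ (g x) := by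
      refine hg.norm.mono' (Complex.continuous_conj.comp_aestronglyMeasurable
        hg.aestronglyMeasurable) (ae_of_all _ fun x => ?_)
      simp
    rw [← integral_add (hint hg) (hint hconj)] at h3
    have h4 : ∫ x : Conf N, 2 * (Complex.exp ((∑ i, t i * x i : ℝ) * Complex.I) *
        ((g x).re : ℂ)) = 0 := by
      rw [← h3]
      refine integral_congr_ae (ae_of_all _ fun x => ?_)
      simp only
      rw [← mul_add, Complex.add_conj]
      push_cast
      ring
    rw [integral_const_mul] at h4
    exact (mul_eq_zero.1 h4).resolve_left two_ne_zero
  have h1 := hre hg h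
  have h2 := hre (g := fun x => -Complex.I * g x) (hg.const_mul _) fun t => by
    simp_rw [mul_left_comm _ (-Complex.I)]
    rw [integral_const_mul, h t, mul_zero]
  filter_upwards [h1, h2] with x hx1 hx2
  simp at hx1 hx2
  exact Complex.ext hx1 hx2

/-- The Hermite functions are complete in `L²(ℝ^N)`. -/
theorem eq_zero_of_inner_hermL2 {κ : ℝ} (hκ : κ ≠ 0) {ψ : L2 N}
    (h : ∀ a : Fin N → ℕ, ⟪hermL2 κ a, ψ⟫_ℂ = 0) : ψ = 0 := by
  have := ae_eq_zero_of_fourier (integrable_gprod_mul_L2 hκ (fun _ => 1) ψ)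
    (integral_cexp_mul_gprod_eq_zero hκ h)
  rw [Lp.eq_zero_iff_ae_eq_zero]
  filter_upwards [this] with x hx
  have hpos : gprod κ (fun _ => 1) x ≠ 0 :=
    Finset.prod_ne_zero_iff.2 fun i _ => by simp [gpoly, Real.exp_ne_zero]
  simpa [hpos] using hx

/-- The Hermite functions, as a Hilbert basis of `L²(ℝ^N)`. -/
def hermHilbert {κ : ℝ} (hκ : κ ≠ 0) : HilbertBasis (Fin N → ℕ) ℂ (L2 N) :=
  HilbertBasis.mkOfOrthogonalEqBot (orthonormal_hermL2 hκ) (by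
    rw [Submodule.eq_bot_iff]
    intro ψ hψ
    refine eq_zero_of_inner_hermL2 hκ fun a => ?_
    exact (Submodule.mem_orthogonal _ ψ).1 hψ _ (Submodule.subset_span ⟨a, rfl⟩))

theorem hermHilbert_apply {κ : ℝ} (hκ : κ ≠ 0) (a : Fin N → ℕ) :
    hermHilbert hκ a = hermL2 κ a := by
  simp [hermHilbert]

/-! ### Weak derivatives -/

/-- The product of a real square integrable function and an `L²` element is integrable. -/
theorem integrable_smul_L2 {η : Conf N → ℝ} (hη : MemLp η 2) (φ : L2 N) :
    Integrable fun x => η x • φ x :=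
  memLp_one_iff_integrable.1 ((Lp.memLp φ).smul hη)

/-- A weak derivative can be tested against every smooth function that is square integrable
together with its derivative: compact support is not needed. -/
theorem HasWeakGrad.integral_fderiv {φ : L2 N} {h : Fin N → L2 N} (hw : HasWeakGrad φ h)
    {η : Conf N → ℝ} (hη : ContDiff ℝ ((⊤ : ℕ∞) : WithTop ℕ∞) η) (i : Fin N) (hη2 : MemLp η 2)
    (hη' : MemLp (fun x => fderiv ℝ η x (Pi.single i 1)) 2) :
    ∫ x, fderiv ℝ η x (Pi.single i 1) • φ x = -∫ x, η x • h i x := by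
  -- cut off with `f (x / (n + 1))`, where `f` is a smooth bump
  let f : ContDiffBump (0 : Conf N) := ⟨1, 2, one_pos, one_lt_two⟩
  have hf : ContDiff ℝ ((⊤ : ℕ∞) : WithTop ℕ∞) (f : Conf N → ℝ) := f.contDiff
  have hfd : Differentiable ℝ (f : Conf N → ℝ) := hf.differentiable (by simp)
  obtain ⟨M, hM⟩ : ∃ M : ℝ, ∀ x, ‖fderiv ℝ f x‖ ≤ M :=
    (hf.continuous_fderiv (by simp)).bounded_above_of_compact_support
      (f.hasCompactSupport.fderiv ℝ)
  have hηd : Differentiable ℝ η := hη.differentiable (by simp)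
  let r : ℕ → ℝ := fun n => ((n : ℝ) + 1)⁻¹
  have hr : ∀ n, 0 < r n := fun n => by positivity
  have hr1 : ∀ n, r n ≤ 1 := fun n => inv_le_one_of_one_le₀ (by
    have : (0 : ℝ) ≤ n := n.cast_nonneg
    linarith)
  have hr0 : Tendsto r atTop (𝓝 0) := by
    simpa [r, one_div] using tendsto_one_div_add_atTop_nhds_zero_nat (𝕜 := ℝ)
  let χ : ℕ → Conf N → ℝ := fun n x => f (r n • x)
  have hχ : ∀ n, ContDiff ℝ ((⊤ : ℕ∞) : WithTop ℕ∞) (χ n) := fun n =>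
    hf.comp (contDiff_id.const_smul (r n))
  have hχs : ∀ n, HasCompactSupport (χ n) := fun n =>
    f.hasCompactSupport.comp_homeomorph (Homeomorph.smulOfNeZero (r n) (hr n).ne')
  have hχ' : ∀ n x, fderiv ℝ (χ n) x (Pi.single i 1) =
      r n * fderiv ℝ f (r n • x) (Pi.single i 1) := by
    intro n x
    have h1 : HasFDerivAt (fun x : Conf N => r n • x) (r n • ContinuousLinearMap.id ℝ (Conf N)) x :=
      (hasFDerivAt_id x).const_smul (r n)
    have h2 := ((hfd (r n • x)).hasFDerivAt).comp x h1
    have h3 : fderiv ℝ (χ n) x = _ := h2.fderiv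
    rw [h3]
    simp
  have hprod : ∀ n x, fderiv ℝ (fun x => χ n x * η x) x (Pi.single i 1) =
      χ n x * fderiv ℝ η x (Pi.single i 1) +
        r n * fderiv ℝ f (r n • x) (Pi.single i 1) * η x := by
    intro n x
    have := ((((hχ n).differentiable (by simp)) x).hasFDerivAt.mul (hηd x).hasFDerivAt).fderiv
    have h2 : fderiv ℝ (fun x => χ n x * η x) x = _ := this
    rw [h2]
    simp only [add_apply, smul_apply, smul_eq_mul, hχ']
    ring
  have hχ1 : ∀ x, ∀ᶠ n in atTop, χ n x = 1 := by
    intro x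
    have : Tendsto (fun n => r n * ‖x‖) atTop (𝓝 0) := by simpa using hr0.mul_const ‖x‖
    filter_upwards [this.eventually (ge_mem_nhds one_pos)] with n hn
    refine f.one_of_mem_closedBall ?_
    rw [mem_closedBall_zero_iff, norm_smul, Real.norm_of_nonneg (hr n).le]
    exact hn
  have hχle : ∀ n x, |χ n x| ≤ 1 := fun n x => by
    rw [abs_of_nonneg f.nonneg]
    exact f.le_one
  have hder : ∀ n x, |r n * fderiv ℝ f (r n • x) (Pi.single i 1)| ≤ r n * M := by
    intro n x
    rw [abs_mul, abs_of_pos (hr n)]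
    refine mul_le_mul_of_nonneg_left ?_ (hr n).le
    refine ((fderiv ℝ f (r n • x)).le_opNorm _).trans ?_
    have h1 : ‖(Pi.single i 1 : Conf N)‖ = 1 := by
      rw [Pi.norm_single]
      exact norm_one
    rw [h1, mul_one]
    exact hM _
  have hM0 : 0 ≤ M := (norm_nonneg _).trans (hM 0)
  have hη1 := integrable_smul_L2 hη' φ
  have hη0 := integrable_smul_L2 hη2 φ
  have hηh := integrable_smul_L2 hη2 (h i)
  have hη'c : Continuous fun x => fderiv ℝ η x (Pi.single i 1) :=
    (hη.continuous_fderiv (by simp)).clm_apply continuous_const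
  have lim1 : Tendsto (fun n => ∫ x, fderiv ℝ (fun x => χ n x * η x) x (Pi.single i 1) • φ x)
      atTop (𝓝 (∫ x, fderiv ℝ η x (Pi.single i 1) • φ x)) := by
    refine tendsto_integral_of_dominated_convergence
      (fun x => ‖fderiv ℝ η x (Pi.single i 1) • φ x‖ + M * ‖η x • φ x‖) (fun n => ?_)
      (hη1.norm.add (hη0.norm.const_mul M)) (fun n => ae_of_all _ fun x => ?_)
      (ae_of_all _ fun x => ?_)
    · have hc : Continuous fun x => fderiv ℝ (fun x => χ n x * η x) x (Pi.single i 1) :=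
        (((hχ n).mul hη).continuous_fderiv (by simp)).clm_apply continuous_const
      exact hc.aestronglyMeasurable.smul (Lp.aestronglyMeasurable φ)
    · rw [hprod, norm_smul, norm_smul, norm_smul, ← mul_assoc, ← add_mul]
      refine mul_le_mul_of_nonneg_right ((norm_add_le _ _).trans ?_) (norm_nonneg _)
      rw [norm_mul, norm_mul]
      refine add_le_add ?_ ?_
      · exact mul_le_of_le_one_left (norm_nonneg _) (hχle n x)
      · refine mul_le_mul_of_nonneg_right ((hder n x).trans ?_) (norm_nonneg _)
        exact mul_le_of_le_one_left hM0 (hr1 n)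
    · have h0 : Tendsto (fun n => r n * fderiv ℝ f (r n • x) (Pi.single i 1)) atTop (𝓝 0) := by
        refine squeeze_zero_norm (fun n => hder n x) ?_
        simpa using hr0.mul_const M
      have h1 : Tendsto (fun n => χ n x) atTop (𝓝 1) :=
        tendsto_const_nhds.congr' ((hχ1 x).mono fun n hn => hn.symm)
      simp_rw [hprod]
      have h2 := ((h1.mul_const (fderiv ℝ η x (Pi.single i 1))).add (h0.mul_const (η x))).smul_const
        (φ x)
      simpa using h2
  have lim2 : Tendsto (fun n => -∫ x, (χ n x * η x) • h i x) atTop (𝓝 (-∫ x, η x • h i x)) := by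
    refine (tendsto_integral_of_dominated_convergence
      (fun x => ‖η x • h i x‖) (fun n => ?_) hηh.norm (fun n => ae_of_all _ fun x => ?_)
      (ae_of_all _ fun x => ?_)).neg
    · exact ((hχ n).mul hη).continuous.aestronglyMeasurable.smul (Lp.aestronglyMeasurable (h i))
    · rw [mul_smul, norm_smul]
      exact mul_le_of_le_one_left (norm_nonneg _) (hχle n x)
    · refine tendsto_const_nhds.congr' ((hχ1 x).mono fun n hn => ?_)
      simp only [hn, one_mul]
  refine tendsto_nhds_unique lim1 (lim2.congr fun n => ?_)
  exact (hw i _ ((hχ n).mul hη) (hχs n).mul_right).symm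

/-! ### The Hermite functions as weak eigenvectors of the oscillator -/

theorem memLp_fderiv_gprod {κ : ℝ} (hκ : κ ≠ 0) (P : Fin N → Polynomial ℝ) (i : Fin N) :
    MemLp (fun x => fderiv ℝ (gprod κ P) x (Pi.single i 1)) 2 := by
  simp_rw [fderiv_gprod]
  exact (memLp_gprod hκ _).const_mul κ

/-- The gradient of `gL2 κ P`. -/
def gGrad (κ : ℝ) (P : Fin N → Polynomial ℝ) (i : Fin N) : L2 N :=
  (κ : ℂ) • gL2 κ (Function.update P i (gderiv (P i)))

theorem coeFn_gGrad {κ : ℝ} (hκ : κ ≠ 0) (P : Fin N → Polynomial ℝ) (i : Fin N) :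
    gGrad κ P i =ᵐ[volume] fun x => ((fderiv ℝ (gprod κ P) x (Pi.single i 1) : ℝ) : ℂ) := by
  rw [gGrad]
  filter_upwards [Lp.coeFn_smul (κ : ℂ) (gL2 κ (Function.update P i (gderiv (P i)))),
    coeFn_gL2 hκ (Function.update P i (gderiv (P i)))] with x h1 h2
  rw [h1, Pi.smul_apply, h2, fderiv_gprod]
  push_cast
  rfl

theorem hasWeakGrad_gL2 {κ : ℝ} (hκ : κ ≠ 0) (P : Fin N → Polynomial ℝ) :
    HasWeakGrad (gL2 κ P) (gGrad κ P) := by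
  intro i η hη hηs
  have hηd : Differentiable ℝ η := hη.differentiable (by simp)
  have hgd : Differentiable ℝ (gprod κ P) := (contDiff_gprod κ P (n := 1)).differentiable (by simp)
  have hη0 : Continuous η := hη.continuous
  have hη1 : Continuous fun x => fderiv ℝ η x (Pi.single i 1) :=
    (hη.continuous_fderiv (by simp)).clm_apply continuous_const
  have hη1s : HasCompactSupport fun x => fderiv ℝ η x (Pi.single i 1) :=
    (hηs.fderiv ℝ).comp_left (g := fun L : Conf N →L[ℝ] ℝ => L (Pi.single i 1)) rfl
  have hg0 : Continuous (gprod κ P) := (contDiff_gprod κ P (n := 0)).continuous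
  have hg1 : Continuous fun x => fderiv ℝ (gprod κ P) x (Pi.single i 1) :=
    ((contDiff_gprod κ P (n := 1)).continuous_fderiv (by simp)).clm_apply continuous_const
  have ibp := integral_mul_fderiv_eq_neg_fderiv_mul_of_integrable (𝕜 := ℝ)
    (μ := (volume : Measure (Conf N))) (f := gprod κ P) (g := η) (v := Pi.single i 1)
    ((hg1.mul hη0).integrable_of_hasCompactSupport hηs.mul_left)
    ((hg0.mul hη1).integrable_of_hasCompactSupport hη1s.mul_left)
    ((hg0.mul hη0).integrable_of_hasCompactSupport hηs.mul_left)
    (fun x _ => hgd x) (fun x _ => hηd x)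
  have e1 : ∫ x, fderiv ℝ η x (Pi.single i 1) • gL2 κ P x =
      ((∫ x, gprod κ P x * fderiv ℝ η x (Pi.single i 1) : ℝ) : ℂ) := by
    rw [← integral_complex_ofReal]
    refine integral_congr_ae ?_
    filter_upwards [coeFn_gL2 hκ P] with x hx
    rw [hx, Complex.real_smul]
    push_cast
    ring
  have e2 : ∫ x, η x • gGrad κ P i x =
      ((∫ x, fderiv ℝ (gprod κ P) x (Pi.single i 1) * η x : ℝ) : ℂ) := by
    rw [← integral_complex_ofReal]
    refine integral_congr_ae ?_
    filter_upwards [coeFn_gGrad hκ P i] with x hx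
    rw [hx, Complex.real_smul]
    push_cast
    ring
  rw [e1, e2, ibp]
  push_cast
  rfl

theorem inner_gL2_right {κ : ℝ} (hκ : κ ≠ 0) (P : Fin N → Polynomial ℝ) (φ : L2 N) :
    ⟪φ, gL2 κ P⟫_ℂ = starRingEnd ℂ (∫ x, gprod κ P x • φ x) := by
  rw [← inner_conj_symm, inner_gL2_left hκ]
  rfl

/-- Partial integration of a weak derivative against a polynomial times a Gaussian. -/
theorem HasWeakGrad.inner_gL2 {κ : ℝ} (hκ : κ ≠ 0) {φ : L2 N} {h : Fin N → L2 N}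
    (hw : HasWeakGrad φ h) (P : Fin N → Polynomial ℝ) (i : Fin N) :
    ⟪h i, gL2 κ P⟫_ℂ = - ⟪φ, gGrad κ P i⟫_ℂ := by
  have h1 := hw.integral_fderiv (contDiff_gprod κ P) i (memLp_gprod hκ P)
    (memLp_fderiv_gprod hκ P i)
  rw [inner_gL2_right hκ, gGrad, inner_smul_right, inner_gL2_right hκ]
  have h2 : ∫ x, fderiv ℝ (gprod κ P) x (Pi.single i 1) • φ x =
      κ * ∫ x, gprod κ (Function.update P i (gderiv (P i))) x • φ x := by
    rw [← integral_const_mul]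
    refine integral_congr_ae (ae_of_all _ fun x => ?_)
    simp only [fderiv_gprod, Complex.real_smul]
    push_cast
    ring
  rw [h2] at h1
  rw [← Complex.conj_ofReal κ, ← map_mul, h1, map_neg, neg_neg]

theorem gprod_update_smul_sub (κ : ℝ) (P : Fin N → Polynomial ℝ) (i : Fin N) (a b : ℝ)
    (p q : Polynomial ℝ) (x : Conf N) :
    gprod κ (Function.update P i (a • p - b • q)) x =
      a * gprod κ (Function.update P i p) x - b * gprod κ (Function.update P i q) x := by
  simp only [gprod_update, gpoly_sub, gpoly_smul]
  ring

/-- The isotropic oscillator potential whose ground state, for the kinetic energy `-c Δ`, is the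
Gaussian `exp (-(κ x)² / 4)`. The levels of a particle are `c κ² (j + 1/2)`. -/
def osc (c κ : ℝ) (N : ℕ) (x : Conf N) : ℝ := ∑ i, c * κ ^ 4 / 4 * x i ^ 2

theorem osc_nonneg {c : ℝ} (hc : 0 ≤ c) (κ : ℝ) (x : Conf N) : 0 ≤ osc c κ N x :=
  Finset.sum_nonneg fun i _ => by positivity

theorem continuous_osc (c κ : ℝ) : Continuous (osc c κ N) := by
  unfold osc
  fun_prop

/-- The energy of the Hermite function with the quantum numbers `a`. -/
def level (c κ : ℝ) (a : Fin N → ℕ) : ℝ := ∑ i, c * κ ^ 2 * (a i + 1 / 2)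

/-- The gradient of a Hermite function. -/
def hermGrad (κ : ℝ) (a : Fin N → ℕ) : Fin N → L2 N := gGrad κ fun i => hermN κ (a i)

theorem hasWeakGrad_hermL2 {κ : ℝ} (hκ : κ ≠ 0) (a : Fin N → ℕ) :
    HasWeakGrad (hermL2 κ a) (hermGrad κ a) := hasWeakGrad_gL2 hκ _

theorem osc_mul_gprod (c κ : ℝ) (P : Fin N → Polynomial ℝ) (x : Conf N) :
    osc c κ N x * gprod κ P x = ∑ i, c * κ ^ 2 / 4 *
      gprod κ (Function.update P i (Polynomial.X * (Polynomial.X * P i))) x := by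
  rw [osc, Finset.sum_mul]
  refine Finset.sum_congr rfl fun i _ => ?_
  rw [gprod_update, gpoly_X_mul, gpoly_X_mul, gprod_eq_mul_erase κ P i]
  ring

theorem memLp_osc_mul_gprod {κ : ℝ} (hκ : κ ≠ 0) (c : ℝ) (P : Fin N → Polynomial ℝ) :
    MemLp (fun x => osc c κ N x * gprod κ P x) 2 := by
  simp_rw [osc_mul_gprod]
  exact memLp_finsetSum _ fun i _ => (memLp_gprod hκ _).const_mul _

theorem finitePotential_osc_gL2 {κ : ℝ} (hκ : κ ≠ 0) (c : ℝ) (P : Fin N → Polynomial ℝ) :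
    FinitePotential (osc c κ N) (gL2 κ P) := by
  have := (memLp_osc_mul_gprod hκ c P).integrable_mul (memLp_gprod hκ P)
  refine this.congr ?_
  filter_upwards [coeFn_gL2 hκ P] with x hx
  rw [hx, Complex.norm_real, Real.norm_eq_abs, sq_abs, Pi.mul_apply]
  ring

/-- The Hermite functions solve the eigenvalue equation of the oscillator in the form sense. -/
theorem hermL2_eigen {κ : ℝ} (hκ : κ ≠ 0) (c : ℝ) (a : Fin N → ℕ) {φ : L2 N}
    {h : Fin N → L2 N} (hw : HasWeakGrad φ h) :
    (c : ℂ) * ∑ i, ⟪h i, hermGrad κ a i⟫_ℂ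
        + ∫ x, (osc c κ N x : ℂ) * (starRingEnd ℂ (φ x) * hermL2 κ a x)
      = (level c κ a : ℂ) * ⟪φ, hermL2 κ a⟫_ℂ := by
  set P : Fin N → Polynomial ℝ := fun i => hermN κ (a i) with hP
  have hint : ∀ Q : Fin N → Polynomial ℝ, Integrable fun x => gprod κ Q x • φ x := fun Q =>
    integrable_smul_L2 (memLp_gprod hκ Q) φ
  let I : (Fin N → Polynomial ℝ) → ℂ := fun Q => starRingEnd ℂ (∫ x, gprod κ Q x • φ x)
  have kin : ∀ i, ⟪h i, hermGrad κ a i⟫_ℂ = -((κ : ℂ) ^ 2 *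
      ((1 / 4 : ℝ) * I (Function.update P i (Polynomial.X * (Polynomial.X * P i)))
        - (a i + 1 / 2 : ℝ) * I P)) := by
    intro i
    have e1 : ⟪h i, hermGrad κ a i⟫_ℂ =
        -((κ : ℂ) ^ 2 * I (Function.update P i (gderiv (gderiv (P i))))) := by
      rw [hermGrad, gGrad, inner_smul_right, hw.inner_gL2 hκ, gGrad, inner_smul_right,
        Function.update_idem, Function.update_self, inner_gL2_right hκ]
      ring
    have e2 : I (Function.update P i (gderiv (gderiv (P i)))) =
        (1 / 4 : ℝ) * I (Function.update P i (Polynomial.X * (Polynomial.X * P i)))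
        - (a i + 1 / 2 : ℝ) * I P := by
      have : ∫ x, gprod κ (Function.update P i (gderiv (gderiv (P i)))) x • φ x =
          ((1 / 4 : ℝ) : ℂ) *
            (∫ x, gprod κ (Function.update P i (Polynomial.X * (Polynomial.X * P i))) x • φ x)
          - ((a i + 1 / 2 : ℝ) : ℂ) * ∫ x, gprod κ P x • φ x := by
        rw [← integral_const_mul, ← integral_const_mul, ← integral_sub]
        · refine integral_congr_ae (ae_of_all _ fun x => ?_)
          simp only [hP, gderiv_gderiv_hermN]
          rw [gprod_update_smul_sub, Function.update_eq_self]
          simp only [Complex.real_smul]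
          push_cast
          ring
        · exact (hint _).const_mul _
        · exact (hint _).const_mul _
      simp only [I]
      rw [this, map_sub, map_mul, map_mul, Complex.conj_ofReal, Complex.conj_ofReal]
    rw [e1, e2]
  have pot : ∫ x, (osc c κ N x : ℂ) * (starRingEnd ℂ (φ x) * hermL2 κ a x) =
      ∑ i, ((c * κ ^ 2 / 4 : ℝ) : ℂ) *
        I (Function.update P i (Polynomial.X * (Polynomial.X * P i))) := by
    have e : ∫ x, (osc c κ N x : ℂ) * (starRingEnd ℂ (φ x) * hermL2 κ a x) =
        starRingEnd ℂ (∫ x, ∑ i, ((c * κ ^ 2 / 4 : ℝ) : ℂ) *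
          (gprod κ (Function.update P i (Polynomial.X * (Polynomial.X * P i))) x • φ x)) := by
      rw [← integral_conj]
      refine integral_congr_ae ?_
      filter_upwards [coeFn_gL2 hκ P] with x hx
      have : hermL2 κ a x = gprod κ P x := hx
      rw [this]
      have h2 := congrArg (fun r : ℝ => (r : ℂ)) (osc_mul_gprod c κ P x)
      simp only [Complex.ofReal_mul, Complex.ofReal_sum] at h2
      rw [mul_left_comm, h2, map_sum, Finset.mul_sum]
      refine Finset.sum_congr rfl fun i _ => ?_
      rw [map_mul, Complex.real_smul, map_mul, Complex.conj_ofReal, Complex.conj_ofReal]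
      push_cast
      ring
    rw [e, integral_finsetSum _ fun i _ => (hint _).const_mul _, map_sum]
    refine Finset.sum_congr rfl fun i _ => ?_
    rw [integral_const_mul, map_mul, Complex.conj_ofReal]
  have hφ : ⟪φ, hermL2 κ a⟫_ℂ = I P := inner_gL2_right hκ P φ
  rw [pot, hφ, level, Finset.mul_sum, Complex.ofReal_sum, Finset.sum_mul, ← Finset.sum_add_distrib]
  refine Finset.sum_congr rfl fun i _ => ?_
  rw [kin i]
  push_cast
  ring

/-! ### Hilbert space lemmas -/

section HilbertSpace

variable {A : Type*} {H Q : Type*} [NormedAddCommGroup H] [InnerProductSpace ℂ H]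
  [NormedAddCommGroup Q] [InnerProductSpace ℂ Q]

/-- Parseval's identity. -/
theorem hasSum_sq_norm_inner {b : A → H} (hb : Orthonormal ℂ b) [CompleteSpace H]
    (hc : ∀ x : H, (∀ a, ⟪b a, x⟫_ℂ = 0) → x = 0) (x : H) :
    HasSum (fun a => ‖⟪b a, x⟫_ℂ‖ ^ 2) (‖x‖ ^ 2) := by
  let B : HilbertBasis A ℂ H := HilbertBasis.mkOfOrthogonalEqBot hb (by
    rw [Submodule.eq_bot_iff]
    intro ψ hψ
    exact hc ψ fun a => (Submodule.mem_orthogonal _ ψ).1 hψ _ (Submodule.subset_span ⟨a, rfl⟩))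
  have hB : ∀ a, B a = b a := fun a => by simp [B]
  have h := (B.hasSum_inner_mul_inner x x).mapL Complex.reCLM
  rw [Complex.reCLM_apply, ← RCLike.re_eq_complex_re, inner_self_eq_norm_sq] at h
  refine h.congr_fun ?_
  intro a
  rw [hB, Complex.reCLM_apply, ← inner_conj_symm x, Complex.conj_mul', ← Complex.ofReal_pow,
    Complex.ofReal_re]

/-- Bessel's inequality for orthogonal vectors `J a` with squared norms `l a`. -/
theorem sum_mul_sq_le_of_orthogonal [DecidableEq A] {J : A → Q} {l : A → ℝ}
    (hJ : ∀ a b, ⟪J a, J b⟫_ℂ = if a = b then (l a : ℂ) else 0) {v : Q} {t : A → ℂ}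
    (ht : ∀ a, ⟪J a, v⟫_ℂ = l a * t a) (F : Finset A) :
    ∑ a ∈ F, l a * ‖t a‖ ^ 2 ≤ ‖v‖ ^ 2 := by
  set w := ∑ a ∈ F, t a • J a with hw
  have h1 : ⟪w, v⟫_ℂ = ((∑ a ∈ F, l a * ‖t a‖ ^ 2 : ℝ) : ℂ) := by
    rw [hw, sum_inner, Complex.ofReal_sum]
    refine Finset.sum_congr rfl fun a _ => ?_
    rw [inner_smul_left, ht]
    push_cast
    rw [← Complex.conj_mul']
    ring
  have h2 : ⟪w, w⟫_ℂ = ((∑ a ∈ F, l a * ‖t a‖ ^ 2 : ℝ) : ℂ) := by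
    conv_lhs => rw [hw, sum_inner]
    rw [Complex.ofReal_sum]
    refine Finset.sum_congr rfl fun a ha => ?_
    rw [inner_smul_left, inner_sum]
    simp only [inner_smul_right, hJ]
    simp only [mul_ite, mul_zero, Finset.sum_ite_eq, ha, if_true]
    push_cast
    rw [← Complex.conj_mul']
    ring
  have h3 : ‖w‖ ^ 2 = ∑ a ∈ F, l a * ‖t a‖ ^ 2 := by
    rw [← inner_self_eq_norm_sq (𝕜 := ℂ), h2, RCLike.re_eq_complex_re, Complex.ofReal_re]
  have h4 := norm_sub_sq (𝕜 := ℂ) v w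
  rw [← inner_conj_symm, h1, Complex.conj_ofReal, RCLike.re_eq_complex_re, Complex.ofReal_re, h3]
    at h4
  nlinarith [sq_nonneg ‖v - w‖]

/-- An operator is compact if it is dominated by a diagonal operator with levels that tend to
infinity. -/
theorem isCompactOperator_of_levels [CompleteSpace H] {b : A → H} (hb : Orthonormal ℂ b)
    (hc : ∀ x : H, (∀ a, ⟪b a, x⟫_ℂ = 0) → x = 0) {l : A → ℝ}
    (hl : ∀ R : ℝ, {a | l a ≤ R}.Finite) (hl0 : ∀ a, 0 ≤ l a) (J : Q →L[ℂ] H)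
    (hJ : ∀ (v : Q) (F : Finset A), ∑ a ∈ F, l a * ‖⟪b a, J v⟫_ℂ‖ ^ 2 ≤ ‖v‖ ^ 2) :
    IsCompactOperator J := by
  classical
  let S : ℕ → Finset A := fun n => (hl ((n : ℝ) + 1)).toFinset
  let F : ℕ → Q →L[ℂ] H := fun n => ∑ a ∈ S n, ((innerSL ℂ (b a)).comp J).smulRight (b a)
  have hFv : ∀ n v, F n v = ∑ a ∈ S n, ⟪b a, J v⟫_ℂ • b a := by
    intro n v
    simp [F]
  have hFc : ∀ n, IsCompactOperator (F n) := by
    intro n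
    have : ∀ T : Finset A, IsCompactOperator
        (∑ a ∈ T, ((innerSL ℂ (b a)).comp J).smulRight (b a) : Q →L[ℂ] H) := by
      intro T
      induction T using Finset.induction_on with
      | empty => simpa using isCompactOperator_zero
      | insert a T ha ih =>
        rw [Finset.sum_insert ha]
        refine IsCompactOperator.add ?_ ih
        have h1 : IsCompactOperator ((innerSL ℂ (b a)).comp J) :=
          isCompactOperator_of_locallyCompactSpace_dom _
        exact h1.clm_comp (ContinuousLinearMap.toSpanSingleton ℂ (b a))
    exact this _
  have hbound : ∀ n v, ‖(J - F n) v‖ ^ 2 ≤ ((n : ℝ) + 1)⁻¹ * ‖v‖ ^ 2 := by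
    intro n v
    have hn : (0 : ℝ) < (n : ℝ) + 1 := by positivity
    have h1 := hasSum_sq_norm_inner hb hc ((J - F n) v)
    refine hasSum_le_of_sum_le h1 fun T => ?_
    rw [inv_mul_eq_div, le_div_iff₀ hn, Finset.sum_mul]
    refine le_trans (Finset.sum_le_sum fun a _ => ?_) (hJ v T)
    have h2 : ⟪b a, (J - F n) v⟫_ℂ = if a ∈ S n then 0 else ⟪b a, J v⟫_ℂ := by
      rw [sub_apply, inner_sub_right, hFv, inner_sum]
      simp only [inner_smul_right, orthonormal_iff_ite.1 hb]
      simp only [mul_ite, mul_one, mul_zero, Finset.sum_ite_eq]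
      split_ifs <;> simp
    rw [h2]
    split_ifs with h
    · simpa using mul_nonneg (hl0 a) (sq_nonneg _)
    · rw [mul_comm]
      refine mul_le_mul_of_nonneg_right ?_ (sq_nonneg _)
      have : ¬ l a ≤ (n : ℝ) + 1 := by simpa [S] using h
      exact (not_le.1 this).le
  refine isCompactOperator_of_tendsto (F := F) (l := atTop) ?_ (Eventually.of_forall hFc)
  rw [tendsto_iff_norm_sub_tendsto_zero]
  have hle : ∀ n, ‖F n - J‖ ≤ Real.sqrt ((n : ℝ) + 1)⁻¹ := by
    intro n
    rw [norm_sub_rev]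
    refine ContinuousLinearMap.opNorm_le_bound _ (Real.sqrt_nonneg _) fun v => ?_
    refine le_of_sq_le_sq ?_ (by positivity)
    rw [mul_pow, Real.sq_sqrt (by positivity)]
    exact hbound n v
  refine squeeze_zero (fun n => norm_nonneg _) hle ?_
  have h0 : Tendsto (fun n : ℕ => ((n : ℝ) + 1)⁻¹) atTop (𝓝 0) := by
    simpa [one_div] using tendsto_one_div_add_atTop_nhds_zero_nat (𝕜 := ℝ)
  have h1 := (Real.continuous_sqrt.tendsto 0).comp h0
  rw [Real.sqrt_zero] at h1
  exact h1

/-- The spectral theorem for the operator of a closed form: if the form domain `Q` is compactly and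
densely embedded in `H`, then there is a complete orthonormal sequence of eigenvectors. -/
theorem exists_eigenbasis_of_compact [CompleteSpace H] [CompleteSpace Q]
    [TopologicalSpace.SeparableSpace H] (hinf : ¬ FiniteDimensional ℂ H) (J : Q →L[ℂ] H)
    (hJ : IsCompactOperator J) (hd : ∀ x : H, (∀ v : Q, ⟪J v, x⟫_ℂ = 0) → x = 0) :
    ∃ (f : ℕ → H) (u : ℕ → Q) (l : ℕ → ℝ), Orthonormal ℂ f ∧
      (∀ x : H, (∀ k, ⟪f k, x⟫_ℂ = 0) → x = 0) ∧ (∀ k, J (u k) = f k) ∧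
      ∀ k v, ⟪v, u k⟫_ℂ = l k * ⟪J v, f k⟫_ℂ := by
  let T : H →L[ℂ] H := J.comp J.adjoint
  have hTc : IsCompactOperator T := hJ.comp_clm J.adjoint
  have hTs : T.IsSymmetric := by
    intro x y
    simp only [T, ContinuousLinearMap.coe_coe, ContinuousLinearMap.comp_apply]
    rw [← ContinuousLinearMap.adjoint_inner_right, ContinuousLinearMap.adjoint_inner_left]
  have hbot := ContinuousLinearMap.orthogonalComplement_iSup_eigenspaces_eq_bot hTc hTs
  have hclosed : ∀ μ : ℂ, IsClosed (Module.End.eigenspace (T : H →ₗ[ℂ] H) μ : Set H) := by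
    intro μ
    have : (Module.End.eigenspace (T : H →ₗ[ℂ] H) μ : Set H) = {x | T x = μ • x} := by
      ext x
      exact Module.End.mem_eigenspace_iff
    rw [this]
    exact isClosed_eq T.continuous (continuous_const_smul μ)
  have hcomp : ∀ μ : ℂ, CompleteSpace (Module.End.eigenspace (T : H →ₗ[ℂ] H) μ) := fun μ =>
    (hclosed μ).completeSpace_coe
  choose w B hB using fun μ : ℂ => exists_hilbertBasis ℂ (Module.End.eigenspace (T : H →ₗ[ℂ] H) μ)
  let g : (Σ μ : ℂ, w μ) → H := fun a => (B a.1 a.2 : H)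
  have hg : Orthonormal ℂ g :=
    hTs.orthogonalFamily_eigenspaces.orthonormal_sigma_orthonormal fun μ => (B μ).orthonormal
  have hgc : ∀ x : H, (∀ a, ⟪g a, x⟫_ℂ = 0) → x = 0 := by
    intro x hx
    have : x ∈ (⨆ μ, Module.End.eigenspace (T : H →ₗ[ℂ] H) μ)ᗮ := by
      rw [← Submodule.iInf_orthogonal]
      rw [Submodule.mem_iInf]
      intro μ
      rw [Submodule.mem_orthogonal]
      intro y hy
      -- expand `y` in the basis of the eigenspace
      have h1 := ((B μ).hasSum_repr ⟨y, hy⟩).mapL (Submodule.subtypeL _)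
      have h2 := h1.mapL (innerSLFlip ℂ x)
      have h3 : ∀ i,
          innerSLFlip ℂ x ((Submodule.subtypeL _) (((B μ).repr ⟨y, hy⟩ i) • B μ i)) = 0 := by
        intro i
        have := hx ⟨μ, i⟩
        simp only [map_smul]
        simp only [Submodule.subtypeL_apply, innerSLFlip_apply_apply]
        rw [inner_smul_left]
        exact mul_eq_zero_of_right _ this
      have h4 := h2.unique (by simpa only [h3] using hasSum_zero)
      simpa using h4
    rw [hbot] at this
    simpa using this
  have hcount : Countable (Σ μ : ℂ, w μ) := by
    refine Pairwise.countable_of_isOpen_disjoint (s := fun a => Metric.ball (g a) (1 / 2))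
      (fun a b hab => ?_) (fun a => Metric.isOpen_ball)
      (fun a => Metric.nonempty_ball.2 (by norm_num))
    refine Metric.ball_disjoint_ball ?_
    -- distinct orthonormal vectors have distance `√2`
    have h1 := norm_sub_sq (𝕜 := ℂ) (g a) (g b)
    rw [hg.1, hg.1, hg.2 hab] at h1
    rw [dist_eq_norm]
    simp at h1
    nlinarith [norm_nonneg (g a - g b)]
  have hinfinite : Infinite (Σ μ : ℂ, w μ) := by
    by_contra hfin
    rw [not_infinite_iff_finite] at hfin
    have := Fintype.ofFinite (Σ μ : ℂ, w μ)
    let b := OrthonormalBasis.mkOfOrthogonalEqBot hg (by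
      rw [Submodule.eq_bot_iff]
      intro ψ hψ
      exact hgc ψ fun a => (Submodule.mem_orthogonal _ ψ).1 hψ _ (Submodule.subset_span ⟨a, rfl⟩))
    exact hinf b.toBasis.finiteDimensional_of_finite
  obtain ⟨e⟩ : Nonempty (ℕ ≃ Σ μ : ℂ, w μ) := nonempty_equiv_of_countable
  have hT : ∀ a, T (g a) = a.1 • g a := fun a =>
    Module.End.mem_eigenspace_iff.1 (B a.1 a.2).2
  have hadj : ∀ a, a.1 * ⟪g a, g a⟫_ℂ = ⟪J.adjoint (g a), J.adjoint (g a)⟫_ℂ := by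
    intro a
    rw [← inner_smul_right, ← hT, ContinuousLinearMap.adjoint_inner_left]
    rfl
  have hg1 : ∀ a, ⟪g a, g a⟫_ℂ = 1 := fun a => by
    rw [inner_self_eq_norm_sq_to_K, hg.1 a]; simp
  have hne : ∀ a, J.adjoint (g a) ≠ 0 := by
    intro a h0
    have : g a = 0 := hd _ fun v => by
      rw [← ContinuousLinearMap.adjoint_inner_right, h0, inner_zero_right]
    have h1 := hg.1 a
    rw [this, norm_zero] at h1
    exact zero_ne_one h1
  have hreal : ∀ a, a.1 = ((‖J.adjoint (g a)‖ ^ 2 : ℝ) : ℂ) := by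
    intro a
    have := hadj a
    rw [hg1, mul_one, inner_self_eq_norm_sq_to_K] at this
    simpa using this
  have hpos : ∀ a, 0 < ‖J.adjoint (g a)‖ ^ 2 := fun a => by
    have := norm_pos_iff.2 (hne a)
    positivity
  refine ⟨fun k => g (e k),
    fun k => (((‖J.adjoint (g (e k))‖ ^ 2)⁻¹ : ℝ) : ℂ) • J.adjoint (g (e k)),
    fun k => (‖J.adjoint (g (e k))‖ ^ 2)⁻¹, hg.comp _ e.injective, fun x hx => hgc x fun a => ?_,
    fun k => ?_, fun k v => ?_⟩
  · simpa using hx (e.symm a)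
  · rw [map_smul]
    have h1 : J (J.adjoint (g (e k))) = T (g (e k)) := rfl
    rw [h1, hT, hreal, smul_smul, ← Complex.ofReal_mul, inv_mul_cancel₀ (hpos _).ne']
    simp
  · rw [inner_smul_right, ContinuousLinearMap.adjoint_inner_right]

end HilbertSpace

/-! ### The bosonic subspace -/

theorem measurePreserving_comp_perm (σ : Equiv.Perm (Fin N)) :
    MeasurePreserving (fun x : Conf N => x ∘ σ) := by
  have h := volume_measurePreserving_piCongrLeft (fun _ : Fin N => ℝ) σ.symm
  have e : (MeasurableEquiv.piCongrLeft (fun _ : Fin N => ℝ) σ.symm : Conf N → Conf N) =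
      fun x => x ∘ σ := by
    ext x i
    rw [MeasurableEquiv.coe_piCongrLeft, Equiv.piCongrLeft_apply]
    simp
  rwa [e] at h

/-- The action of permutations of the particles on wave functions. -/
def permL2 (σ : Equiv.Perm (Fin N)) : L2 N →ₗᵢ[ℂ] L2 N :=
  Lp.compMeasurePreservingₗᵢ ℂ (fun x : Conf N => x ∘ σ) (measurePreserving_comp_perm σ)

theorem coeFn_permL2 (σ : Equiv.Perm (Fin N)) (ψ : L2 N) :
    permL2 σ ψ =ᵐ[volume] fun x => ψ (x ∘ σ) :=
  Lp.coeFn_compMeasurePreserving ψ (measurePreserving_comp_perm σ)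

theorem isBosonic_iff {ψ : L2 N} : IsBosonic ψ ↔ ∀ σ : Equiv.Perm (Fin N), permL2 σ ψ = ψ := by
  refine forall_congr' fun σ => ?_
  rw [Lp.ext_iff]
  constructor
  · intro h
    exact (coeFn_permL2 σ ψ).trans h
  · intro h
    exact (coeFn_permL2 σ ψ).symm.trans h

/-- The bosonic subspace of `L²(ℝ^N)`. -/
def bosonic (N : ℕ) : Submodule ℂ (L2 N) where
  carrier := {ψ | IsBosonic ψ}
  zero_mem' := by
    simp only [Set.mem_ofPred_eq, isBosonic_iff]
    intro σ
    simp
  add_mem' := by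
    simp only [Set.mem_ofPred_eq, isBosonic_iff]
    intro a b ha hb σ
    rw [map_add, ha, hb]
  smul_mem' := by
    simp only [Set.mem_ofPred_eq, isBosonic_iff]
    intro t a ha σ
    rw [map_smul, ha]

theorem mem_bosonic {ψ : L2 N} : ψ ∈ bosonic N ↔ IsBosonic ψ := Iff.rfl

theorem isClosed_bosonic : IsClosed (bosonic N : Set (L2 N)) := by
  have : (bosonic N : Set (L2 N)) = ⋂ σ : Equiv.Perm (Fin N), {ψ | permL2 σ ψ = ψ} := by
    ext ψ
    simp only [SetLike.mem_coe, mem_bosonic, isBosonic_iff, Set.mem_iInter, Set.mem_ofPred_eq]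
  rw [this]
  exact isClosed_iInter fun σ => isClosed_eq (permL2 σ).continuous continuous_id

instance : CompleteSpace (bosonic N) := isClosed_bosonic.completeSpace_coe

theorem permL2_gL2 {κ : ℝ} (hκ : κ ≠ 0) (P : Fin N → Polynomial ℝ) (σ : Equiv.Perm (Fin N)) :
    permL2 σ (gL2 κ P) = gL2 κ (P ∘ σ.symm) := by
  rw [Lp.ext_iff]
  have h1 := (measurePreserving_comp_perm σ).quasiMeasurePreserving.ae (coeFn_gL2 hκ P)
  filter_upwards [coeFn_permL2 σ (gL2 κ P), coeFn_gL2 hκ (P ∘ σ.symm), h1] with x hx1 hx2 hx3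
  rw [hx1, hx2, hx3]
  congr 1
  simp only [gprod, Function.comp_apply]
  rw [← Equiv.prod_comp σ.symm]
  simp

theorem permL2_hermL2 {κ : ℝ} (hκ : κ ≠ 0) (a : Fin N → ℕ) (σ : Equiv.Perm (Fin N)) :
    permL2 σ (hermL2 κ a) = hermL2 κ (a ∘ σ.symm) := permL2_gL2 hκ _ σ

theorem inner_hermL2_comp {κ : ℝ} (hκ : κ ≠ 0) {ψ : L2 N} (hψ : IsBosonic ψ) (a : Fin N → ℕ)
    (σ : Equiv.Perm (Fin N)) : ⟪hermL2 κ (a ∘ σ), ψ⟫_ℂ = ⟪hermL2 κ a, ψ⟫_ℂ := by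
  have h1 := isBosonic_iff.1 hψ σ.symm
  rw [← (permL2 σ.symm).inner_map_map (hermL2 κ a) ψ, h1, permL2_hermL2 hκ, Equiv.symm_symm]

/-- The rearrangements of the quantum numbers `a`. -/
def orbit (a : Fin N → ℕ) : Finset (Fin N → ℕ) :=
  Finset.univ.image fun σ : Equiv.Perm (Fin N) => a ∘ σ

theorem mem_orbit {a b : Fin N → ℕ} : b ∈ orbit a ↔ ∃ σ : Equiv.Perm (Fin N), a ∘ σ = b := by
  simp [orbit]

theorem self_mem_orbit (a : Fin N → ℕ) : a ∈ orbit a := mem_orbit.2 ⟨1, rfl⟩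

theorem comp_mem_orbit {a b : Fin N → ℕ} (σ : Equiv.Perm (Fin N)) :
    b ∘ σ ∈ orbit a ↔ b ∈ orbit a := by
  simp only [mem_orbit]
  constructor
  · rintro ⟨τ, hτ⟩
    refine ⟨σ.symm.trans τ, ?_⟩
    ext i
    have := congrFun hτ (σ.symm i)
    simpa using this
  · rintro ⟨τ, rfl⟩
    exact ⟨σ.trans τ, rfl⟩

/-- The symmetrised Hermite function, not normalised. -/
def symVec (κ : ℝ) (a : Fin N → ℕ) : L2 N := ∑ b ∈ orbit a, hermL2 κ b

theorem isBosonic_symVec {κ : ℝ} (hκ : κ ≠ 0) (a : Fin N → ℕ) : IsBosonic (symVec κ a) := by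
  rw [isBosonic_iff]
  intro σ
  rw [symVec, map_sum]
  refine Finset.sum_bij (fun b _ => b ∘ σ.symm) (fun b hb => (comp_mem_orbit σ.symm).2 hb) ?_ ?_ ?_
  · intro b _ b' _ h
    ext i
    simpa using congrFun h (σ i)
  · intro b hb
    refine ⟨b ∘ σ, (comp_mem_orbit σ).2 hb, ?_⟩
    ext i
    simp
  · intro b _
    exact permL2_hermL2 hκ b σ

theorem inner_symVec {κ : ℝ} (hκ : κ ≠ 0) {ψ : L2 N} (hψ : IsBosonic ψ) (a : Fin N → ℕ) :
    ⟪symVec κ a, ψ⟫_ℂ = (orbit a).card * ⟪hermL2 κ a, ψ⟫_ℂ := by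
  rw [symVec, sum_inner]
  have : ∀ b ∈ orbit a, ⟪hermL2 κ b, ψ⟫_ℂ = ⟪hermL2 κ a, ψ⟫_ℂ := by
    intro b hb
    obtain ⟨σ, rfl⟩ := mem_orbit.1 hb
    exact inner_hermL2_comp hκ hψ a σ
  rw [Finset.sum_congr rfl this, Finset.sum_const, nsmul_eq_mul]

theorem norm_sq_symVec {κ : ℝ} (hκ : κ ≠ 0) (a : Fin N → ℕ) :
    ‖symVec κ a‖ ^ 2 = (orbit a).card := by
  have h := inner_symVec hκ (isBosonic_symVec hκ a) a
  rw [inner_self_eq_norm_sq_to_K] at h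
  have h2 : ⟪hermL2 κ a, symVec κ a⟫_ℂ = 1 := by
    rw [symVec, inner_sum]
    simp only [orthonormal_iff_ite.1 (orthonormal_hermL2 hκ)]
    simp [self_mem_orbit]
  rw [h2, mul_one] at h
  refine Complex.ofReal_injective ?_
  push_cast
  exact h

theorem not_finiteDimensional_bosonic (hN : 0 < N) : ¬ FiniteDimensional ℂ (bosonic N) := by
  intro hfin
  have hκ : (1 : ℝ) ≠ 0 := one_ne_zero
  have hb : ∀ n : ℕ, IsBosonic (hermL2 (N := N) 1 fun _ => n) := fun n => by
    rw [isBosonic_iff]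
    intro σ
    rw [permL2_hermL2 hκ]
    rfl
  have hinj : Function.Injective fun (n : ℕ) (_ : Fin N) => n := fun m n h => congrFun h ⟨0, hN⟩
  have hli := ((orthonormal_hermL2 (N := N) hκ).comp _ hinj).linearIndependent
  have hli' : LinearIndependent ℂ fun n : ℕ => (⟨_, hb n⟩ : bosonic N) :=
    LinearIndependent.of_comp (bosonic N).subtype hli
  exact not_finite_iff_infinite.2 inferInstance hli'.finite

theorem separableSpace_L2 : TopologicalSpace.SeparableSpace (L2 N) := by
  rw [← TopologicalSpace.isSeparable_univ_iff]
  have h := (hermHilbert (N := N) one_ne_zero).dense_span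
  have h1 : TopologicalSpace.IsSeparable
      (Submodule.span ℂ (Set.range (hermHilbert (N := N) (κ := 1) one_ne_zero)) : Set (L2 N)) :=
    (Set.countable_range _).isSeparable.span
  have h2 := h1.closure
  rw [← Submodule.topologicalClosure_coe, h] at h2
  exact h2

instance : TopologicalSpace.SeparableSpace (bosonic N) := by
  have := separableSpace_L2 (N := N)
  have : SecondCountableTopology (L2 N) := UniformSpace.secondCountable_of_separable (L2 N)
  infer_instance

/-! ### Weak gradients form a closed subspace -/

theorem integrable_smul_of_compactSupport {η : Conf N → ℝ} (hη : Continuous η)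
    (hs : HasCompactSupport η) (ψ : L2 N) : Integrable fun x => η x • ψ x :=
  integrable_smul_L2 (hη.memLp_of_hasCompactSupport hs) ψ

theorem continuous_fderiv_single {η : Conf N → ℝ} (hη : ContDiff ℝ ((⊤ : ℕ∞) : WithTop ℕ∞) η)
    (i : Fin N) : Continuous fun x => fderiv ℝ η x (Pi.single i 1) :=
  (hη.continuous_fderiv (by simp)).clm_apply continuous_const

theorem hasCompactSupport_fderiv_single {η : Conf N → ℝ} (hs : HasCompactSupport η)
    (i : Fin N) : HasCompactSupport fun x => fderiv ℝ η x (Pi.single i 1) :=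
  (hs.fderiv ℝ).comp_left (g := fun L : Conf N →L[ℝ] ℝ => L (Pi.single i 1)) rfl

/-- The pairing of `L²` with a real continuous compactly supported function. -/
theorem continuous_integral_smul {η : Conf N → ℝ} (hη : Continuous η)
    (hs : HasCompactSupport η) : Continuous fun ψ : L2 N => ∫ x, η x • ψ x := by
  have hm : MemLp (fun x => (η x : ℂ)) 2 (volume : Measure (Conf N)) :=
    (hη.memLp_of_hasCompactSupport hs).ofReal
  have : (fun ψ : L2 N => ∫ x, η x • ψ x) = fun ψ => ⟪hm.toLp _, ψ⟫_ℂ := by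
    ext ψ
    rw [L2.inner_def]
    refine integral_congr_ae ?_
    filter_upwards [hm.coeFn_toLp] with x hx
    rw [hx, RCLike.inner_apply, Complex.conj_ofReal, mul_comm]
    rfl
  rw [this]
  exact continuous_const.inner continuous_id

theorem HasWeakGrad.add {φ ψ : L2 N} {h g : Fin N → L2 N} (hφ : HasWeakGrad φ h)
    (hψ : HasWeakGrad ψ g) : HasWeakGrad (φ + ψ) (h + g) := by
  intro i η hη hs
  have key : ∀ (η : Conf N → ℝ), Continuous η → HasCompactSupport η → ∀ φ ψ : L2 N,
      ∫ x, η x • (φ + ψ) x = (∫ x, η x • φ x) + ∫ x, η x • ψ x := by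
    intro η hη hs φ ψ
    rw [← integral_add (integrable_smul_of_compactSupport hη hs φ)
      (integrable_smul_of_compactSupport hη hs ψ)]
    refine integral_congr_ae ?_
    filter_upwards [Lp.coeFn_add φ ψ] with x hx
    rw [hx, Pi.add_apply, smul_add]
  rw [key _ (continuous_fderiv_single hη i) (hasCompactSupport_fderiv_single hs i), Pi.add_apply,
    key _ hη.continuous hs, hφ i η hη hs, hψ i η hη hs, neg_add]

theorem HasWeakGrad.smul {φ : L2 N} {h : Fin N → L2 N} (hφ : HasWeakGrad φ h) (t : ℂ) :
    HasWeakGrad (t • φ) (fun i => t • h i) := by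
  intro i η hη hs
  have key : ∀ (η : Conf N → ℝ) (φ : L2 N), ∫ x, η x • (t • φ) x = t * ∫ x, η x • φ x := by
    intro η φ
    rw [← integral_const_mul]
    refine integral_congr_ae ?_
    filter_upwards [Lp.coeFn_smul t φ] with x hx
    rw [hx, Pi.smul_apply, smul_eq_mul, mul_smul_comm]
  rw [key, key, hφ i η hη hs, mul_neg]

theorem hasWeakGrad_zero : HasWeakGrad (0 : L2 N) 0 := by
  intro i η _ _
  have key : ∀ η : Conf N → ℝ, ∫ x, η x • (0 : L2 N) x = 0 := by
    intro η
    rw [← integral_zero (Conf N) ℂ]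
    refine integral_congr_ae ?_
    filter_upwards [Lp.coeFn_zero ℂ 2 (volume : Measure (Conf N))] with x hx
    rw [hx, Pi.zero_apply, smul_zero]
  rw [key, Pi.zero_apply, key, neg_zero]

theorem hasWeakGrad_sum {A : Type*} (s : Finset A) {φ : A → L2 N} {h : A → Fin N → L2 N}
    (hφ : ∀ a ∈ s, HasWeakGrad (φ a) (h a)) : HasWeakGrad (∑ a ∈ s, φ a) (∑ a ∈ s, h a) := by
  classical
  induction s using Finset.induction_on with
  | empty => exact hasWeakGrad_zero
  | insert a s ha ih =>
    rw [Finset.sum_insert ha, Finset.sum_insert ha]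
    exact (hφ a (Finset.mem_insert_self a s)).add
      (ih fun b hb => hφ b (Finset.mem_insert_of_mem hb))

/-! ### The Hilbert space of the closed form -/

/-- The condition of a finite potential energy, in a form that is linear in the wave function. -/
theorem memLp_sqrt_mul_iff {W : Conf N → ℝ} {C : ℝ} (hW : AEMeasurable W)
    (hWC : ∀ᵐ x, 0 ≤ W x + C) {φ : L2 N} :
    MemLp (fun x => (Real.sqrt (W x + C) : ℂ) * φ x) 2 ↔ FinitePotential W φ := by
  have hm : AEStronglyMeasurable (fun x => (Real.sqrt (W x + C) : ℂ) * φ x) volume :=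
    (Complex.measurable_ofReal.comp_aemeasurable
      ((hW.add_const C).sqrt)).aestronglyMeasurable.mul (Lp.aestronglyMeasurable φ)
  have hφ : Integrable fun x => C * ‖φ x‖ ^ 2 :=
    ((memLp_two_iff_integrable_sq_norm (Lp.aestronglyMeasurable φ)).1 (Lp.memLp φ)).const_mul C
  rw [memLp_two_iff_integrable_sq_norm hm, FinitePotential]
  have e : (fun x => ‖(Real.sqrt (W x + C) : ℂ) * φ x‖ ^ 2) =ᵐ[volume]
      fun x => W x * ‖φ x‖ ^ 2 + C * ‖φ x‖ ^ 2 := by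
    filter_upwards [hWC] with x hx
    rw [norm_mul, mul_pow, Complex.norm_real, Real.norm_of_nonneg (Real.sqrt_nonneg _),
      Real.sq_sqrt hx, add_mul]
  rw [integrable_congr e]
  constructor
  · intro h
    refine (h.sub hφ).congr (ae_of_all _ fun x => ?_)
    simp
  · intro h
    exact h.add hφ

theorem finitePotential_sum {A : Type*} {W : Conf N → ℝ} {C : ℝ} (hW : AEMeasurable W)
    (hWC : ∀ᵐ x, 0 ≤ W x + C) (s : Finset A) {φ : A → L2 N}
    (hφ : ∀ a ∈ s, FinitePotential W (φ a)) : FinitePotential W (∑ a ∈ s, φ a) := by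
  rw [← memLp_sqrt_mul_iff hW hWC]
  have h := memLp_finsetSum s fun a ha => (memLp_sqrt_mul_iff hW hWC).2 (hφ a ha)
  refine h.ae_eq ?_
  have := Lp.coeFn_finsetSum s φ
  filter_upwards [this] with x hx
  rw [hx, Finset.sum_apply, Finset.mul_sum]

/-- The ambient space of the closed form: the wave function, the wave function times the root of
the shifted potential, and the scaled weak gradient. -/
abbrev FormVec (N : ℕ) : Type := PiLp 2 fun _ : Option (Option (Fin N)) => L2 N

/-- The vector of the form Hilbert space that belongs to a wave function. -/
def mkFormVec (c : ℝ) {W : Conf N → ℝ} {C : ℝ} {φ : L2 N} (h : Fin N → L2 N)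
    (hs : MemLp (fun x => (Real.sqrt (W x + C) : ℂ) * φ x) 2) : FormVec N :=
  WithLp.toLp 2 fun o => match o with
    | none => φ
    | some none => hs.toLp _
    | some (some i) => (Real.sqrt c : ℂ) • h i

theorem integrable_potential_mul {W : Conf N → ℝ} {C : ℝ} (hWC : ∀ᵐ x, 0 ≤ W x + C)
    {φ ψ : L2 N} (hφ : MemLp (fun x => (Real.sqrt (W x + C) : ℂ) * φ x) 2)
    (hψ : MemLp (fun x => (Real.sqrt (W x + C) : ℂ) * ψ x) 2) :
    Integrable (fun x => (W x : ℂ) * (starRingEnd ℂ (φ x) * ψ x)) ∧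
    ⟪hφ.toLp _, hψ.toLp _⟫_ℂ =
      (∫ x, (W x : ℂ) * (starRingEnd ℂ (φ x) * ψ x)) + C * ⟪φ, ψ⟫_ℂ := by
  have h1 := L2.integrable_inner (𝕜 := ℂ) (hφ.toLp _) (hψ.toLp _)
  have h2 := (L2.integrable_inner (𝕜 := ℂ) φ ψ).const_mul (C : ℂ)
  have e : (fun x => ⟪hφ.toLp _ x, hψ.toLp _ x⟫_ℂ) =ᵐ[volume] fun x =>
      (W x : ℂ) * (starRingEnd ℂ (φ x) * ψ x) + (C : ℂ) * ⟪φ x, ψ x⟫_ℂ := by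
    filter_upwards [hφ.coeFn_toLp, hψ.coeFn_toLp, hWC] with x hx1 hx2 hx
    rw [hx1, hx2, RCLike.inner_apply, RCLike.inner_apply, map_mul, Complex.conj_ofReal]
    have : (Real.sqrt (W x + C) : ℂ) * (Real.sqrt (W x + C) : ℂ) = (W x : ℂ) + C := by
      rw [← Complex.ofReal_mul, Real.mul_self_sqrt hx]
      push_cast
      rfl
    linear_combination (starRingEnd ℂ (φ x) * ψ x) * this
  have h3 : Integrable fun x => (W x : ℂ) * (starRingEnd ℂ (φ x) * ψ x) := by
    refine ((h1.congr e).sub h2).congr (ae_of_all _ fun x => ?_)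
    simp
  refine ⟨h3, ?_⟩
  rw [L2.inner_def, integral_congr_ae e, integral_add h3 h2, integral_const_mul, ← L2.inner_def]

/-- The inner product of the form Hilbert space is the form of the Hamiltonian, shifted by
`C + 1`. -/
theorem inner_mkFormVec {c : ℝ} (hc : 0 ≤ c) {W : Conf N → ℝ} {C : ℝ}
    (hWC : ∀ᵐ x, 0 ≤ W x + C) {φ ψ : L2 N} (h g : Fin N → L2 N)
    (hφ : MemLp (fun x => (Real.sqrt (W x + C) : ℂ) * φ x) 2)
    (hψ : MemLp (fun x => (Real.sqrt (W x + C) : ℂ) * ψ x) 2) :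
    ⟪mkFormVec c h hφ, mkFormVec c g hψ⟫_ℂ =
      ((c : ℂ) * ∑ i, ⟪h i, g i⟫_ℂ + ∫ x, (W x : ℂ) * (starRingEnd ℂ (φ x) * ψ x))
        + ((C : ℂ) + 1) * ⟪φ, ψ⟫_ℂ := by
  rw [PiLp.inner_apply, Fintype.sum_option, Fintype.sum_option]
  simp only [mkFormVec, inner_smul_left, inner_smul_right, Complex.conj_ofReal]
  rw [(integrable_potential_mul hWC hφ hψ).2, Finset.mul_sum]
  have : (Real.sqrt c : ℂ) * (Real.sqrt c : ℂ) = c := by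
    rw [← Complex.ofReal_mul, Real.mul_self_sqrt hc]
  simp_rw [← mul_assoc, this]
  ring

/-- The energy `c ∑ ‖∂ᵢφ‖² + ∫ W |φ|²` of the wave function `φ` with the gradient `h`. -/
def energy (c : ℝ) (W : Conf N → ℝ) (φ : L2 N) (h : Fin N → L2 N) : ℝ :=
  c * ∑ i, ‖h i‖ ^ 2 + ∫ x, W x * ‖φ x‖ ^ 2

theorem form_self_eq_energy (c : ℝ) (W : Conf N → ℝ) (φ : L2 N) (h : Fin N → L2 N) :
    (c : ℂ) * ∑ i, ⟪h i, h i⟫_ℂ + ∫ x, (W x : ℂ) * (starRingEnd ℂ (φ x) * φ x) =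
      (energy c W φ h : ℂ) := by
  rw [energy, Complex.ofReal_add, Complex.ofReal_mul, Complex.ofReal_sum,
    ← integral_complex_ofReal]
  congr 1
  · congr 1
    refine Finset.sum_congr rfl fun i _ => ?_
    rw [inner_self_eq_norm_sq_to_K]
    push_cast
    rfl
  · refine integral_congr_ae (ae_of_all _ fun x => ?_)
    simp only
    rw [Complex.conj_mul']
    push_cast
    rfl

theorem norm_sq_mkFormVec {c : ℝ} (hc : 0 ≤ c) {W : Conf N → ℝ} {C : ℝ}
    (hWC : ∀ᵐ x, 0 ≤ W x + C) {φ : L2 N} (h : Fin N → L2 N)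
    (hφ : MemLp (fun x => (Real.sqrt (W x + C) : ℂ) * φ x) 2) :
    ‖mkFormVec c h hφ‖ ^ 2 = energy c W φ h + (C + 1) * ‖φ‖ ^ 2 := by
  have h1 := inner_mkFormVec hc hWC h h hφ hφ
  rw [form_self_eq_energy, inner_self_eq_norm_sq_to_K, inner_self_eq_norm_sq_to_K] at h1
  have h2 : ((‖mkFormVec c h hφ‖ ^ 2 : ℝ) : ℂ) =
      ((energy c W φ h + (C + 1) * ‖φ‖ ^ 2 : ℝ) : ℂ) := by
    push_cast
    exact h1
  exact_mod_cast h2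

/-- `ψ`, with the weak gradient `g`, satisfies the eigenvalue equation of the form with the
potential `W`, tested against the wave functions in `D`. -/
structure IsFormEigen (c : ℝ) (W : Conf N → ℝ) (D : Set (L2 N)) (ψ : L2 N) (g : Fin N → L2 N)
    (E : ℝ) : Prop where
  mem : ψ ∈ D
  grad : HasWeakGrad ψ g
  finite : FinitePotential W ψ
  eq : ∀ (φ : L2 N) (h : Fin N → L2 N), φ ∈ D → HasWeakGrad φ h → FinitePotential W φ →
    (c : ℂ) * ∑ i, ⟪h i, g i⟫_ℂ + ∫ x, (W x : ℂ) * (starRingEnd ℂ (φ x) * ψ x) = E * ⟪φ, ψ⟫_ℂ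

theorem IsFormEigen.energy_eq {c : ℝ} {W : Conf N → ℝ} {D : Set (L2 N)} {ψ : L2 N}
    {g : Fin N → L2 N} {E : ℝ} (h : IsFormEigen c W D ψ g E) : energy c W ψ g = E * ‖ψ‖ ^ 2 := by
  have h1 := h.eq ψ g h.mem h.grad h.finite
  rw [form_self_eq_energy, inner_self_eq_norm_sq_to_K] at h1
  have h2 : (energy c W ψ g : ℂ) = ((E * ‖ψ‖ ^ 2 : ℝ) : ℂ) := by
    rw [h1]
    push_cast
    rfl
  exact_mod_cast h2

/-- Bessel's inequality for the form: orthonormal eigenvectors see at most the energy of a wave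
function. -/
theorem sum_level_mul_le_energy {A : Type*} {c : ℝ} (hc : 0 ≤ c) {W : Conf N → ℝ} {C : ℝ}
    (hW : AEMeasurable W) (hWC : ∀ᵐ x, 0 ≤ W x + C) {D : Set (L2 N)} {f : A → L2 N}
    {g : A → Fin N → L2 N} {E : A → ℝ} (hf : Orthonormal ℂ f)
    (hfE : ∀ a, IsFormEigen c W D (f a) (g a) (E a)) {φ : L2 N} {h : Fin N → L2 N}
    (hφ : φ ∈ D) (hh : HasWeakGrad φ h) (hfin : FinitePotential W φ) (F : Finset A) :
    ∑ a ∈ F, (E a + C + 1) * ‖⟪f a, φ⟫_ℂ‖ ^ 2 ≤ energy c W φ h + (C + 1) * ‖φ‖ ^ 2 := by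
  classical
  have hs := fun a => (memLp_sqrt_mul_iff hW hWC).2 (hfE a).finite
  have hsφ := (memLp_sqrt_mul_iff hW hWC).2 hfin
  have key : ∀ a (ψ : L2 N) (k : Fin N → L2 N) (hψ : ψ ∈ D) (hk : HasWeakGrad ψ k)
      (hWψ : FinitePotential W ψ),
      ⟪mkFormVec c (g a) (hs a), mkFormVec c k ((memLp_sqrt_mul_iff hW hWC).2 hWψ)⟫_ℂ =
        ((E a + C + 1 : ℝ) : ℂ) * ⟪f a, ψ⟫_ℂ := by
    intro a ψ k hψ hk hWψ
    rw [← inner_conj_symm, inner_mkFormVec hc hWC, (hfE a).eq ψ k hψ hk hWψ, ← add_mul, map_mul,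
      inner_conj_symm]
    congr 1
    have : ((E a : ℂ) + ((C : ℂ) + 1)) = ((E a + C + 1 : ℝ) : ℂ) := by
      push_cast
      ring
    rw [this, Complex.conj_ofReal]
  rw [← norm_sq_mkFormVec hc hWC h hsφ]
  refine sum_mul_sq_le_of_orthogonal (J := fun a => mkFormVec c (g a) (hs a))
    (fun a b => ?_) (fun a => ?_) F
  · rw [key a (f b) (g b) (hfE b).mem (hfE b).grad (hfE b).finite, orthonormal_iff_ite.1 hf]
    split_ifs <;> simp
  · exact key a φ h hφ hh hfin

/-! ### Existence of the spectral resolution -/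

/-- The form domain of the bosonic Hamiltonian, with its Hilbert space structure. -/
def formSpace (c : ℝ) (W : Conf N → ℝ) (C : ℝ) : Submodule ℂ (FormVec N) where
  carrier := {v | IsBosonic (v none) ∧
    HasWeakGrad ((Real.sqrt c : ℂ) • v none) (fun i => v (some (some i))) ∧
    v (some none) =ᵐ[volume] fun x => (Real.sqrt (W x + C) : ℂ) * v none x}
  zero_mem' := by
    refine ⟨(bosonic N).zero_mem, ?_, ?_⟩
    · have h : (Real.sqrt c : ℂ) • (0 : FormVec N) none = 0 := smul_zero _
      rw [h]
      exact hasWeakGrad_zero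
    · have h0 := Lp.coeFn_zero ℂ 2 (volume : Measure (Conf N))
      filter_upwards [h0] with x hx
      have h : (0 : L2 N) x = 0 := hx
      show (0 : L2 N) x = _ * (0 : L2 N) x
      rw [h, mul_zero]
  add_mem' := by
    rintro v w ⟨hv1, hv2, hv3⟩ ⟨hw1, hw2, hw3⟩
    refine ⟨(bosonic N).add_mem hv1 hw1, ?_, ?_⟩
    · have h : (Real.sqrt c : ℂ) • (v + w) none =
          (Real.sqrt c : ℂ) • v none + (Real.sqrt c : ℂ) • w none := smul_add _ _ _
      rw [h]
      exact hv2.add hw2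
    · filter_upwards [hv3, hw3, Lp.coeFn_add (v none) (w none),
        Lp.coeFn_add (v (some none)) (w (some none))] with x h1 h2 h3 h4
      show (v (some none) + w (some none) : L2 N) x = _ * (v none + w none : L2 N) x
      rw [h3, h4, Pi.add_apply, Pi.add_apply, h1, h2, mul_add]
  smul_mem' := by
    rintro t v ⟨hv1, hv2, hv3⟩
    refine ⟨(bosonic N).smul_mem t hv1, ?_, ?_⟩
    · have h : (Real.sqrt c : ℂ) • (t • v) none = t • ((Real.sqrt c : ℂ) • v none) := by
        show (Real.sqrt c : ℂ) • (t • v none) = t • ((Real.sqrt c : ℂ) • v none)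
        exact smul_comm _ _ _
      rw [h]
      exact hv2.smul t
    · filter_upwards [hv3, Lp.coeFn_smul t (v none), Lp.coeFn_smul t (v (some none))]
        with x h1 h3 h4
      show (t • v (some none) : L2 N) x = _ * (t • v none : L2 N) x
      rw [h3, h4, Pi.smul_apply, Pi.smul_apply, h1, smul_eq_mul, smul_eq_mul, mul_left_comm]

theorem mem_formSpace {c : ℝ} {W : Conf N → ℝ} {C : ℝ} {v : FormVec N} :
    v ∈ formSpace c W C ↔ IsBosonic (v none) ∧
    HasWeakGrad ((Real.sqrt c : ℂ) • v none) (fun i => v (some (some i))) ∧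
    v (some none) =ᵐ[volume] fun x => (Real.sqrt (W x + C) : ℂ) * v none x := Iff.rfl

theorem isClosed_formSpace (c : ℝ) (W : Conf N → ℝ) (C : ℝ) :
    IsClosed (formSpace c W C : Set (FormVec N)) := by
  have hcont : ∀ o, Continuous fun v : FormVec N => v o := fun o =>
    PiLp.continuous_apply 2 (fun _ : Option (Option (Fin N)) => L2 N) o
  refine IsSeqClosed.isClosed fun v w hv hvw => ?_
  have hlim : ∀ o, Tendsto (fun n => v n o) atTop (𝓝 (w o)) := fun o =>
    ((hcont o).tendsto w).comp hvw
  refine mem_formSpace.2 ⟨?_, ?_, ?_⟩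
  · exact isClosed_bosonic.mem_of_tendsto (hlim none)
      (Eventually.of_forall fun n => (mem_formSpace.1 (hv n)).1)
  · intro i η hη hs
    have h1 : Tendsto
        (fun n => ∫ x, fderiv ℝ η x (Pi.single i 1) • ((Real.sqrt c : ℂ) • v n none) x)
        atTop (𝓝 (∫ x, fderiv ℝ η x (Pi.single i 1) • ((Real.sqrt c : ℂ) • w none) x)) :=
      ((continuous_integral_smul (continuous_fderiv_single hη i)
        (hasCompactSupport_fderiv_single hs i)).tendsto _).comp ((hlim none).const_smul _)
    have h2 : Tendsto (fun n => -∫ x, η x • v n (some (some i)) x)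
        atTop (𝓝 (-∫ x, η x • w (some (some i)) x)) :=
      (((continuous_integral_smul hη.continuous hs).tendsto _).comp (hlim (some (some i)))).neg
    exact tendsto_nhds_unique h1 (h2.congr fun n =>
      ((mem_formSpace.1 (hv n)).2.1 i η hη hs).symm)
  · -- the graph of a multiplication operator is closed: pass to a.e. convergent subsequences
    obtain ⟨ns, hns, h1⟩ := (tendstoInMeasure_of_tendsto_Lp (hlim none)).exists_seq_tendsto_ae
    have h2 : Tendsto (fun n => v (ns n) (some none)) atTop (𝓝 (w (some none))) :=
      (hlim (some none)).comp hns.tendsto_atTop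
    obtain ⟨ms, hms, h3⟩ := (tendstoInMeasure_of_tendsto_Lp h2).exists_seq_tendsto_ae
    have h4 : ∀ᵐ x, ∀ n, v n (some none) x = (Real.sqrt (W x + C) : ℂ) * v n none x :=
      ae_all_iff.2 fun n => (mem_formSpace.1 (hv n)).2.2
    filter_upwards [h1, h3, h4] with x hx1 hx3 hx4
    have h5 := (hx1.comp hms.tendsto_atTop).const_mul (Real.sqrt (W x + C) : ℂ)
    refine tendsto_nhds_unique hx3 (h5.congr fun n => ?_)
    exact (hx4 _).symm

instance (c : ℝ) (W : Conf N → ℝ) (C : ℝ) : CompleteSpace (formSpace c W C) :=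
  (isClosed_formSpace c W C).completeSpace_coe

theorem mkFormVec_mem_formSpace {c : ℝ} {W : Conf N → ℝ} {C : ℝ} {φ : L2 N} {h : Fin N → L2 N}
    (hb : IsBosonic φ) (hh : HasWeakGrad φ h)
    (hs : MemLp (fun x => (Real.sqrt (W x + C) : ℂ) * φ x) 2) :
    mkFormVec c h hs ∈ formSpace c W C :=
  ⟨hb, hh.smul _, hs.coeFn_toLp⟩

theorem exists_eq_mkFormVec {c : ℝ} (hc : 0 < c) {W : Conf N → ℝ} {C : ℝ} {v : FormVec N}
    (hv : v ∈ formSpace c W C) :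
    ∃ (h : Fin N → L2 N) (hs : MemLp (fun x => (Real.sqrt (W x + C) : ℂ) * v none x) 2),
      HasWeakGrad (v none) h ∧ v = mkFormVec (W := W) (C := C) (φ := v none) c h hs := by
  obtain ⟨-, h2, h3⟩ := mem_formSpace.1 hv
  have hc0 : (Real.sqrt c : ℂ) ≠ 0 := by
    have := Real.sqrt_pos.2 hc
    exact_mod_cast this.ne'
  have hs : MemLp (fun x => (Real.sqrt (W x + C) : ℂ) * v none x) 2 :=
    (Lp.memLp (v (some none))).ae_eq h3
  refine ⟨fun i => (Real.sqrt c : ℂ)⁻¹ • v (some (some i)), hs, ?_, ?_⟩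
  · have := h2.smul (Real.sqrt c : ℂ)⁻¹
    rwa [inv_smul_smul₀ hc0] at this
  · have h4 : v (some none) = hs.toLp _ := Lp.ext_iff.2 (h3.trans hs.coeFn_toLp.symm)
    have h5 : ∀ i, v (some (some i)) =
        (Real.sqrt c : ℂ) • ((Real.sqrt c : ℂ)⁻¹ • v (some (some i))) := fun i =>
      (smul_inv_smul₀ hc0 (v (some (some i)))).symm
    refine PiLp.ext fun o => ?_
    match o with
    | none => rfl
    | some none => exact h4
    | some (some i) => exact h5 i

/-- The embedding of the form domain into the bosonic subspace. -/
def formEmbedding (c : ℝ) (W : Conf N → ℝ) (C : ℝ) : formSpace c W C →L[ℂ] bosonic N :=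
  ((PiLp.proj 2 (fun _ : Option (Option (Fin N)) => L2 N) none).comp
    (formSpace c W C).subtypeL).codRestrict (bosonic N) fun v => v.2.1

theorem finite_level_le {c κ : ℝ} (hc : 0 < c) (hκ : κ ≠ 0) (R : ℝ) :
    {a : Fin N → ℕ | level c κ a ≤ R}.Finite := by
  have hε : 0 < c * κ ^ 2 := by positivity
  refine (Set.finite_Iic (fun _ : Fin N => ⌊R / (c * κ ^ 2)⌋₊)).subset fun a ha i => ?_
  have h1 : c * κ ^ 2 * (a i + 1 / 2) ≤ level c κ a :=
    Finset.single_le_sum (f := fun i => c * κ ^ 2 * ((a i : ℝ) + 1 / 2))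
      (fun j _ => by positivity) (Finset.mem_univ i)
  refine Nat.le_floor ?_
  rw [le_div_iff₀ hε]
  have ha' : level c κ a ≤ R := ha
  nlinarith

theorem level_nonneg {c κ : ℝ} (hc : 0 ≤ c) (a : Fin N → ℕ) : 0 ≤ level c κ a :=
  Finset.sum_nonneg fun i _ => by positivity

theorem isFormEigen_hermL2 {c κ : ℝ} (hκ : κ ≠ 0) (a : Fin N → ℕ) :
    IsFormEigen c (osc c κ N) Set.univ (hermL2 κ a) (hermGrad κ a) (level c κ a) :=
  ⟨trivial, hasWeakGrad_hermL2 hκ a, finitePotential_osc_gL2 hκ c _,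
    fun _ _ _ hh _ => hermL2_eigen hκ c a hh⟩

theorem sum_level_hermL2_le {c κ : ℝ} (hc : 0 < c) (hκ : κ ≠ 0) {φ : L2 N} {h : Fin N → L2 N}
    (hh : HasWeakGrad φ h) (hfin : FinitePotential (osc c κ N) φ) (F : Finset (Fin N → ℕ)) :
    ∑ a ∈ F, (level c κ a + 1) * ‖⟪hermL2 κ a, φ⟫_ℂ‖ ^ 2 ≤
      energy c (osc c κ N) φ h + ‖φ‖ ^ 2 := by
  have := sum_level_mul_le_energy (C := 0) hc.le (continuous_osc c κ).aemeasurable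
    (ae_of_all _ fun x => by simpa using osc_nonneg hc.le κ x) (orthonormal_hermL2 hκ)
    (isFormEigen_hermL2 hκ) (Set.mem_univ φ) hh hfin F
  simpa using this

/-- A potential above the oscillator (up to a constant) has finite energy only where the
oscillator has. -/
theorem finitePotential_osc_of_le {c κ : ℝ} (hc : 0 ≤ c) {W : Conf N → ℝ} {C : ℝ}
    (hWC : ∀ᵐ x, osc c κ N x ≤ W x + C) {φ : L2 N} (hφ : FinitePotential W φ) :
    FinitePotential (osc c κ N) φ := by
  have hφ2 : Integrable fun x => C * ‖φ x‖ ^ 2 :=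
    ((memLp_two_iff_integrable_sq_norm (Lp.aestronglyMeasurable φ)).1 (Lp.memLp φ)).const_mul C
  refine (Integrable.add hφ hφ2).mono' ((continuous_osc c κ).aestronglyMeasurable.mul
    ((Lp.aestronglyMeasurable φ).norm.pow 2)) ?_
  filter_upwards [hWC] with x hx
  rw [Real.norm_of_nonneg (mul_nonneg (osc_nonneg hc κ x) (sq_nonneg _))]
  have := mul_le_mul_of_nonneg_right hx (sq_nonneg ‖φ x‖)
  simpa [add_mul] using this

theorem norm_sq_L2 (φ : L2 N) : ‖φ‖ ^ 2 = ∫ x, ‖φ x‖ ^ 2 := by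
  have h : ((‖φ‖ ^ 2 : ℝ) : ℂ) = ((∫ x, ‖φ x‖ ^ 2 : ℝ) : ℂ) := by
    rw [← integral_complex_ofReal]
    have h1 := inner_self_eq_norm_sq_to_K (𝕜 := ℂ) φ
    rw [L2.inner_def] at h1
    push_cast
    refine Eq.trans h1.symm (integral_congr_ae (ae_of_all _ fun x => ?_))
    simp only
    rw [RCLike.inner_apply, mul_comm, Complex.conj_mul']
  exact_mod_cast h

theorem energy_osc_le {c κ : ℝ} (hc : 0 ≤ c) {W : Conf N → ℝ} {C : ℝ}
    (hWC : ∀ᵐ x, osc c κ N x ≤ W x + C) {φ : L2 N} (hφ : FinitePotential W φ)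
    (h : Fin N → L2 N) : energy c (osc c κ N) φ h ≤ energy c W φ h + C * ‖φ‖ ^ 2 := by
  have hφ2 : Integrable fun x => C * ‖φ x‖ ^ 2 :=
    ((memLp_two_iff_integrable_sq_norm (Lp.aestronglyMeasurable φ)).1 (Lp.memLp φ)).const_mul C
  rw [energy, energy, norm_sq_L2 φ, ← integral_const_mul, add_assoc, ← integral_add hφ hφ2]
  refine add_le_add le_rfl (integral_mono_ae (finitePotential_osc_of_le hc hWC hφ)
    (Integrable.add hφ hφ2) ?_)
  filter_upwards [hWC] with x hx
  have := mul_le_mul_of_nonneg_right hx (sq_nonneg ‖φ x‖)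
  simpa [add_mul] using this

/-- Bosonic eigenvectors of the form with the potential `W` span the bosonic subspace, if `W` is
above an oscillator and the form is densely defined. -/
theorem exists_form_eigenbasis (hN : 0 < N) {c κ : ℝ} (hc : 0 < c) (hκ : κ ≠ 0)
    {W : Conf N → ℝ} {C : ℝ} (hW : AEMeasurable W) (hWC : ∀ᵐ x, osc c κ N x ≤ W x + C)
    (hd : ∀ χ : L2 N, IsBosonic χ → (∀ φ h, IsBosonic φ → HasWeakGrad φ h → FinitePotential W φ →
      ⟪φ, χ⟫_ℂ = 0) → χ = 0) :
    ∃ (f : ℕ → L2 N) (g : ℕ → Fin N → L2 N) (E : ℕ → ℝ), Orthonormal ℂ f ∧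
      (∀ χ : L2 N, IsBosonic χ → (∀ k, ⟪f k, χ⟫_ℂ = 0) → χ = 0) ∧
      ∀ k, IsFormEigen c W {ψ | IsBosonic ψ} (f k) (g k) (E k) := by
  have hWC0 : ∀ᵐ x, 0 ≤ W x + C := by
    filter_upwards [hWC] with x hx
    exact (osc_nonneg hc.le κ x).trans hx
  set J := formEmbedding c W C with hJ
  have hcompact : IsCompactOperator J := by
    have h1 : IsCompactOperator ((PiLp.proj 2 (fun _ : Option (Option (Fin N)) => L2 N) none).comp
        (formSpace c W C).subtypeL) := by
      refine isCompactOperator_of_levels (orthonormal_hermL2 hκ)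
        (fun x hx => eq_zero_of_inner_hermL2 hκ hx) (finite_level_le hc hκ)
        (fun a => level_nonneg hc.le a) _ fun v F => ?_
      obtain ⟨h, hs, hh, hv⟩ := exists_eq_mkFormVec hc v.2
      have hfin := (memLp_sqrt_mul_iff hW hWC0).1 hs
      have h2 := sum_level_hermL2_le hc hκ hh (finitePotential_osc_of_le hc.le hWC hfin) F
      have h3 := energy_osc_le hc.le hWC hfin h
      have h4 : ‖v‖ ^ 2 = energy c W ((v : FormVec N) none) h +
          (C + 1) * ‖(v : FormVec N) none‖ ^ 2 := by
        rw [← norm_sq_mkFormVec hc.le hWC0 h hs, ← hv]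
        rfl
      rw [h4]
      refine (Finset.sum_le_sum fun a _ => ?_).trans (h2.trans (by linarith))
      exact mul_le_mul_of_nonneg_right (by linarith) (sq_nonneg _)
    exact h1.codRestrict (fun v => v.2.1) isClosed_bosonic
  have hdense : ∀ x : bosonic N, (∀ v, ⟪J v, x⟫_ℂ = 0) → x = 0 := by
    intro x hx
    refine Subtype.ext (hd x x.2 fun φ h hb hh hfin => ?_)
    exact hx ⟨_, mkFormVec_mem_formSpace hb hh ((memLp_sqrt_mul_iff hW hWC0).2 hfin)⟩
  obtain ⟨f, u, l, hf, hfc, hfu, hful⟩ :=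
    exists_eigenbasis_of_compact (not_finiteDimensional_bosonic hN) J hcompact hdense
  choose g hs hg hu using fun k => exists_eq_mkFormVec hc (u k).2
  have hfu' : ∀ k, (f k : L2 N) = (u k : FormVec N) none := fun k => by
    rw [← hfu k]
    rfl
  refine ⟨fun k => f k, g, fun k => l k - C - 1, ?_, fun χ hχ h0 => ?_, fun k => ⟨(f k).2, ?_, ?_,
    fun φ h hφ hh hfin => ?_⟩⟩
  · exact hf.comp_linearIsometry (bosonic N).subtypeₗᵢ
  · exact congrArg Subtype.val (hfc ⟨χ, hχ⟩ h0)
  · simp only [hfu']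
    exact hg k
  · simp only [hfu']
    exact (memLp_sqrt_mul_iff hW hWC0).1 (hs k)
  · have hsφ := (memLp_sqrt_mul_iff hW hWC0).2 hfin
    have h1 := hful k ⟨_, mkFormVec_mem_formSpace hφ hh hsφ⟩
    have h2 : ⟪mkFormVec c h hsφ, mkFormVec c (g k) (hs k)⟫_ℂ = l k * ⟪φ, f k⟫_ℂ := by
      rw [← hu k]
      exact h1
    rw [inner_mkFormVec hc.le hWC0] at h2
    simp only [hfu'] at h2 ⊢
    push_cast
    linear_combination h2

/-! ### The partition function of the ideal gas -/

/-- The generating function of the increasing sequences (that is, of the occupation numbers of the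
ideal Bose gas) is at most a product of geometric series. -/
theorem tsum_monotone_pow_le (r : ℝ≥0∞) (N : ℕ) :
    ∑' a : {a : Fin N → ℕ // Monotone a}, r ^ (∑ i, a.1 i) ≤
      ∏ k ∈ Finset.range N, (1 - r ^ (k + 1))⁻¹ := by
  induction N with
  | zero =>
    have : Unique {a : Fin 0 → ℕ // Monotone a} :=
      ⟨⟨⟨Fin.elim0, fun i => i.elim0⟩⟩, fun a => Subtype.ext (funext fun i => i.elim0)⟩
    rw [tsum_fintype]
    simp
  | succ N ih =>
    -- split off the smallest entry and subtract it from the others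
    let e : {a : Fin (N + 1) → ℕ // Monotone a} → ℕ × {a : Fin N → ℕ // Monotone a} := fun a =>
      (a.1 0, ⟨fun i => a.1 i.succ - a.1 0, fun i j hij =>
        Nat.sub_le_sub_right (a.2 (Fin.succ_le_succ_iff.2 hij)) _⟩)
    have he : Function.Injective e := by
      intro a b hab
      have h0 : a.1 0 = b.1 0 := congrArg Prod.fst hab
      have h1 : ∀ i : Fin N, a.1 i.succ - a.1 0 = b.1 i.succ - b.1 0 := fun i =>
        congrFun (congrArg Subtype.val (congrArg Prod.snd hab)) i
      refine Subtype.ext (funext fun i => ?_)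
      refine Fin.cases h0 (fun i => ?_) i
      have ha := a.2 (Fin.zero_le i.succ)
      have hb := b.2 (Fin.zero_le i.succ)
      have := h1 i
      omega
    let F : ℕ × {a : Fin N → ℕ // Monotone a} → ℝ≥0∞ := fun p =>
      (r ^ (N + 1)) ^ p.1 * r ^ (∑ i, p.2.1 i)
    have hF : ∀ a : {a : Fin (N + 1) → ℕ // Monotone a}, r ^ (∑ i, a.1 i) = F (e a) := by
      intro a
      simp only [F, e]
      rw [← pow_mul, ← pow_add, Fin.sum_univ_succ]
      congr 1
      have : ∑ i : Fin N, a.1 i.succ = ∑ i : Fin N, ((a.1 i.succ - a.1 0) + a.1 0) :=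
        Finset.sum_congr rfl fun i _ => (Nat.sub_add_cancel (a.2 (Fin.zero_le i.succ))).symm
      rw [this, Finset.sum_add_distrib, Finset.sum_const, Finset.card_univ, Fintype.card_fin]
      simp only [smul_eq_mul]
      ring
    calc ∑' a : {a : Fin (N + 1) → ℕ // Monotone a}, r ^ (∑ i, a.1 i)
        = ∑' a, F (e a) := tsum_congr hF
      _ ≤ ∑' p, F p := ENNReal.tsum_comp_le_tsum_of_injective he F
      _ = (∑' m : ℕ, (r ^ (N + 1)) ^ m) *
          ∑' a : {a : Fin N → ℕ // Monotone a}, r ^ (∑ i, a.1 i) := by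
        rw [ENNReal.tsum_prod', ← ENNReal.tsum_mul_right]
        refine tsum_congr fun m => ?_
        simp only [F]
        rw [ENNReal.tsum_mul_left]
      _ ≤ (1 - r ^ (N + 1))⁻¹ * ∏ k ∈ Finset.range N, (1 - r ^ (k + 1))⁻¹ := by
        rw [ENNReal.tsum_geometric]
        gcongr
      _ = _ := by rw [Finset.prod_range_succ, mul_comm]

theorem inv_one_sub_exp_le {s : ℝ} (hs : 0 < s) :
    (1 - ENNReal.ofReal (Real.exp (-s)))⁻¹ ≤ ENNReal.ofReal (Real.exp s⁻¹) := by
  have h1 : Real.exp (-s) < 1 := by rw [Real.exp_lt_one_iff]; linarith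
  have h2 : 0 < 1 - Real.exp (-s) := by linarith
  rw [← ENNReal.ofReal_one, ← ENNReal.ofReal_sub _ (Real.exp_pos _).le,
    ← ENNReal.ofReal_inv_of_pos h2]
  refine ENNReal.ofReal_le_ofReal ?_
  have h3 : Real.exp (-s) ≤ (1 + s)⁻¹ := by
    rw [Real.exp_neg]
    exact inv_anti₀ (by linarith) (by linarith [Real.add_one_le_exp s])
  have h4 : s / (1 + s) ≤ 1 - Real.exp (-s) := by
    have : s / (1 + s) = 1 - (1 + s)⁻¹ := by field_simp; ring
    linarith
  calc (1 - Real.exp (-s))⁻¹ ≤ (s / (1 + s))⁻¹ := inv_anti₀ (by positivity) h4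
    _ = s⁻¹ + 1 := by field_simp
    _ ≤ Real.exp s⁻¹ := Real.add_one_le_exp _

/-- The logarithm of the partition function of the ideal gas, with level spacing `t` in units of
the temperature, is at most `(1 + log N) / t`. -/
theorem tsum_monotone_exp_le {t : ℝ} (ht : 0 < t) (N : ℕ) :
    ∑' a : {a : Fin N → ℕ // Monotone a}, ENNReal.ofReal (Real.exp (-t * ∑ i, (a.1 i : ℝ))) ≤
      ENNReal.ofReal (Real.exp ((1 + Real.log N) / t)) := by
  have h1 : ∀ a : {a : Fin N → ℕ // Monotone a},
      ENNReal.ofReal (Real.exp (-t * ∑ i, (a.1 i : ℝ))) =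
        ENNReal.ofReal (Real.exp (-t)) ^ (∑ i, a.1 i) := by
    intro a
    rw [← ENNReal.ofReal_pow (Real.exp_pos _).le, ← Real.exp_nat_mul]
    congr 2
    push_cast
    ring
  rw [tsum_congr h1]
  refine (tsum_monotone_pow_le _ N).trans ?_
  calc ∏ k ∈ Finset.range N, (1 - ENNReal.ofReal (Real.exp (-t)) ^ (k + 1))⁻¹
      ≤ ∏ k ∈ Finset.range N, ENNReal.ofReal (Real.exp (t * (k + 1))⁻¹) := by
        refine Finset.prod_le_prod' fun k _ => ?_
        have h2 : ENNReal.ofReal (Real.exp (-t)) ^ (k + 1) =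
            ENNReal.ofReal (Real.exp (-(t * (k + 1)))) := by
          rw [← ENNReal.ofReal_pow (Real.exp_pos _).le, ← Real.exp_nat_mul]
          congr 2
          push_cast
          ring
        rw [h2]
        exact inv_one_sub_exp_le (by positivity)
    _ = ENNReal.ofReal (Real.exp (∑ k ∈ Finset.range N, (t * ((k : ℝ) + 1))⁻¹)) := by
        rw [Real.exp_sum, ENNReal.ofReal_prod_of_nonneg fun k _ => (Real.exp_pos _).le]
    _ ≤ ENNReal.ofReal (Real.exp ((1 + Real.log N) / t)) := by
        refine ENNReal.ofReal_le_ofReal (Real.exp_le_exp.2 ?_)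
        have h3 := harmonic_le_one_add_log N
        rw [harmonic] at h3
        push_cast at h3
        have h4 : ∑ k ∈ Finset.range N, (t * ((k : ℝ) + 1))⁻¹ =
            t⁻¹ * ∑ k ∈ Finset.range N, ((k : ℝ) + 1)⁻¹ := by
          rw [Finset.mul_sum]
          exact Finset.sum_congr rfl fun k _ => mul_inv _ _
        rw [h4, div_eq_inv_mul]
        exact mul_le_mul_of_nonneg_left h3 (by positivity)

/-! ### Jensen's and Peierls' inequalities -/

/-- Jensen's inequality for the exponential function and a discrete probability law. -/
theorem exp_tsum_le {A : Type*} {p y : A → ℝ} (hp : ∀ a, 0 ≤ p a) (hp1 : HasSum p 1)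
    (hy : Summable fun a => p a * y a) (he : Summable fun a => p a * Real.exp (y a)) :
    Real.exp (∑' a, p a * y a) ≤ ∑' a, p a * Real.exp (y a) := by
  set μ := ∑' a, p a * y a with hμ
  -- the tangent line of `exp` at the mean
  have h1 : HasSum (fun a => Real.exp μ * (p a * y a) + Real.exp μ * (1 - μ) * p a)
      (Real.exp μ * μ + Real.exp μ * (1 - μ) * 1) :=
    (hy.hasSum.mul_left _).add (hp1.mul_left _)
  have h2 : Real.exp μ * μ + Real.exp μ * (1 - μ) * 1 = Real.exp μ := by ring
  rw [h2] at h1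
  refine hasSum_le (fun a => ?_) h1 he.hasSum
  have h3 : Real.exp (y a) = Real.exp μ * Real.exp (y a - μ) := by
    rw [← Real.exp_add]
    congr 1
    ring
  have h4 := Real.add_one_le_exp (y a - μ)
  have h5 : Real.exp μ * (y a - μ + 1) ≤ Real.exp (y a) := by
    rw [h3]
    exact mul_le_mul_of_nonneg_left h4 (Real.exp_pos _).le
  calc Real.exp μ * (p a * y a) + Real.exp μ * (1 - μ) * p a
      = p a * (Real.exp μ * (y a - μ + 1)) := by ring
    _ ≤ p a * Real.exp (y a) := mul_le_mul_of_nonneg_left h5 (hp a)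

/-- The convexity step in Peierls' inequality: `q` is an upper bound of the mean of the levels `l`
in the law `p`. -/
theorem ofReal_exp_le_tsum {A : Type*} {p l : A → ℝ} (hp : ∀ a, 0 ≤ p a) (hp1 : HasSum p 1)
    {L q t : ℝ} (ht : 0 ≤ t) (hl : ∀ a, 0 ≤ l a + L)
    (hq : ∀ F : Finset A, ∑ a ∈ F, (l a + L) * p a ≤ q + L) :
    ENNReal.ofReal (Real.exp (-t * q)) ≤
      ∑' a, ENNReal.ofReal (p a) * ENNReal.ofReal (Real.exp (-t * l a)) := by
  have h0 : ∀ a, 0 ≤ (l a + L) * p a := fun a => mul_nonneg (hl a) (hp a)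
  have hs : Summable fun a => (l a + L) * p a := summable_of_sum_le h0 hq
  have hle : ∑' a, (l a + L) * p a ≤ q + L := hs.tsum_le_of_sum_le hq
  have hs2 : Summable fun a => p a * (-t * l a) := by
    refine ((hs.sub (hp1.summable.mul_left L)).mul_left (-t)).congr fun a => ?_
    ring
  have hts : ∑' a, p a * (-t * l a) = -t * (∑' a, (l a + L) * p a) + t * L := by
    have h1 : HasSum (fun a => -t * ((l a + L) * p a) + t * L * p a)
        (-t * (∑' a, (l a + L) * p a) + t * L * 1) :=
      (hs.hasSum.mul_left _).add (hp1.mul_left _)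
    rw [mul_one] at h1
    rw [← h1.tsum_eq]
    exact tsum_congr fun a => by ring
  have he : Summable fun a => p a * Real.exp (-t * l a) := by
    refine Summable.of_nonneg_of_le (fun a => mul_nonneg (hp a) (Real.exp_pos _).le) (fun a => ?_)
      (hp1.summable.mul_right (Real.exp (t * L)))
    refine mul_le_mul_of_nonneg_left (Real.exp_le_exp.2 ?_) (hp a)
    nlinarith [mul_nonneg ht (hl a)]
  have hj := exp_tsum_le hp hp1 hs2 he
  have hmono : Real.exp (-t * q) ≤ ∑' a, p a * Real.exp (-t * l a) := by
    refine le_trans (Real.exp_le_exp.2 ?_) hj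
    rw [hts]
    nlinarith [mul_le_mul_of_nonneg_left hle ht]
  refine (ENNReal.ofReal_le_ofReal hmono).trans ?_
  rw [ENNReal.ofReal_tsum_of_nonneg (fun a => mul_nonneg (hp a) (Real.exp_pos _).le) he]
  exact le_of_eq (tsum_congr fun a => ENNReal.ofReal_mul (hp a))

theorem level_eq (c κ : ℝ) (a : Fin N → ℕ) :
    level c κ a = c * κ ^ 2 * ∑ i, (a i : ℝ) + c * κ ^ 2 * N / 2 := by
  rw [level, ← Finset.mul_sum, Finset.sum_add_distrib, Finset.sum_const, Finset.card_univ,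
    Fintype.card_fin, nsmul_eq_mul]
  ring

theorem level_comp_perm (c κ : ℝ) (a : Fin N → ℕ) (σ : Equiv.Perm (Fin N)) :
    level c κ (a ∘ σ) = level c κ a := by
  rw [level_eq, level_eq]
  congr 2
  exact Equiv.sum_comp σ fun i => (a i : ℝ)

theorem hasSum_norm_sq_hermL2 {κ : ℝ} (hκ : κ ≠ 0) (ψ : L2 N) :
    HasSum (fun a : Fin N → ℕ => ‖⟪hermL2 κ a, ψ⟫_ℂ‖ ^ 2) (‖ψ‖ ^ 2) :=
  hasSum_sq_norm_inner (orthonormal_hermL2 hκ) (fun _ hx => eq_zero_of_inner_hermL2 hκ hx) ψ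

/-- An orthonormal family of bosonic functions has total weight at most one on the quantum numbers
that are rearrangements of each other. -/
theorem sum_orbit_tsum_le {A : Type*} {κ : ℝ} (hκ : κ ≠ 0) {f : A → L2 N} (hf : Orthonormal ℂ f)
    (hb : ∀ k, IsBosonic (f k)) (a : Fin N → ℕ) :
    ∑ b ∈ orbit a, ∑' k, ENNReal.ofReal (‖⟪hermL2 κ b, f k⟫_ℂ‖ ^ 2) ≤ 1 := by
  have h1 : ∀ b ∈ orbit a, ∑' k, ENNReal.ofReal (‖⟪hermL2 κ b, f k⟫_ℂ‖ ^ 2) =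
      ∑' k, ENNReal.ofReal (‖⟪hermL2 κ a, f k⟫_ℂ‖ ^ 2) := by
    intro b hb'
    obtain ⟨σ, rfl⟩ := mem_orbit.1 hb'
    exact tsum_congr fun k => by rw [inner_hermL2_comp hκ (hb k)]
  rw [Finset.sum_congr rfl h1, Finset.sum_const, nsmul_eq_mul, ← ENNReal.tsum_mul_left]
  have hcard : (0 : ℝ) < (orbit a).card := by
    exact_mod_cast Finset.card_pos.2 ⟨a, self_mem_orbit a⟩
  -- Bessel's inequality for the symmetrised Hermite function
  have h2 : ∀ k, ((orbit a).card : ℝ≥0∞) * ENNReal.ofReal (‖⟪hermL2 κ a, f k⟫_ℂ‖ ^ 2) =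
      ENNReal.ofReal (((orbit a).card : ℝ)⁻¹ * ‖⟪f k, symVec κ a⟫_ℂ‖ ^ 2) := by
    intro k
    rw [norm_inner_symm (f k) (symVec κ a), inner_symVec hκ (hb k), norm_mul, Complex.norm_natCast,
      ← ENNReal.ofReal_natCast, ← ENNReal.ofReal_mul hcard.le]
    congr 1
    field_simp
  rw [tsum_congr h2]
  have h3 : Summable fun k => ((orbit a).card : ℝ)⁻¹ * ‖⟪f k, symVec κ a⟫_ℂ‖ ^ 2 :=
    (hf.inner_products_summable (symVec κ a)).mul_left _
  rw [← ENNReal.ofReal_tsum_of_nonneg (fun k => by positivity) h3]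
  refine ENNReal.ofReal_le_one.2 ?_
  rw [tsum_mul_left]
  have h4 := hf.tsum_inner_products_le (symVec κ a)
  rw [norm_sq_symVec hκ] at h4
  rw [inv_mul_le_iff₀ hcard, mul_one]
  exact h4

/-- Peierls' inequality for the oscillator: the trace of `exp (-t H⁰)` over any orthonormal family
of bosonic functions is bounded by the partition function of the ideal gas. -/
theorem tsum_exp_energy_le {A : Type*} {c κ t : ℝ} (hc : 0 < c) (hκ : κ ≠ 0) (ht : 0 < t)
    {f : A → L2 N} {h : A → Fin N → L2 N} (hf : Orthonormal ℂ f) (hb : ∀ k, IsBosonic (f k))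
    (hh : ∀ k, HasWeakGrad (f k) (h k)) (hfin : ∀ k, FinitePotential (osc c κ N) (f k)) :
    ∑' k, ENNReal.ofReal (Real.exp (-t * (energy c (osc c κ N) (f k) (h k) - c * κ ^ 2 * N / 2))) ≤
      ENNReal.ofReal (Real.exp ((1 + Real.log N) / (t * (c * κ ^ 2)))) := by
  have hω : 0 < c * κ ^ 2 := by positivity
  have step1 : ∀ k, ENNReal.ofReal
      (Real.exp (-t * (energy c (osc c κ N) (f k) (h k) - c * κ ^ 2 * N / 2))) ≤
      ∑' a : Fin N → ℕ, ENNReal.ofReal (‖⟪hermL2 κ a, f k⟫_ℂ‖ ^ 2) *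
        ENNReal.ofReal (Real.exp (-t * (c * κ ^ 2 * ∑ i, (a i : ℝ)))) := by
    intro k
    have hnorm : ‖f k‖ ^ 2 = 1 := by rw [hf.1 k]; norm_num
    refine ofReal_exp_le_tsum (L := c * κ ^ 2 * N / 2 + 1) (fun a => sq_nonneg _)
      (by simpa [hnorm] using hasSum_norm_sq_hermL2 hκ (f k)) ht.le (fun a => by positivity)
      fun F => ?_
    have := sum_level_hermL2_le hc hκ (hh k) (hfin k) F
    rw [hnorm] at this
    refine le_trans (le_of_eq (Finset.sum_congr rfl fun a _ => ?_)) (this.trans (by linarith))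
    rw [level_eq]
    ring
  let w : (Fin N → ℕ) → ℝ≥0∞ := fun a =>
    ENNReal.ofReal (Real.exp (-t * (c * κ ^ 2 * ∑ i, (a i : ℝ))))
  let G : (Fin N → ℕ) → ℝ≥0∞ := fun a =>
    (∑' k, ENNReal.ofReal (‖⟪hermL2 κ a, f k⟫_ℂ‖ ^ 2)) * w a
  calc ∑' k, ENNReal.ofReal
        (Real.exp (-t * (energy c (osc c κ N) (f k) (h k) - c * κ ^ 2 * N / 2)))
      ≤ ∑' k, ∑' a : Fin N → ℕ, ENNReal.ofReal (‖⟪hermL2 κ a, f k⟫_ℂ‖ ^ 2) * w a :=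
        ENNReal.tsum_le_tsum step1
    _ = ∑' a, G a := by
        rw [ENNReal.tsum_comm]
        exact tsum_congr fun a => ENNReal.tsum_mul_right
    _ ≤ ∑' τ : {a : Fin N → ℕ // Monotone a}, ∑ b ∈ orbit τ.1, G b := by
        -- every sequence is a rearrangement of an increasing one
        have h1 : ∀ τ : {a : Fin N → ℕ // Monotone a},
            ∑ b ∈ orbit τ.1, G b = ∑' b : {b // b ∈ orbit τ.1}, G b.1 := fun τ => by
          rw [tsum_fintype, Finset.univ_eq_attach, Finset.sum_attach _ G]
        rw [tsum_congr h1, ← ENNReal.tsum_sigma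
          (f := fun (τ : {a : Fin N → ℕ // Monotone a}) (b : {b // b ∈ orbit τ.1}) => G b.1)]
        let e : (Fin N → ℕ) → Σ τ : {a : Fin N → ℕ // Monotone a}, {b // b ∈ orbit τ.1} :=
          fun a => ⟨⟨a ∘ Tuple.sort a, Tuple.monotone_sort a⟩, a,
            mem_orbit.2 ⟨(Tuple.sort a).symm, by ext i; simp⟩⟩
        have he : Function.Injective e := fun a b hab => by
          have := congrArg (fun z : Σ τ : {a : Fin N → ℕ // Monotone a}, {b // b ∈ orbit τ.1} =>
            z.2.1) hab
          exact this
        exact ENNReal.tsum_comp_le_tsum_of_injective he fun z => G z.2.1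
    _ ≤ ∑' τ : {a : Fin N → ℕ // Monotone a}, w τ.1 := by
        refine ENNReal.tsum_le_tsum fun τ => ?_
        have h1 : ∀ b ∈ orbit τ.1, G b =
            (∑' k, ENNReal.ofReal (‖⟪hermL2 κ b, f k⟫_ℂ‖ ^ 2)) * w τ.1 := by
          intro b hb'
          obtain ⟨σ, rfl⟩ := mem_orbit.1 hb'
          simp only [G, w]
          congr 5
          exact Equiv.sum_comp σ fun i => (τ.1 i : ℝ)
        rw [Finset.sum_congr rfl h1, ← Finset.sum_mul]
        exact mul_le_of_le_one_left' (sum_orbit_tsum_le hκ hf hb τ.1)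
    _ ≤ _ := by
        have h1 := tsum_monotone_exp_le (mul_pos ht hω) N
        refine le_trans (le_of_eq (tsum_congr fun τ => ?_)) h1
        simp only [w]
        congr 2
        ring

/-- The ground state energy of the ideal gas is a lower bound of the energy. -/
theorem le_energy_osc {c κ : ℝ} (hc : 0 < c) (hκ : κ ≠ 0) {φ : L2 N} {h : Fin N → L2 N}
    (hh : HasWeakGrad φ h) (hfin : FinitePotential (osc c κ N) φ) :
    c * κ ^ 2 * N / 2 * ‖φ‖ ^ 2 ≤ energy c (osc c κ N) φ h := by
  have h1 := (hasSum_norm_sq_hermL2 hκ φ).mul_left (c * κ ^ 2 * N / 2 + 1)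
  have h2 := hasSum_le_of_sum_le h1 fun F => (Finset.sum_le_sum fun a _ =>
    mul_le_mul_of_nonneg_right (show c * κ ^ 2 * N / 2 + 1 ≤ level c κ a + 1 by
      rw [level_eq]
      have : 0 ≤ c * κ ^ 2 * ∑ i, (a i : ℝ) := by positivity
      linarith) (sq_nonneg ‖⟪hermL2 κ a, φ⟫_ℂ‖)).trans (sum_level_hermL2_le hc hκ hh hfin F)
  linarith

/-! ### Eigenbases and Peierls' inequality for the interacting gas -/

/-- A complete orthonormal sequence of bosonic eigenvectors `f k` of the form with the potential
`W`, with their gradients `g k` and eigenvalues `E k`. -/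
structure IsEigenbasis (c : ℝ) (W : Conf N → ℝ) (f : ℕ → L2 N) (g : ℕ → Fin N → L2 N)
    (E : ℕ → ℝ) : Prop where
  orthonormal : Orthonormal ℂ f
  complete : ∀ χ : L2 N, IsBosonic χ → (∀ k, ⟪f k, χ⟫_ℂ = 0) → χ = 0
  eigen : ∀ k, IsFormEigen c W {ψ | IsBosonic ψ} (f k) (g k) (E k)

theorem isSpectralResolution_iff {ħ m : ℝ} {W : Conf N → ℝ} {f : ℕ → L2 N} {E : ℕ → ℝ} :
    IsSpectralResolution ħ m W f E ↔ ∃ g, IsEigenbasis (ħ ^ 2 / (2 * m)) W f g E := by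
  constructor
  · intro h
    choose h1 h2 h3 g hg hE using h.eigen
    refine ⟨g, h.orthonormal, h.complete, fun k => ⟨h1 k, hg k, h3 k, fun φ h' hφ hh hfin => ?_⟩⟩
    rw [hE k φ h' hφ hh hfin, inner_smul_right]
  · rintro ⟨g, h1, h2, h3⟩
    refine ⟨fun k => (h3 k).mem, h1, h2, fun k => ⟨(h3 k).mem,
      (bosonic N).smul_mem _ (h3 k).mem, (h3 k).finite, g k, (h3 k).grad,
      fun φ h' hφ hh hfin => ?_⟩⟩
    rw [(h3 k).eq φ h' hφ hh hfin, inner_smul_right]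

section Eigenbasis

variable {c C t : ℝ} {W : Conf N → ℝ} {f : ℕ → L2 N} {g : ℕ → Fin N → L2 N} {E : ℕ → ℝ}

theorem IsEigenbasis.norm_eq (B : IsEigenbasis c W f g E) (k : ℕ) : ‖f k‖ = 1 := B.orthonormal.1 k

theorem IsEigenbasis.energy_eq (B : IsEigenbasis c W f g E) (k : ℕ) :
    energy c W (f k) (g k) = E k := by
  rw [(B.eigen k).energy_eq, B.norm_eq, one_pow, mul_one]

/-- Parseval's identity in the bosonic subspace. -/
theorem IsEigenbasis.hasSum_sq_norm_inner (B : IsEigenbasis c W f g E) {χ : L2 N}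
    (hχ : IsBosonic χ) : HasSum (fun k => ‖⟪f k, χ⟫_ℂ‖ ^ 2) (‖χ‖ ^ 2) := by
  let b : ℕ → bosonic N := fun k => ⟨f k, (B.eigen k).mem⟩
  have hb : Orthonormal ℂ b := by
    rw [orthonormal_iff_ite]
    intro i j
    exact orthonormal_iff_ite.1 B.orthonormal i j
  exact TrappedBose.hasSum_sq_norm_inner hb
    (fun x hx => Subtype.ext (B.complete x x.2 hx)) ⟨χ, hχ⟩

theorem energy_add_nonneg (hc : 0 ≤ c) (hW : AEMeasurable W) (hWC : ∀ᵐ x, 0 ≤ W x + C) {φ : L2 N}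
    (h : Fin N → L2 N) (hfin : FinitePotential W φ) :
    0 ≤ energy c W φ h + (C + 1) * ‖φ‖ ^ 2 := by
  rw [← norm_sq_mkFormVec hc hWC h ((memLp_sqrt_mul_iff hW hWC).2 hfin)]
  positivity

/-- Peierls' inequality. -/
theorem IsEigenbasis.tsum_exp_energy_le (B : IsEigenbasis c W f g E) (hc : 0 ≤ c)
    (hW : AEMeasurable W) (hWC : ∀ᵐ x, 0 ≤ W x + C) (ht : 0 ≤ t) {A : Type*} {φ : A → L2 N}
    {h : A → Fin N → L2 N} (hφ : Orthonormal ℂ φ) (hb : ∀ a, IsBosonic (φ a))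
    (hh : ∀ a, HasWeakGrad (φ a) (h a)) (hfin : ∀ a, FinitePotential W (φ a)) :
    ∑' a, ENNReal.ofReal (Real.exp (-t * energy c W (φ a) (h a))) ≤
      ∑' k, ENNReal.ofReal (Real.exp (-t * E k)) := by
  have hE : ∀ k, 0 ≤ E k + (C + 1) := fun k => by
    have := energy_add_nonneg hc hW hWC (g k) (B.eigen k).finite
    rwa [B.energy_eq, B.norm_eq, one_pow, mul_one] at this
  calc ∑' a, ENNReal.ofReal (Real.exp (-t * energy c W (φ a) (h a)))
      ≤ ∑' a, ∑' k, ENNReal.ofReal (‖⟪f k, φ a⟫_ℂ‖ ^ 2) *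
          ENNReal.ofReal (Real.exp (-t * E k)) := by
        refine ENNReal.tsum_le_tsum fun a => ?_
        have h1 : ‖φ a‖ ^ 2 = 1 := by rw [hφ.1 a, one_pow]
        refine ofReal_exp_le_tsum (fun k => sq_nonneg _) (h1 ▸ B.hasSum_sq_norm_inner (hb a)) ht hE
          fun F => ?_
        have := sum_level_mul_le_energy hc hW hWC B.orthonormal B.eigen (hb a) (hh a) (hfin a) F
        simpa only [h1, mul_one, add_assoc] using this
    _ = ∑' k, (∑' a, ENNReal.ofReal (‖⟪f k, φ a⟫_ℂ‖ ^ 2)) *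
          ENNReal.ofReal (Real.exp (-t * E k)) := by
        rw [ENNReal.tsum_comm]
        exact tsum_congr fun k => ENNReal.tsum_mul_right
    _ ≤ ∑' k, ENNReal.ofReal (Real.exp (-t * E k)) := by
        refine ENNReal.tsum_le_tsum fun k => mul_le_of_le_one_left' ?_
        have h1 : ∀ a, ‖⟪f k, φ a⟫_ℂ‖ ^ 2 = ‖⟪φ a, f k⟫_ℂ‖ ^ 2 := fun a => by
          rw [norm_inner_symm]
        simp only [h1]
        rw [← ENNReal.ofReal_tsum_of_nonneg (fun a => sq_nonneg _)
          (hφ.inner_products_summable (f k))]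
        refine ENNReal.ofReal_le_one.2 ((hφ.tsum_inner_products_le (f k)).trans ?_)
        rw [B.norm_eq, one_pow]

end Eigenbasis

/-! ### Thermal states -/

section Thermal

variable {ħ m β : ℝ} {W : Conf N → ℝ}

theorem spectralPair_spec (h : HasThermalState ħ m β W) :
    IsSpectralResolution ħ m W (spectralPair ħ m β W).1 (spectralPair ħ m β W).2 ∧
      Summable fun k => Real.exp (-β * (spectralPair ħ m β W).2 k) := by
  rw [spectralPair, dif_pos h]
  exact h.choose_spec

theorem exists_isEigenbasis (h : HasThermalState ħ m β W) :
    ∃ g, IsEigenbasis (ħ ^ 2 / (2 * m)) W (spectralPair ħ m β W).1 g (spectralPair ħ m β W).2 :=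
  isSpectralResolution_iff.1 (spectralPair_spec h).1

theorem partition_pos (h : HasThermalState ħ m β W) :
    0 < ∑' l, Real.exp (-β * (spectralPair ħ m β W).2 l) :=
  (spectralPair_spec h).2.tsum_pos (fun _ => (Real.exp_pos _).le) 0 (Real.exp_pos _)

theorem thermalWeight_pos (h : HasThermalState ħ m β W) (k : ℕ) : 0 < thermalWeight ħ m β W k :=
  div_pos (Real.exp_pos _) (partition_pos h)

theorem hasSum_thermalWeight (h : HasThermalState ħ m β W) :
    HasSum (thermalWeight ħ m β W) 1 := by
  have := (spectralPair_spec h).2.hasSum.div_const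
    (∑' l, Real.exp (-β * (spectralPair ħ m β W).2 l))
  rwa [div_self (partition_pos h).ne'] at this

theorem measurable_enorm_sq (ψ : L2 N) : Measurable fun x => ‖ψ x‖ₑ ^ 2 :=
  (Lp.stronglyMeasurable ψ).measurable.enorm.pow_const 2

/-- An observable that is integrable in the position law of a thermal state has a finite mean in
every eigenvector, and its thermal mean is the weighted mean. -/
theorem hasSum_integral_positionLaw (h : HasThermalState ħ m β W) {U : Conf N → ℝ}
    (hU : Integrable U (positionLaw ħ m β W)) :
    (∀ k, FinitePotential U ((spectralPair ħ m β W).1 k)) ∧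
    HasSum (fun k => thermalWeight ħ m β W k * ∫ x, U x * ‖(spectralPair ħ m β W).1 k x‖ ^ 2)
      (∫ x, U x ∂(positionLaw ħ m β W)) := by
  constructor
  · intro k
    have h1 := hU.mono_measure (Measure.le_sum _ k)
    rw [integrable_smul_measure (by simpa using thermalWeight_pos h k) ENNReal.ofReal_ne_top,
      integrable_withDensity_iff (measurable_enorm_sq _) (ae_of_all _ fun x => by simp)] at h1
    simpa [FinitePotential] using h1
  · have h1 := hasSum_integral_measure hU
    have h2 : ∀ k, ∫ x, U x ∂(ENNReal.ofReal (thermalWeight ħ m β W k) •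
        (volume : Measure (Conf N)).withDensity fun x => ‖(spectralPair ħ m β W).1 k x‖ₑ ^ 2) =
        thermalWeight ħ m β W k * ∫ x, U x * ‖(spectralPair ħ m β W).1 k x‖ ^ 2 := by
      intro k
      rw [integral_smul_measure, ENNReal.toReal_ofReal (thermalWeight_pos h k).le, smul_eq_mul,
        integral_withDensity_eq_integral_toReal_smul (measurable_enorm_sq _)
          (ae_of_all _ fun x => by simp)]
      congr 1
      refine integral_congr_ae (ae_of_all _ fun x => ?_)
      simp [mul_comm]
    simp only [h2] at h1
    exact h1

/-- The thermal state exists for a potential above an oscillator, if the form is densely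
defined. -/
theorem hasThermalState_of_le (hN : 0 < N) (hc : 0 < ħ ^ 2 / (2 * m)) (hβ : 0 < β) {κ C : ℝ}
    (hκ : κ ≠ 0) (hW : AEMeasurable W) (hWC : ∀ᵐ x, osc (ħ ^ 2 / (2 * m)) κ N x ≤ W x + C)
    (hd : ∀ χ : L2 N, IsBosonic χ → (∀ φ h, IsBosonic φ → HasWeakGrad φ h → FinitePotential W φ →
      ⟪φ, χ⟫_ℂ = 0) → χ = 0) : HasThermalState ħ m β W := by
  obtain ⟨f, g, E, h1, h2, h3⟩ := exists_form_eigenbasis hN hc hκ hW hWC hd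
  have B : IsEigenbasis (ħ ^ 2 / (2 * m)) W f g E := ⟨h1, h2, h3⟩
  refine ⟨(f, E), isSpectralResolution_iff.2 ⟨g, B⟩, ?_⟩
  have h4 := TrappedBose.tsum_exp_energy_le hc hκ hβ h1 (fun k => (h3 k).mem)
    (fun k => (h3 k).grad) (fun k => finitePotential_osc_of_le hc.le hWC (h3 k).finite)
  have h5 := ENNReal.summable_toReal (ne_top_of_le_ne_top ENNReal.ofReal_ne_top h4)
  refine Summable.of_nonneg_of_le (fun k => (Real.exp_pos _).le) (fun k => ?_)
    (h5.mul_left (Real.exp (β * (C - ħ ^ 2 / (2 * m) * κ ^ 2 * N / 2))))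
  rw [ENNReal.toReal_ofReal (Real.exp_pos _).le, ← Real.exp_add]
  refine Real.exp_le_exp.2 ?_
  have h6 := energy_osc_le hc.le hWC (h3 k).finite (g k)
  rw [B.energy_eq, B.norm_eq, one_pow, mul_one] at h6
  nlinarith

/-- The thermal state of the ideal gas exists. -/
theorem hasThermalState_osc (hN : 0 < N) (hc : 0 < ħ ^ 2 / (2 * m)) (hβ : 0 < β) {κ : ℝ}
    (hκ : κ ≠ 0) : HasThermalState ħ m β (osc (ħ ^ 2 / (2 * m)) κ N) := by
  refine hasThermalState_of_le hN hc hβ (C := 0) hκ (continuous_osc _ _).aemeasurable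
    (ae_of_all _ fun x => by rw [add_zero]) fun χ hχ h => ?_
  refine eq_zero_of_inner_hermL2 hκ fun a => ?_
  have h1 := inner_symVec hκ hχ a
  have hw : HasWeakGrad (symVec κ a) (∑ b ∈ orbit a, hermGrad κ b) :=
    hasWeakGrad_sum _ fun b _ => hasWeakGrad_hermL2 hκ b
  have hf : FinitePotential (osc (ħ ^ 2 / (2 * m)) κ N) (symVec κ a) :=
    finitePotential_sum (C := 0) (continuous_osc _ _).aemeasurable
      (ae_of_all _ fun x => by simpa using osc_nonneg hc.le κ x) _
      fun b _ => finitePotential_osc_gL2 hκ _ _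
  rw [h _ _ (isBosonic_symVec hκ a) hw hf] at h1
  refine (mul_eq_zero.1 h1.symm).resolve_left ?_
  exact_mod_cast (Finset.card_pos.2 ⟨a, self_mem_orbit a⟩).ne'

/-- The thermal state exists for an interaction that is bounded from below and has a finite mean in
the thermal state of the ideal gas. -/
theorem hasThermalState_osc_add (hN : 0 < N) (hc : 0 < ħ ^ 2 / (2 * m)) (hβ : 0 < β) {κ L : ℝ}
    (hκ : κ ≠ 0) {U : Conf N → ℝ} (hU : AEMeasurable U) (hUL : ∀ᵐ x, -L ≤ U x)
    (hint : Integrable U (positionLaw ħ m β (osc (ħ ^ 2 / (2 * m)) κ N))) :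
    HasThermalState ħ m β fun x => osc (ħ ^ 2 / (2 * m)) κ N x + U x := by
  have h0 := hasThermalState_osc (N := N) (β := β) hN hc hβ hκ
  obtain ⟨g, B⟩ := exists_isEigenbasis h0
  refine hasThermalState_of_le hN hc hβ (C := L) hκ ((continuous_osc _ _).aemeasurable.add hU)
    ?_ fun χ hχ h => B.complete χ hχ fun k => ?_
  · filter_upwards [hUL] with x hx
    linarith
  · -- the eigenvectors of the ideal gas are in the form domain
    refine h _ (g k) (B.eigen k).mem (B.eigen k).grad ?_
    refine (Integrable.add (B.eigen k).finite ((hasSum_integral_positionLaw h0 hint).1 k)).congr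
      (ae_of_all _ fun x => ?_)
    simp [add_mul]

/-- The Gibbs variational principle: the interaction lowers the partition function at most by the
factor that belongs to its mean in the ideal gas. -/
theorem partition_lower_bound (hN : 0 < N) (hc : 0 < ħ ^ 2 / (2 * m)) (hβ : 0 < β) {κ L : ℝ}
    (hκ : κ ≠ 0) {U : Conf N → ℝ} (hU : AEMeasurable U) (hUL : ∀ᵐ x, -L ≤ U x)
    (hint : Integrable U (positionLaw ħ m β (osc (ħ ^ 2 / (2 * m)) κ N))) :
    Real.exp (-β * (ħ ^ 2 / (2 * m) * κ ^ 2 * N / 2 +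
        ∫ x, U x ∂(positionLaw ħ m β (osc (ħ ^ 2 / (2 * m)) κ N)))) ≤
      ∑' k, Real.exp (-β * (spectralPair ħ m β
        fun x => osc (ħ ^ 2 / (2 * m)) κ N x + U x).2 k) := by
  set c := ħ ^ 2 / (2 * m) with hcdef
  set W0 := osc c κ N with hW0
  set W : Conf N → ℝ := fun x => W0 x + U x with hWdef
  have h0 : HasThermalState ħ m β W0 := hasThermalState_osc hN hc hβ hκ
  have hT : HasThermalState ħ m β W := hasThermalState_osc_add hN hc hβ hκ hU hUL hint
  obtain ⟨g0, B0⟩ : ∃ g, IsEigenbasis c W0 _ g _ := exists_isEigenbasis h0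
  obtain ⟨g, B⟩ : ∃ g, IsEigenbasis c W _ g _ := exists_isEigenbasis hT
  have hW0m : AEMeasurable W0 := (continuous_osc _ _).aemeasurable
  have hW0n : ∀ x, 0 ≤ W0 x := osc_nonneg hc.le κ
  obtain ⟨hfin, hsum⟩ := hasSum_integral_positionLaw h0 hint
  set f0 := (spectralPair ħ m β W0).1
  set E0 := (spectralPair ħ m β W0).2
  set u : ℕ → ℝ := fun k => ∫ x, U x * ‖f0 k x‖ ^ 2 with hu
  have hs0 : Summable fun k => Real.exp (-β * E0 k) := (spectralPair_spec h0).2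
  have hs : Summable fun k => Real.exp (-β * (spectralPair ħ m β W).2 k) :=
    (spectralPair_spec hT).2
  -- Peierls' inequality with the eigenvectors of the ideal gas
  have hfW : ∀ k, FinitePotential W (f0 k) := fun k => by
    refine (Integrable.add (B0.eigen k).finite (hfin k)).congr (ae_of_all _ fun x => ?_)
    simp [hWdef, add_mul]
  have hen : ∀ k, energy c W (f0 k) (g0 k) = E0 k + u k := by
    intro k
    rw [← B0.energy_eq k, energy, energy, add_assoc, hu,
      ← integral_add (B0.eigen k).finite (hfin k)]
    congr 1
    refine integral_congr_ae (ae_of_all _ fun x => ?_)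
    simp [hWdef, add_mul]
  have hP := B.tsum_exp_energy_le (C := L) hc.le (hW0m.add hU) (by
    filter_upwards [hUL] with x hx
    have := hW0n x
    simp only [hWdef]
    linarith) hβ.le B0.orthonormal (fun k => (B0.eigen k).mem) (fun k => (B0.eigen k).grad) hfW
  simp only [hen] at hP
  rw [← ENNReal.ofReal_tsum_of_nonneg (fun k => (Real.exp_pos _).le) hs] at hP
  have hs1 : Summable fun k => Real.exp (-β * (E0 k + u k)) := by
    have := ENNReal.summable_toReal (ne_top_of_le_ne_top ENNReal.ofReal_ne_top hP)
    simpa only [ENNReal.toReal_ofReal (Real.exp_pos _).le] using this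
  rw [← ENNReal.ofReal_tsum_of_nonneg (fun k => (Real.exp_pos _).le) hs1,
    ENNReal.ofReal_le_ofReal_iff (tsum_nonneg fun k => (Real.exp_pos _).le)] at hP
  refine le_trans ?_ hP
  -- Jensen's inequality in the thermal state of the ideal gas
  set Z0 := ∑' l, Real.exp (-β * E0 l) with hZ0
  have hZ0pos : 0 < Z0 := partition_pos h0
  have hw : ∀ k, thermalWeight ħ m β W0 k = Real.exp (-β * E0 k) / Z0 := fun k => rfl
  have hexp : ∀ k, thermalWeight ħ m β W0 k * Real.exp (-β * u k) =
      Real.exp (-β * (E0 k + u k)) / Z0 := by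
    intro k
    rw [hw, div_mul_eq_mul_div, ← Real.exp_add]
    congr 2
    ring
  have hJ := exp_tsum_le (y := fun k => -β * u k) (fun k => (thermalWeight_pos h0 k).le)
    (hasSum_thermalWeight h0)
    ((hsum.summable.mul_left (-β)).congr fun k => by ring)
    ((hs1.div_const Z0).congr fun k => (hexp k).symm)
  have hJ1 : ∑' k, thermalWeight ħ m β W0 k * (-β * u k) =
      -β * ∫ x, U x ∂(positionLaw ħ m β W0) := by
    rw [← hsum.tsum_eq, ← tsum_mul_left]
    exact tsum_congr fun k => by ring
  rw [hJ1, tsum_congr hexp, tsum_div_const, le_div_iff₀ hZ0pos] at hJ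
  refine le_trans ?_ hJ
  -- the ground state of the ideal gas
  have hground : Real.exp (-β * (c * κ ^ 2 * N / 2)) ≤ Z0 := by
    have h1 := B0.tsum_exp_energy_le (C := 0) (A := Unit) hc.le hW0m
      (ae_of_all _ fun x => by simpa using hW0n x) hβ.le (φ := fun _ => hermL2 κ fun _ => 0)
      (h := fun _ => hermGrad κ fun _ => 0)
      ((orthonormal_hermL2 hκ).comp (fun _ : Unit => fun _ => 0) fun _ _ _ => rfl)
      (fun _ => by
        rw [isBosonic_iff]
        intro σ
        rw [permL2_hermL2 hκ]
        rfl)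
      (fun _ => hasWeakGrad_hermL2 hκ _) (fun _ => finitePotential_osc_gL2 hκ c _)
    rw [← ENNReal.ofReal_tsum_of_nonneg (fun k => (Real.exp_pos _).le) hs0, tsum_fintype,
      Finset.univ_unique, Finset.sum_singleton,
      ENNReal.ofReal_le_ofReal_iff (tsum_nonneg fun k => (Real.exp_pos _).le),
      (isFormEigen_hermL2 hκ _).energy_eq, level_eq, (orthonormal_hermL2 hκ).1] at h1
    simpa [hZ0] using h1
  rw [mul_add, add_comm, Real.exp_add]
  exact mul_le_mul_of_nonneg_left hground (Real.exp_pos _).le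

/-- The mean excitation energy of the trapped particles in the thermal state, in terms of the lower
bound of the interaction and of its mean in the ideal gas. -/
theorem mean_excitation_le (hN : 0 < N) (hc : 0 < ħ ^ 2 / (2 * m)) (hβ : 0 < β) {κ L : ℝ}
    (hκ : κ ≠ 0) {U : Conf N → ℝ} (hU : AEMeasurable U) (hUL : ∀ᵐ x, -L ≤ U x)
    (hint : Integrable U (positionLaw ħ m β (osc (ħ ^ 2 / (2 * m)) κ N)))
    {W : Conf N → ℝ} (hW : W = fun x => osc (ħ ^ 2 / (2 * m)) κ N x + U x)
    {g : ℕ → Fin N → L2 N} (hg : IsEigenbasis (ħ ^ 2 / (2 * m)) W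
      (spectralPair ħ m β W).1 g (spectralPair ħ m β W).2) {e : ℕ → ℝ}
    (he : ∀ k, e k = energy (ħ ^ 2 / (2 * m)) (osc (ħ ^ 2 / (2 * m)) κ N)
      ((spectralPair ħ m β W).1 k) (g k) - ħ ^ 2 / (2 * m) * κ ^ 2 * N / 2) :
    (∀ k, FinitePotential (osc (ħ ^ 2 / (2 * m)) κ N) ((spectralPair ħ m β W).1 k)) ∧
    (∀ k, 0 ≤ e k) ∧ (Summable fun k => thermalWeight ħ m β W k * e k) ∧
    ∑' k, thermalWeight ħ m β W k * e k ≤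
      2 / β * ((1 + Real.log N) / (β / 2 * (ħ ^ 2 / (2 * m) * κ ^ 2)) + β * L +
        β * ∫ x, U x ∂(positionLaw ħ m β (osc (ħ ^ 2 / (2 * m)) κ N))) := by
  have hT : HasThermalState ħ m β W := hW ▸ hasThermalState_osc_add hN hc hβ hκ hU hUL hint
  have hZ := partition_lower_bound hN hc hβ hκ hU hUL hint
  rw [← hW] at hZ
  set c := ħ ^ 2 / (2 * m) with hcdef
  set m0 := ∫ x, U x ∂(positionLaw ħ m β (osc c κ N)) with hm0
  set e0 := c * κ ^ 2 * N / 2 with he0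
  set A := (1 + Real.log N) / (β / 2 * (c * κ ^ 2)) with hA
  set f := (spectralPair ħ m β W).1 with hf
  set E := (spectralPair ħ m β W).2 with hE
  set Z := ∑' k, Real.exp (-β * E k) with hZdef
  have hZpos : 0 < Z := partition_pos hT
  have hw : ∀ k, thermalWeight ħ m β W k = Real.exp (-β * E k) / Z := fun k => rfl
  have hWL : ∀ᵐ x, osc c κ N x ≤ W x + L := by
    filter_upwards [hUL] with x hx
    rw [hW]
    linarith
  have hfin : ∀ k, FinitePotential (osc c κ N) (f k) := fun k =>
    finitePotential_osc_of_le hc.le hWL (hg.eigen k).finite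
  have hpos : ∀ k, 0 ≤ e k := fun k => by
    have := le_energy_osc hc hκ (hg.eigen k).grad (hfin k)
    rw [hg.norm_eq, one_pow, mul_one] at this
    rw [he]
    linarith
  have hEe : ∀ k, e k + e0 - L ≤ E k := fun k => by
    have := energy_osc_le hc.le hWL (hg.eigen k).finite (g k)
    rw [hg.energy_eq, hg.norm_eq, one_pow, mul_one] at this
    rw [he]
    linarith
  -- half of the Boltzmann factor is enough for the convergence of the trace
  have h1 := TrappedBose.tsum_exp_energy_le hc hκ (half_pos hβ) hg.orthonormal
    (fun k => (hg.eigen k).mem) (fun k => (hg.eigen k).grad) hfin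
  simp only [← he, ← he0] at h1
  have hs1 : Summable fun k => Real.exp (-(β / 2) * e k) := by
    have := ENNReal.summable_toReal (ne_top_of_le_ne_top ENNReal.ofReal_ne_top h1)
    simpa only [ENNReal.toReal_ofReal (Real.exp_pos _).le] using this
  rw [← ENNReal.ofReal_tsum_of_nonneg (fun k => (Real.exp_pos _).le) hs1,
    ENNReal.ofReal_le_ofReal_iff (Real.exp_pos _).le] at h1
  have hle : ∀ k, thermalWeight ħ m β W k * Real.exp (β / 2 * e k) ≤
      Real.exp (β * (L - e0)) / Z * Real.exp (-(β / 2) * e k) := by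
    intro k
    rw [hw, div_mul_eq_mul_div (Real.exp _), ← Real.exp_add, div_mul_eq_mul_div (Real.exp _),
      ← Real.exp_add]
    refine div_le_div_of_nonneg_right (Real.exp_le_exp.2 ?_) hZpos.le
    nlinarith [hEe k]
  have hs2 : Summable fun k => thermalWeight ħ m β W k * Real.exp (β / 2 * e k) :=
    Summable.of_nonneg_of_le (fun k => mul_nonneg (thermalWeight_pos hT k).le (Real.exp_pos _).le)
      hle (hs1.mul_left _)
  have hs3 : Summable fun k => thermalWeight ħ m β W k * (β / 2 * e k) :=
    Summable.of_nonneg_of_le (fun k => mul_nonneg (thermalWeight_pos hT k).le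
      (mul_nonneg (half_pos hβ).le (hpos k))) (fun k => mul_le_mul_of_nonneg_left
        (by linarith [Real.add_one_le_exp (β / 2 * e k)]) (thermalWeight_pos hT k).le) hs2
  have hs4 : ∀ k, 2 / β * (thermalWeight ħ m β W k * (β / 2 * e k)) =
      thermalWeight ħ m β W k * e k := fun k => by field_simp
  refine ⟨hfin, hpos, (hs3.mul_left (2 / β)).congr hs4, ?_⟩
  rw [← tsum_congr hs4, tsum_mul_left]
  refine mul_le_mul_of_nonneg_left ?_ (by positivity)
  have hJ := exp_tsum_le (fun k => (thermalWeight_pos hT k).le) (hasSum_thermalWeight hT) hs3 hs2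
  have h2 : ∑' k, thermalWeight ħ m β W k * Real.exp (β / 2 * e k) ≤
      Real.exp (β * (L - e0)) / Z * Real.exp A := by
    refine (hs2.tsum_le_tsum hle (hs1.mul_left _)).trans ?_
    rw [tsum_mul_left]
    exact mul_le_mul_of_nonneg_left h1 (by positivity)
  have h3 : Real.exp (β * (L - e0)) / Z * Real.exp A ≤ Real.exp (A + β * L + β * m0) := by
    rw [div_mul_eq_mul_div, div_le_iff₀ hZpos, ← Real.exp_add]
    refine le_trans (le_of_eq ?_) (mul_le_mul_of_nonneg_left hZ (Real.exp_pos _).le)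
    rw [← Real.exp_add]
    congr 1
    ring
  exact Real.exp_le_exp.1 (hJ.trans (h2.trans h3))

end Thermal

/-! ### Exchanging a coordinate with an auxiliary variable -/

/-- The exchange of the `i`-th coordinate with an auxiliary real variable. It turns an integration
along the fibers `x i ↦ y` into an integration over a product space. -/
def exch (i : Fin N) (z : Conf N × ℝ) : Conf N × ℝ := (Function.update z.1 i z.2, z.1 i)

theorem exch_exch (i : Fin N) (z : Conf N × ℝ) : exch i (exch i z) = z := by
  simp [exch]

theorem measurePreserving_exch (i : Fin N) : MeasurePreserving (exch i) := by
  have e := volume_preserving_piFinSuccAbove (fun _ : Fin (N + 1) => ℝ) 0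
  have h := Measure.measurePreserving_swap.comp (e.comp
    ((measurePreserving_comp_perm (Equiv.swap 0 i.succ)).comp
      (e.symm.comp (Measure.measurePreserving_swap (μ := (volume : Measure (Conf N)))
        (ν := (volume : Measure ℝ))))))
  convert h using 1
  ext z j
  · simp only [exch, Function.comp_apply, MeasurableEquiv.piFinSuccAbove_apply, Prod.swap,
      MeasurableEquiv.piFinSuccAbove_symm_apply, Fin.insertNthEquiv_zero,
      Fin.consEquiv_symm_apply, Fin.consEquiv_apply, Fin.tail]
    by_cases hj : j = i
    · subst hj
      simp
    · rw [Function.update_of_ne hj, Equiv.swap_apply_of_ne_of_ne (Fin.succ_ne_zero j)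
        (fun h => hj (Fin.succ_injective _ h))]
      simp
  · simp [exch, MeasurableEquiv.piFinSuccAbove]
  · rfl
  · rfl

theorem measurableEmbedding_exch (i : Fin N) : MeasurableEmbedding (exch i) :=
  (MeasurableEquiv.mk ⟨exch i, exch i, exch_exch i, exch_exch i⟩
    (measurePreserving_exch i).measurable (measurePreserving_exch i).measurable).measurableEmbedding

theorem integral_exch {G : Type*} [NormedAddCommGroup G] [NormedSpace ℝ G] (i : Fin N)
    (F : Conf N × ℝ → G) : ∫ z, F (exch i z) = ∫ z, F z :=
  (measurePreserving_exch i).integral_comp (measurableEmbedding_exch i) F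

theorem integrable_exch {G : Type*} [NormedAddCommGroup G] (i : Fin N)
    {F : Conf N × ℝ → G} : Integrable (fun z => F (exch i z)) ↔ Integrable F :=
  (measurePreserving_exch i).integrable_comp_emb (measurableEmbedding_exch i)

theorem sq_integral_norm_mul_norm_le {α : Type*} [MeasurableSpace α] {μ : Measure α} {f g : α → ℂ}
    (hf : MemLp f 2 μ) (hg : MemLp g 2 μ) :
    (∫ x, ‖f x‖ * ‖g x‖ ∂μ) ^ 2 ≤ (∫ x, ‖f x‖ ^ 2 ∂μ) * ∫ x, ‖g x‖ ^ 2 ∂μ := by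
  have h := integral_mul_norm_le_Lp_mul_Lq (μ := μ) (f := f) (g := g) Real.HolderConjugate.two_two
    (by simpa using hf) (by simpa using hg)
  simp only [Real.rpow_two, ← Real.sqrt_eq_rpow] at h
  have h0 : 0 ≤ ∫ x, ‖f x‖ * ‖g x‖ ∂μ := integral_nonneg fun x => by positivity
  have h1 : 0 ≤ ∫ x, ‖f x‖ ^ 2 ∂μ := integral_nonneg fun x => by positivity
  have h2 : 0 ≤ ∫ x, ‖g x‖ ^ 2 ∂μ := integral_nonneg fun x => by positivity
  calc _ ≤ (Real.sqrt (∫ x, ‖f x‖ ^ 2 ∂μ) * Real.sqrt (∫ x, ‖g x‖ ^ 2 ∂μ)) ^ 2 :=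
        pow_le_pow_left₀ h0 h 2
    _ = _ := by rw [mul_pow, Real.sq_sqrt h1, Real.sq_sqrt h2]

/-! ### The occupation of a Hermite mode -/

/-- The projection `1 ⊗ ⋯ ⊗ |q⟩⟨q| ⊗ ⋯ ⊗ 1` in the `i`-th factor, applied to `ψ`, where `q` is the
real function `gpoly κ p`. -/
def modeProj (κ : ℝ) (p : Polynomial ℝ) (i : Fin N) (ψ : L2 N) (x : Conf N) : ℂ :=
  gpoly κ p (x i) * ∫ y : ℝ, gpoly κ p y * ψ (Function.update x i y)

theorem measurable_comp_update (ψ : L2 N) (i : Fin N) :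
    Measurable fun z : Conf N × ℝ => ψ (Function.update z.1 i z.2) :=
  (Lp.stronglyMeasurable ψ).measurable.comp
    (measurable_fst.comp (measurePreserving_exch i).measurable)

theorem measurable_gpoly (κ : ℝ) (p : Polynomial ℝ) : Measurable (gpoly κ p) :=
  (contDiff_gpoly κ p (n := 0)).continuous.measurable

theorem integrable_sq_norm_L2 (ψ : L2 N) : Integrable fun x => ‖ψ x‖ ^ 2 :=
  (memLp_two_iff_integrable_sq_norm (Lp.aestronglyMeasurable ψ)).1 (Lp.memLp ψ)

theorem memLp_gpoly_mul_comp_update {κ : ℝ} (hκ : κ ≠ 0) (p : Polynomial ℝ) (i : Fin N)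
    (ψ : L2 N) : MemLp (fun z : Conf N × ℝ =>
      (gpoly κ p (z.1 i) : ℂ) * ψ (Function.update z.1 i z.2)) 2 := by
  have hm : Measurable fun z : Conf N × ℝ =>
      (gpoly κ p (z.1 i) : ℂ) * ψ (Function.update z.1 i z.2) :=
    (Complex.measurable_ofReal.comp ((measurable_gpoly κ p).comp
      ((measurable_pi_apply i).comp measurable_fst))).mul (measurable_comp_update ψ i)
  rw [memLp_two_iff_integrable_sq_norm hm.aestronglyMeasurable]
  have h1 : Integrable (fun z : Conf N × ℝ => ‖ψ z.1‖ ^ 2 * (gpoly κ p z.2 * gpoly κ p z.2)) :=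
    (integrable_sq_norm_L2 ψ).mul_prod (integrable_gpoly_mul hκ p p)
  refine ((integrable_exch i).2 h1).congr (ae_of_all _ fun z => ?_)
  simp only [exch, norm_mul, Complex.norm_real, mul_pow, Real.norm_eq_abs, sq_abs]
  ring

theorem memLp_modeProj {κ : ℝ} (hκ : κ ≠ 0) (p : Polynomial ℝ) (i : Fin N) (ψ : L2 N) :
    MemLp (modeProj κ p i ψ) 2 := by
  have hM := memLp_gpoly_mul_comp_update hκ p i ψ
  have hG := (memLp_two_iff_integrable_sq_norm hM.1).1 hM
  have hq : MemLp (fun y => (gpoly κ p y : ℂ)) 2 := by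
    have hm : Measurable fun y => (gpoly κ p y : ℂ) :=
      Complex.measurable_ofReal.comp (measurable_gpoly κ p)
    rw [memLp_two_iff_integrable_sq_norm hm.aestronglyMeasurable]
    refine (integrable_gpoly_mul hκ p p).congr (ae_of_all _ fun y => ?_)
    simp [sq]
  have e : ∀ x, modeProj κ p i ψ x =
      ∫ y, (gpoly κ p y : ℂ) * ((gpoly κ p (x i) : ℂ) * ψ (Function.update x i y)) := by
    intro x
    rw [modeProj, ← integral_const_mul]
    exact integral_congr_ae (ae_of_all _ fun y => by ring)
  have hm : AEStronglyMeasurable (modeProj κ p i ψ) := by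
    have h1 : AEStronglyMeasurable (fun z : Conf N × ℝ => (gpoly κ p z.2 : ℂ) *
        ((gpoly κ p (z.1 i) : ℂ) * ψ (Function.update z.1 i z.2)))
        ((volume : Measure (Conf N)).prod (volume : Measure ℝ)) :=
      (Complex.measurable_ofReal.comp
        ((measurable_gpoly κ p).comp measurable_snd)).aestronglyMeasurable.mul hM.1
    exact h1.integral_prod_right'.congr (ae_of_all _ fun x => (e x).symm)
  rw [memLp_two_iff_integrable_sq_norm hm]
  have hG' : Integrable _ ((volume : Measure (Conf N)).prod (volume : Measure ℝ)) := hG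
  refine (hG'.integral_prod_left.const_mul (∫ y, ‖(gpoly κ p y : ℂ)‖ ^ 2)).mono' (hm.norm.pow 2) ?_
  filter_upwards [hG'.prod_right_ae] with x hx
  rw [Real.norm_of_nonneg (sq_nonneg _), e]
  have hx2 : MemLp (fun y => (gpoly κ p (x i) : ℂ) * ψ (Function.update x i y)) 2 := by
    refine (memLp_two_iff_integrable_sq_norm ?_).2 hx
    exact (((measurable_comp_update ψ i).comp measurable_prodMk_left).const_mul
      _).aestronglyMeasurable
  refine le_trans (pow_le_pow_left₀ (norm_nonneg _) (norm_integral_le_integral_norm _) 2) ?_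
  simp only [norm_mul (gpoly κ p _ : ℂ) ((gpoly κ p (x i) : ℂ) * _)]
  exact sq_integral_norm_mul_norm_le hq hx2

/-- The projection onto a mode is diagonal in the Hermite basis. -/
theorem inner_hermL2_modeProj {κ : ℝ} (hκ : κ ≠ 0) (j : ℕ) (i : Fin N) (ψ : L2 N)
    (a : Fin N → ℕ) : ⟪hermL2 κ a, (memLp_modeProj hκ (hermN κ j) i ψ).toLp _⟫_ℂ =
      if a i = j then ⟪hermL2 κ a, ψ⟫_ℂ else 0 := by
  set p := hermN κ j with hp
  set P : Fin N → Polynomial ℝ := fun k => hermN κ (a k) with hP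
  have hM := memLp_gpoly_mul_comp_update hκ p i ψ
  have hK : MemLp (fun z : Conf N × ℝ => ((gprod κ P z.1 * gpoly κ p z.2 : ℝ) : ℂ)) 2 := by
    have hm : Measurable fun z : Conf N × ℝ => ((gprod κ P z.1 * gpoly κ p z.2 : ℝ) : ℂ) :=
      Complex.measurable_ofReal.comp
        (((contDiff_gprod κ P (n := 0)).continuous.measurable.comp measurable_fst).mul
          ((measurable_gpoly κ p).comp measurable_snd))
    rw [memLp_two_iff_integrable_sq_norm hm.aestronglyMeasurable]
    have h1 : Integrable (fun z : Conf N × ℝ =>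
        (gprod κ P z.1 * gprod κ P z.1) * (gpoly κ p z.2 * gpoly κ p z.2)) :=
      (integrable_gprod_mul hκ P P).mul_prod (integrable_gpoly_mul hκ p p)
    refine h1.congr (ae_of_all _ fun z => ?_)
    simp only [Complex.norm_real, Real.norm_eq_abs, sq_abs]
    ring
  have hint := hK.integrable_mul hM
  have h1 : ⟪hermL2 κ a, (memLp_modeProj hκ p i ψ).toLp _⟫_ℂ =
      ∫ x, ∫ y, ((gprod κ P x * gpoly κ p y : ℝ) : ℂ) *
        ((gpoly κ p (x i) : ℂ) * ψ (Function.update x i y)) := by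
    rw [hermL2, inner_gL2_left hκ]
    refine integral_congr_ae ?_
    filter_upwards [(memLp_modeProj hκ p i ψ).coeFn_toLp] with x hx
    rw [hx, modeProj, ← integral_const_mul, ← integral_const_mul]
    refine integral_congr_ae (ae_of_all _ fun y => ?_)
    push_cast
    ring
  have h2 := integral_prod (μ := (volume : Measure (Conf N))) (ν := (volume : Measure ℝ)) _ hint
  have h3 := (integrable_exch i).2 hint
  have h4 := integral_prod (μ := (volume : Measure (Conf N))) (ν := (volume : Measure ℝ)) _ h3
  have h5 := integral_exch i (fun z : Conf N × ℝ => ((gprod κ P z.1 * gpoly κ p z.2 : ℝ) : ℂ) *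
    ((gpoly κ p (z.1 i) : ℂ) * ψ (Function.update z.1 i z.2)))
  rw [h1]
  refine h2.symm.trans (h5.symm.trans (h4.trans ?_))
  have h6 : ∀ x : Conf N, ∫ y, ((gprod κ P (Function.update x i y) * gpoly κ p (x i) : ℝ) : ℂ) *
      ((gpoly κ p y : ℂ) * ψ x) = (if a i = j then (gprod κ P x : ℂ) else 0) * ψ x := by
    intro x
    have h7 : ∀ y, ((gprod κ P (Function.update x i y) * gpoly κ p (x i) : ℝ) : ℂ) *
        ((gpoly κ p y : ℂ) * ψ x) = ((gpoly κ (P i) y * gpoly κ p y : ℝ) : ℂ) *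
        ((gpoly κ p (x i) * ∏ k ∈ Finset.univ.erase i, gpoly κ (P k) (x k) : ℝ) * ψ x) := by
      intro y
      have h8 : ∏ k ∈ Finset.univ.erase i, gpoly κ (P k) (Function.update x i y k) =
          ∏ k ∈ Finset.univ.erase i, gpoly κ (P k) (x k) :=
        Finset.prod_congr rfl fun k hk => by rw [Function.update_of_ne (Finset.ne_of_mem_erase hk)]
      rw [gprod_eq_mul_erase κ P i, Function.update_self, h8]
      push_cast
      ring
    rw [integral_congr_ae (ae_of_all _ h7), integral_mul_const, integral_complex_ofReal]
    have h9 : ∫ y, gpoly κ (P i) y * gpoly κ p y = if a i = j then 1 else 0 :=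
      ginner_hermN hκ (a i) j
    rw [h9]
    split_ifs with hij
    · have hpi : p = P i := by simp only [hp, hP, hij]
      rw [hpi, ← gprod_eq_mul_erase κ P i]
      simp
    · simp
  have h7 : ∫ x, (if a i = j then (gprod κ P x : ℂ) else 0) * ψ x =
      if a i = j then ⟪hermL2 κ a, ψ⟫_ℂ else 0 := by
    split_ifs
    · rw [hermL2, inner_gL2_left hκ]
    · simp
  rw [← h7]
  refine integral_congr_ae (ae_of_all _ fun x => ?_)
  refine Eq.trans (integral_congr_ae (ae_of_all _ fun y => ?_)) (h6 x)
  simp [exch]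

theorem hasSum_inner_modeProj {κ : ℝ} (hκ : κ ≠ 0) (j : ℕ) (i : Fin N) (ψ : L2 N) :
    HasSum (fun a : Fin N → ℕ => if a i = j then ‖⟪hermL2 κ a, ψ⟫_ℂ‖ ^ 2 else 0)
      (∫ x, starRingEnd ℂ (ψ x) * modeProj κ (hermN κ j) i ψ x).re := by
  have h1 := (hermHilbert hκ).hasSum_inner_mul_inner ψ
    ((memLp_modeProj hκ (hermN κ j) i ψ).toLp _)
  have h2 : ⟪ψ, (memLp_modeProj hκ (hermN κ j) i ψ).toLp _⟫_ℂ =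
      ∫ x, starRingEnd ℂ (ψ x) * modeProj κ (hermN κ j) i ψ x := by
    rw [L2.inner_def]
    refine integral_congr_ae ?_
    filter_upwards [(memLp_modeProj hκ (hermN κ j) i ψ).coeFn_toLp] with x hx
    rw [hx, RCLike.inner_apply, mul_comm]
  rw [h2] at h1
  have h3 := Complex.hasSum_re h1
  have h4 : ∀ a : Fin N → ℕ, (⟪ψ, hermHilbert hκ a⟫_ℂ *
      ⟪hermHilbert hκ a, (memLp_modeProj hκ (hermN κ j) i ψ).toLp _⟫_ℂ).re =
      if a i = j then ‖⟪hermL2 κ a, ψ⟫_ℂ‖ ^ 2 else 0 := by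
    intro a
    rw [hermHilbert_apply, inner_hermL2_modeProj hκ]
    split_ifs
    · rw [← inner_conj_symm, Complex.conj_mul', ← Complex.ofReal_pow, Complex.ofReal_re]
    · simp
  simpa only [h4] using h3

theorem quasiMeasurePreserving_coord (i : Fin N) :
    Measure.QuasiMeasurePreserving (fun x : Conf N => (fun _ => x i : Conf 1)) :=
  (volume_preserving_funUnique (Fin 1) ℝ).symm.quasiMeasurePreserving.comp
    (Measure.quasiMeasurePreserving_eval (fun _ : Fin N => (volume : Measure ℝ)) i)

theorem coeFn_smul_hermL2_one {κ : ℝ} (hκ : κ ≠ 0) (t : ℂ) (j : ℕ) :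
    ∀ᵐ y : Conf 1, (t • hermL2 κ fun _ => j) y = t * gpoly κ (hermN κ j) (y 0) := by
  filter_upwards [Lp.coeFn_smul t (hermL2 κ fun _ : Fin 1 => j),
    coeFn_gL2 hκ fun _ : Fin 1 => hermN κ j] with y h1 h2
  rw [h1, Pi.smul_apply, hermL2, h2]
  simp [gprod]

/-- The occupation of the mode `j` is the mean number of the quantum numbers equal to `j`. -/
theorem hasSum_occupation {κ : ℝ} (hκ : κ ≠ 0) {t : ℂ} (ht : ‖t‖ = 1) (j : ℕ) (ψ : L2 N) :
    HasSum (fun a : Fin N → ℕ => ∑ i, if a i = j then ‖⟪hermL2 κ a, ψ⟫_ℂ‖ ^ 2 else 0)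
      (occupation (t • hermL2 κ fun _ => j) ψ) := by
  have h1 : ∀ᵐ y : ℝ, (t • hermL2 κ fun _ : Fin 1 => j) (fun _ => y) =
      t * gpoly κ (hermN κ j) y :=
    (volume_preserving_funUnique (Fin 1) ℝ).symm.quasiMeasurePreserving.ae
      (coeFn_smul_hermL2_one hκ t j)
  have h2 : ∀ᵐ x : Conf N, ∀ i, (t • hermL2 κ fun _ : Fin 1 => j) (fun _ => x i) =
      t * gpoly κ (hermN κ j) (x i) :=
    ae_all_iff.2 fun i => (quasiMeasurePreserving_coord i).ae (coeFn_smul_hermL2_one hκ t j)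
  have h3 : ∀ᵐ x : Conf N, numberOp (t • hermL2 κ fun _ => j) ψ x =
      ∑ i, modeProj κ (hermN κ j) i ψ x := by
    filter_upwards [h2] with x hx
    rw [numberOp]
    refine Finset.sum_congr rfl fun i _ => ?_
    have h4 : ∫ y : ℝ, starRingEnd ℂ ((t • hermL2 κ fun _ : Fin 1 => j) fun _ => y) *
        ψ (Function.update x i y) = starRingEnd ℂ t *
        ∫ y : ℝ, gpoly κ (hermN κ j) y * ψ (Function.update x i y) := by
      rw [← integral_const_mul]
      refine integral_congr_ae ?_
      filter_upwards [h1] with y hy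
      rw [hy, map_mul, Complex.conj_ofReal, mul_assoc]
    rw [hx i, h4, modeProj]
    have h5 : t * starRingEnd ℂ t = 1 := by rw [Complex.mul_conj', ht]; simp
    linear_combination (gpoly κ (hermN κ j) (x i) *
      ∫ y : ℝ, gpoly κ (hermN κ j) y * ψ (Function.update x i y)) * h5
  have h4 : occupation (t • hermL2 κ fun _ => j) ψ =
      ∑ i, (∫ x, starRingEnd ℂ (ψ x) * modeProj κ (hermN κ j) i ψ x).re := by
    rw [occupation, ← Complex.re_sum, ← integral_finsetSum]
    · congr 1
      refine integral_congr_ae ?_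
      filter_upwards [h3] with x hx
      rw [hx, Finset.mul_sum]
    · intro i _
      exact (Lp.memLp ψ).star.integrable_mul (memLp_modeProj hκ (hermN κ j) i ψ)
  rw [h4]
  exact hasSum_sum fun i _ => hasSum_inner_modeProj hκ j i ψ

/-- The occupation of the modes up to `M`, for a normalised wave function: at most the number of
particles, and all but the excitation energy divided by the energy of the mode `M + 1`. -/
theorem sum_occupation_bounds {c κ : ℝ} (hc : 0 < c) (hκ : κ ≠ 0) {φ : ℕ → L2 1}
    (hφ : ∀ j, ∃ t : ℂ, ‖t‖ = 1 ∧ φ j = t • hermL2 κ fun _ => j) {ψ : L2 N} {g : Fin N → L2 N}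
    (hψ : ‖ψ‖ = 1) (hg : HasWeakGrad ψ g) (hfin : FinitePotential (osc c κ N) ψ) (M : ℕ) :
    (∀ j, 0 ≤ occupation (φ j) ψ) ∧ ∑ j ∈ Finset.range (M + 1), occupation (φ j) ψ ≤ N ∧
    N - (energy c (osc c κ N) ψ g - c * κ ^ 2 * N / 2) / (c * κ ^ 2 * (M + 1)) ≤
      ∑ j ∈ Finset.range (M + 1), occupation (φ j) ψ := by
  have hω : 0 < c * κ ^ 2 := by positivity
  have hocc : ∀ j, HasSum (fun a : Fin N → ℕ =>
      ∑ i, if a i = j then ‖⟪hermL2 κ a, ψ⟫_ℂ‖ ^ 2 else 0) (occupation (φ j) ψ) := fun j => by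
    obtain ⟨t, ht, h⟩ := hφ j
    rw [h]
    exact hasSum_occupation hκ ht j ψ
  have hsum := hasSum_sum fun j (_ : j ∈ Finset.range (M + 1)) => hocc j
  have hterm : ∀ a : Fin N → ℕ, (∑ j ∈ Finset.range (M + 1),
      ∑ i, if a i = j then ‖⟪hermL2 κ a, ψ⟫_ℂ‖ ^ 2 else 0) =
      ∑ i, if a i < M + 1 then ‖⟪hermL2 κ a, ψ⟫_ℂ‖ ^ 2 else 0 := by
    intro a
    rw [Finset.sum_comm]
    refine Finset.sum_congr rfl fun i _ => ?_
    rw [Finset.sum_ite_eq]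
    simp
  simp only [hterm] at hsum
  have hnorm : HasSum (fun a : Fin N → ℕ => ‖⟪hermL2 κ a, ψ⟫_ℂ‖ ^ 2) 1 := by
    have := hasSum_norm_sq_hermL2 hκ ψ
    rwa [hψ, one_pow] at this
  refine ⟨fun j => (hocc j).nonneg fun a => Finset.sum_nonneg fun i _ => ?_, ?_, ?_⟩
  · split_ifs <;> positivity
  · have h1 := hnorm.mul_left (N : ℝ)
    rw [mul_one] at h1
    refine hasSum_le (fun a => ?_) hsum h1
    refine (Finset.sum_le_sum fun i _ => (?_ : _ ≤ ‖⟪hermL2 κ a, ψ⟫_ℂ‖ ^ 2)).trans ?_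
    · split_ifs
      · exact le_rfl
      · positivity
    · simp
  · -- a particle in a mode above `M` has an excitation energy of at least `c κ² (M + 1)`
    set D := c * κ ^ 2 * (M + 1) with hD
    have hDpos : 0 < D := by positivity
    have h1 := hasSum_le_of_sum_le ((hnorm.mul_left (D * N + c * κ ^ 2 * N / 2 + 1)).sub
        (hsum.mul_left D)) (c := energy c (osc c κ N) ψ g + ‖ψ‖ ^ 2) fun F =>
      (Finset.sum_le_sum fun a _ => ?_).trans (sum_level_hermL2_le hc hκ hg hfin F)
    · rw [hψ, mul_one, one_pow] at h1
      have h2 : D * (N - (energy c (osc c κ N) ψ g - c * κ ^ 2 * N / 2) / D) ≤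
          D * ∑ j ∈ Finset.range (M + 1), occupation (φ j) ψ := by
        rw [mul_sub, mul_div_cancel₀ _ hDpos.ne']
        linarith
      exact le_of_mul_le_mul_left h2 hDpos
    · set q := ‖⟪hermL2 κ a, ψ⟫_ℂ‖ ^ 2 with hq
      have hq0 : 0 ≤ q := sq_nonneg _
      have h3 : D * N * q - D * (∑ i, if a i < M + 1 then q else 0) ≤
          c * κ ^ 2 * (∑ i, (a i : ℝ)) * q := by
        have h4 : D * N * q = ∑ _i : Fin N, D * q := by
          rw [Finset.sum_const, Finset.card_univ, Fintype.card_fin, nsmul_eq_mul]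
          ring
        rw [h4, Finset.mul_sum, Finset.mul_sum, Finset.sum_mul, ← Finset.sum_sub_distrib]
        refine Finset.sum_le_sum fun i _ => ?_
        split_ifs with hi
        · rw [sub_self]
          positivity
        · have h5 : (M : ℝ) + 1 ≤ a i := by exact_mod_cast not_lt.1 hi
          rw [mul_zero, sub_zero]
          exact mul_le_mul_of_nonneg_right (mul_le_mul_of_nonneg_left h5 hω.le) hq0
      rw [level_eq]
      linarith

/-! ### The eigenvectors of the ideal gas -/

/-- The form of the Hamiltonian is hermitian. -/
theorem form_conj_symm (c : ℝ) (W : Conf N → ℝ) (φ ψ : L2 N) (h g : Fin N → L2 N) :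
    starRingEnd ℂ ((c : ℂ) * ∑ i, ⟪h i, g i⟫_ℂ + ∫ x, (W x : ℂ) * (starRingEnd ℂ (φ x) * ψ x)) =
      (c : ℂ) * ∑ i, ⟪g i, h i⟫_ℂ + ∫ x, (W x : ℂ) * (starRingEnd ℂ (ψ x) * φ x) := by
  rw [map_add, map_mul, Complex.conj_ofReal, map_sum, ← integral_conj]
  congr 1
  · simp only [inner_conj_symm]
  · refine integral_congr_ae (ae_of_all _ fun x => ?_)
    simp only [map_mul, Complex.conj_ofReal, Complex.conj_conj]
    ring

theorem isFormEigen_symVec {c κ : ℝ} (hc : 0 ≤ c) (hκ : κ ≠ 0) (a : Fin N → ℕ) :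
    IsFormEigen c (osc c κ N) Set.univ (symVec κ a) (∑ b ∈ orbit a, hermGrad κ b)
      (level c κ a) := by
  have hm : AEMeasurable (osc c κ N) := (continuous_osc c κ).aemeasurable
  have h0 : ∀ᵐ x : Conf N, 0 ≤ osc c κ N x + 0 := ae_of_all _ fun x => by
    simpa using osc_nonneg hc κ x
  refine ⟨trivial, hasWeakGrad_sum _ fun b _ => hasWeakGrad_hermL2 hκ b,
    finitePotential_sum hm h0 _ fun b _ => finitePotential_osc_gL2 hκ _ _,
    fun φ h _ hh hfin => ?_⟩
  have hint : ∀ b : Fin N → ℕ,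
      Integrable fun x => (osc c κ N x : ℂ) * (starRingEnd ℂ (φ x) * hermL2 κ b x) := fun b =>
    (integrable_potential_mul h0 ((memLp_sqrt_mul_iff hm h0).2 hfin)
      ((memLp_sqrt_mul_iff hm h0).2 (finitePotential_osc_gL2 hκ _ _))).1
  have h1 : ∫ x, (osc c κ N x : ℂ) * (starRingEnd ℂ (φ x) * symVec κ a x) =
      ∑ b ∈ orbit a, ∫ x, (osc c κ N x : ℂ) * (starRingEnd ℂ (φ x) * hermL2 κ b x) := by
    rw [← integral_finsetSum _ fun b _ => hint b]
    refine integral_congr_ae ?_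
    filter_upwards [Lp.coeFn_finsetSum (orbit a) fun b => hermL2 κ b] with x hx
    rw [symVec, hx, Finset.sum_apply, Finset.mul_sum, Finset.mul_sum]
  have h2 : ∑ i, ⟪h i, (∑ b ∈ orbit a, hermGrad κ b) i⟫_ℂ =
      ∑ b ∈ orbit a, ∑ i, ⟪h i, hermGrad κ b i⟫_ℂ := by
    rw [Finset.sum_comm]
    refine Finset.sum_congr rfl fun i _ => ?_
    rw [Finset.sum_apply, inner_sum]
  rw [h1, h2, Finset.mul_sum, ← Finset.sum_add_distrib, symVec, inner_sum, Finset.mul_sum]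
  refine Finset.sum_congr rfl fun b hb => ?_
  rw [hermL2_eigen hκ c b hh]
  obtain ⟨σ, rfl⟩ := mem_orbit.1 hb
  rw [level_comp_perm]

/-- An eigenvector of the ideal gas is orthogonal to the Hermite functions of a different energy. -/
theorem IsEigenbasis.inner_hermL2_eq_zero {c κ : ℝ} {f : ℕ → L2 N} {g : ℕ → Fin N → L2 N}
    {E : ℕ → ℝ} (B : IsEigenbasis c (osc c κ N) f g E) (hc : 0 ≤ c) (hκ : κ ≠ 0) {k : ℕ}
    {a : Fin N → ℕ} (h : level c κ a ≠ E k) : ⟪hermL2 κ a, f k⟫_ℂ = 0 := by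
  have hs := isFormEigen_symVec hc hκ a
  have h1 := hs.eq (f k) (g k) trivial (B.eigen k).grad (B.eigen k).finite
  have h2 := (B.eigen k).eq (symVec κ a) _ (isBosonic_symVec hκ a) hs.grad hs.finite
  rw [← form_conj_symm, h1, map_mul, Complex.conj_ofReal, inner_conj_symm] at h2
  have h3 : ((level c κ a - E k : ℝ) : ℂ) * ⟪symVec κ a, f k⟫_ℂ = 0 := by
    push_cast
    linear_combination h2
  have h4 : ((level c κ a - E k : ℝ) : ℂ) ≠ 0 := by exact_mod_cast sub_ne_zero.2 h
  have h5 := (mul_eq_zero.1 h3).resolve_left h4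
  rw [inner_symVec hκ (B.eigen k).mem] at h5
  refine (mul_eq_zero.1 h5).resolve_left ?_
  exact_mod_cast (Finset.card_pos.2 ⟨a, self_mem_orbit a⟩).ne'

/-- The eigenvectors of the ideal gas are finite linear combinations of Hermite functions. -/
theorem IsEigenbasis.exists_eq_sum_hermL2 {c κ : ℝ} {f : ℕ → L2 N} {g : ℕ → Fin N → L2 N}
    {E : ℕ → ℝ} (B : IsEigenbasis c (osc c κ N) f g E) (hc : 0 < c) (hκ : κ ≠ 0) (k : ℕ) :
    ∃ (s : Finset (Fin N → ℕ)) (t : (Fin N → ℕ) → ℂ), f k = ∑ a ∈ s, t a • hermL2 κ a := by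
  let s := (finite_level_le (N := N) hc hκ (E k)).toFinset
  refine ⟨s, fun a => ⟪hermL2 κ a, f k⟫_ℂ, ?_⟩
  have h1 := (hermHilbert hκ).hasSum_repr (f k)
  have h2 := hasSum_sum_of_ne_finset_zero (L := SummationFilter.unconditional _) (s := s)
    (f := fun a => (hermHilbert hκ).repr (f k) a • hermHilbert hκ a) fun a ha => by
      rw [HilbertBasis.repr_apply_apply, hermHilbert_apply, B.inner_hermL2_eq_zero hc.le hκ,
        zero_smul]
      intro h
      exact ha ((Set.Finite.mem_toFinset _).2 h.le)
  refine (h1.unique h2).trans (Finset.sum_congr rfl fun a _ => ?_)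
  rw [HilbertBasis.repr_apply_apply, hermHilbert_apply]

/-! ### The modes of the trap -/

theorem isBosonic_one (ψ : L2 1) : IsBosonic ψ := fun σ => by
  rw [Subsingleton.elim σ 1]
  exact ae_of_all _ fun _ => rfl

theorem fin_one_eq (a : Fin 1 → ℕ) : a = fun _ => a 0 :=
  funext fun i => by rw [Subsingleton.elim i 0]

theorem level_one (c κ : ℝ) (j : ℕ) :
    level c κ (fun _ : Fin 1 => j) = c * κ ^ 2 * (j + 1 / 2) := by simp [level]

theorem isEigenbasis_hermL2_one {c κ : ℝ} (hκ : κ ≠ 0) :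
    IsEigenbasis c (osc c κ 1) (fun j => hermL2 κ fun _ => j) (fun j => hermGrad κ fun _ => j)
      fun j => level c κ fun _ : Fin 1 => j := by
  refine ⟨(orthonormal_hermL2 hκ).comp (fun (j : ℕ) (_ : Fin 1) => j)
    fun i j h => congrFun h 0, fun χ _ h => ?_, fun k => ?_⟩
  · refine eq_zero_of_inner_hermL2 hκ fun a => ?_
    rw [fin_one_eq a]
    exact h _
  · have h := isFormEigen_hermL2 (c := c) hκ fun _ : Fin 1 => k
    exact ⟨isBosonic_one _, h.grad, h.finite, fun φ h' _ => h.eq φ h' trivial⟩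

/-- The one-particle eigenvectors are unique up to a phase, if the eigenvalues are in increasing
order. -/
theorem IsEigenbasis.eq_smul_hermL2_one {c κ : ℝ} {f : ℕ → L2 1} {g : ℕ → Fin 1 → L2 1}
    {E : ℕ → ℝ} (B : IsEigenbasis c (osc c κ 1) f g E) (hE : Monotone E) (hc : 0 < c)
    (hκ : κ ≠ 0) (j : ℕ) : ∃ t : ℂ, ‖t‖ = 1 ∧ f j = t • hermL2 κ fun _ => j := by
  have hω : 0 < c * κ ^ 2 := by positivity
  set e : ℕ → L2 1 := fun j => hermL2 κ fun _ => j with he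
  have hex : ∀ k, ∃ j, ⟪e j, f k⟫_ℂ ≠ 0 := by
    intro k
    by_contra! h
    have h0 : f k = 0 := eq_zero_of_inner_hermL2 hκ fun a => by
      rw [fin_one_eq a]
      exact h _
    have := B.norm_eq k
    rw [h0, norm_zero] at this
    exact zero_ne_one this
  choose σ hσ using hex
  have hlev : ∀ k j, ⟪e j, f k⟫_ℂ ≠ 0 → c * κ ^ 2 * (j + 1 / 2) = E k := by
    intro k j h
    by_contra h1
    exact h (B.inner_hermL2_eq_zero hc.le hκ (by rwa [level_one]))
  have huniq : ∀ k j, ⟪e j, f k⟫_ℂ ≠ 0 → j = σ k := by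
    intro k j h
    have h1 := (hlev k j h).trans (hlev k _ (hσ k)).symm
    have h2 := add_right_cancel (mul_left_cancel₀ hω.ne' h1)
    exact_mod_cast h2
  have hsmul : ∀ k, f k = ⟪e (σ k), f k⟫_ℂ • e (σ k) := by
    intro k
    rw [← sub_eq_zero]
    refine eq_zero_of_inner_hermL2 hκ fun a => ?_
    rw [fin_one_eq a, inner_sub_right, inner_smul_right]
    have h1 : ⟪hermL2 κ fun _ => a 0, e (σ k)⟫_ℂ = if a 0 = σ k then 1 else 0 := by
      rw [orthonormal_iff_ite.1 (orthonormal_hermL2 hκ)]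
      simp [funext_iff]
    rw [h1]
    by_cases h : a 0 = σ k
    · rw [if_pos h, mul_one, h, sub_self]
    · rw [if_neg h, mul_zero, sub_zero]
      by_contra h2
      exact h (huniq k (a 0) h2)
  have hnorm : ∀ k, ‖⟪e (σ k), f k⟫_ℂ‖ = 1 := by
    intro k
    have h1 := congrArg norm (hsmul k)
    rw [norm_smul, B.norm_eq, he, (orthonormal_hermL2 hκ).1, mul_one] at h1
    exact h1.symm
  have hinj : Function.Injective σ := by
    intro k l hkl
    by_contra hne
    have h1 : ⟪f k, f l⟫_ℂ = 0 := B.orthonormal.2 hne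
    have h2 : ‖⟪f k, f l⟫_ℂ‖ = 1 := by
      rw [hsmul k, hsmul l, inner_smul_left, inner_smul_right, norm_mul, norm_mul,
        RCLike.norm_conj, hnorm, hnorm, hkl, inner_self_eq_norm_sq_to_K, he,
        (orthonormal_hermL2 hκ).1]
      simp
    rw [h1, norm_zero] at h2
    exact zero_ne_one h2
  have hmono : StrictMono σ := by
    refine Monotone.strictMono_of_injective (fun k l hkl => ?_) hinj
    have h1 := hE hkl
    rw [← hlev k _ (hσ k), ← hlev l _ (hσ l)] at h1
    have h2 := le_of_add_le_add_right (le_of_mul_le_mul_left h1 hω)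
    exact_mod_cast h2
  have hsurj : Function.Surjective σ := by
    intro i
    by_contra! h
    have h1 : e i = 0 := B.complete _ (isBosonic_one _) fun k => by
      by_contra h2
      exact h k (huniq k i fun h3 => h2 (by rw [← inner_conj_symm, h3, map_zero])).symm
    have h2 : ‖e i‖ = 1 := (orthonormal_hermL2 hκ).1 _
    rw [h1, norm_zero] at h2
    exact zero_ne_one h2
  have hid : σ j = j := by
    have := Subsingleton.elim (hmono.orderIsoOfSurjective σ hsurj) (OrderIso.refl ℕ)
    exact congrArg (fun o : ℕ ≃o ℕ => o j) this
  refine ⟨⟪e (σ j), f j⟫_ℂ, hnorm j, ?_⟩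
  have := hsmul j
  rwa [hid] at this ⊢

/-- The inverse length scale of the trap with the frequency `om * γ`, so that `osc` has the level
spacing `ħ * om * γ`. -/
def trapScale (ħ m om γ : ℝ) : ℝ := Real.sqrt (2 * m * om * γ / ħ)

section Trap

variable {ħ m om γ : ℝ}

theorem trapScale_ne_zero (hħ : 0 < ħ) (hm : 0 < m) (hom : 0 < om) (hγ : 0 < γ) :
    trapScale ħ m om γ ≠ 0 :=
  (Real.sqrt_pos.2 (by positivity)).ne'

theorem spacing_eq (hħ : 0 < ħ) (hm : 0 < m) (hom : 0 < om) (hγ : 0 < γ) :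
    ħ ^ 2 / (2 * m) * trapScale ħ m om γ ^ 2 = ħ * om * γ := by
  rw [trapScale, Real.sq_sqrt (by positivity)]
  field_simp

theorem trap_eq_osc (hħ : 0 < ħ) (hm : 0 < m) (hom : 0 < om) (hγ : 0 < γ) (N : ℕ) :
    trap m om γ N = osc (ħ ^ 2 / (2 * m)) (trapScale ħ m om γ) N := by
  ext x
  refine Finset.sum_congr rfl fun i _ => ?_
  have h : trapScale ħ m om γ ^ 4 = (2 * m * om * γ / ħ) ^ 2 := by
    rw [trapScale, show (4 : ℕ) = 2 * 2 from rfl, pow_mul, Real.sq_sqrt (by positivity)]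
  rw [h, mul_pow, Real.sq_sqrt hγ.le]
  field_simp
  ring

/-- The modes of the trap are the Hermite functions of one variable, up to phases. -/
theorem trapMode_eq (hħ : 0 < ħ) (hm : 0 < m) (hom : 0 < om) (hγ : 0 < γ) (j : ℕ) :
    ∃ t : ℂ, ‖t‖ = 1 ∧
      trapMode ħ m om γ j = t • hermL2 (trapScale ħ m om γ) fun _ => j := by
  have hκ := trapScale_ne_zero hħ hm hom hγ
  have hc : 0 < ħ ^ 2 / (2 * m) := by positivity
  have hex : ∃ p : (ℕ → L2 1) × (ℕ → ℝ),
      IsSpectralResolution ħ m (trap m om γ 1) p.1 p.2 ∧ Monotone p.2 := by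
    refine ⟨(fun j => hermL2 (trapScale ħ m om γ) fun _ => j,
      fun j => level (ħ ^ 2 / (2 * m)) (trapScale ħ m om γ) fun _ : Fin 1 => j), ?_, ?_⟩
    · rw [trap_eq_osc hħ hm hom hγ]
      exact isSpectralResolution_iff.2 ⟨_, isEigenbasis_hermL2_one hκ⟩
    · intro i j hij
      simp only [level_one]
      have : (i : ℝ) ≤ j := by exact_mod_cast hij
      gcongr
  rw [trapMode, dif_pos hex]
  obtain ⟨h1, h2⟩ := hex.choose_spec
  generalize hex.choose = p at h1 h2 ⊢
  rw [trap_eq_osc hħ hm hom hγ] at h1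
  obtain ⟨g, B⟩ := isSpectralResolution_iff.1 h1
  exact B.eq_smul_hermL2_one h2 hc hκ j

end Trap

/-! ### Complete generalized condensation -/

section Condensation

variable {ħ m om β : ℝ}

theorem log_natCast_pos {N : ℕ} (hN : 2 ≤ N) : 0 < Real.log N :=
  Real.log_pos (by exact_mod_cast hN)

theorem gam_pos {N : ℕ} (hN : 2 ≤ N) : 0 < gam N :=
  div_pos (log_natCast_pos hN) (by exact_mod_cast (by omega : 0 < N))

theorem gam_mul_natCast {N : ℕ} (hN : 2 ≤ N) : gam N * N = Real.log N :=
  div_mul_cancel₀ _ (by exact_mod_cast (by omega : N ≠ 0))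

theorem potential_eq (hħ : 0 < ħ) (hm : 0 < m) (hom : 0 < om) (hN : 2 ≤ N)
    (U : (N : ℕ) → Conf N → ℝ) : potential m om U N =
      fun x => osc (ħ ^ 2 / (2 * m)) (trapScale ħ m om (gam N)) N x + U N x := by
  ext x
  rw [potential, trap_eq_osc hħ hm hom (gam_pos hN)]

theorem freeLaw_eq (hħ : 0 < ħ) (hm : 0 < m) (hom : 0 < om) (hN : 2 ≤ N) : freeLaw ħ m om β N =
    positionLaw ħ m β (osc (ħ ^ 2 / (2 * m)) (trapScale ħ m om (gam N)) N) := by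
  rw [freeLaw, trap_eq_osc hħ hm hom (gam_pos hN)]

/-- The bound on the mean excitation energy for a lower bound `-L` and a free mean `μ` of the
interaction. -/
def excitationBound (ħ om β L μ : ℝ) (N : ℕ) : ℝ :=
  2 / β * ((1 + Real.log N) / (β / 2 * (ħ * om * gam N)) + β * L + β * μ)

/-- In the thermal state, the modes up to `M` hold at most all particles, and all but the mean
excitation energy divided by the excitation energy of the mode `M + 1`. -/
theorem sum_meanOccupation_bounds (hħ : 0 < ħ) (hm : 0 < m) (hom : 0 < om) (hβ : 0 < β)
    (hN : 2 ≤ N) {U : (N : ℕ) → Conf N → ℝ} (hU : AEMeasurable (U N)) {L : ℝ}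
    (hUL : ∀ᵐ x, -L ≤ U N x) (hint : Integrable (U N) (freeLaw ħ m om β N)) (M : ℕ) :
    HasThermalState ħ m β (potential m om U N) ∧
    0 ≤ excitationBound ħ om β L (∫ x, U N x ∂(freeLaw ħ m om β N)) N ∧
    ∑ j ∈ Finset.range (M + 1), meanOccupation ħ m om β U N j ≤ N ∧
    N - excitationBound ħ om β L (∫ x, U N x ∂(freeLaw ħ m om β N)) N /
        (ħ * om * gam N * (M + 1)) ≤
      ∑ j ∈ Finset.range (M + 1), meanOccupation ħ m om β U N j := by
  have hγ := gam_pos hN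
  have hN0 : 0 < N := by omega
  have hc : 0 < ħ ^ 2 / (2 * m) := by positivity
  have hκ := trapScale_ne_zero hħ hm hom hγ
  have hsp := spacing_eq hħ hm hom hγ
  have hω : 0 < ħ * om * gam N := by positivity
  rw [freeLaw_eq hħ hm hom hN] at hint ⊢
  have hpot := potential_eq hħ hm hom hN U
  have hT : HasThermalState ħ m β (potential m om U N) :=
    hpot ▸ hasThermalState_osc_add hN0 hc hβ hκ hU hUL hint
  obtain ⟨g, B⟩ := exists_isEigenbasis hT
  obtain ⟨hfin, he0, hes, hle⟩ := mean_excitation_le hN0 hc hβ hκ hU hUL hint hpot B (fun _ => rfl)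
  set κ := trapScale ħ m om (gam N) with hκdef
  set c := ħ ^ 2 / (2 * m) with hcdef
  set f := (spectralPair ħ m β (potential m om U N)).1 with hf
  set w := thermalWeight ħ m β (potential m om U N) with hw
  set e : ℕ → ℝ := fun k => energy c (osc c κ N) (f k) (g k) - c * κ ^ 2 * N / 2 with he
  have hw0 : ∀ k, 0 ≤ w k := fun k => (thermalWeight_pos hT k).le
  have hws : HasSum w 1 := hasSum_thermalWeight hT
  have hbd := fun k M => sum_occupation_bounds hc hκ (trapMode_eq hħ hm hom hγ) (B.norm_eq k)
    (B.eigen k).grad (hfin k) M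
  have hocc : ∀ j k, w k * occupation (trapMode ħ m om (gam N) j) (f k) ≤ w k * N := by
    intro j k
    refine mul_le_mul_of_nonneg_left (le_trans ?_ (hbd k j).2.1) (hw0 k)
    exact Finset.single_le_sum (f := fun j => occupation (trapMode ħ m om (gam N) j) (f k))
      (fun i _ => (hbd k j).1 i) (Finset.self_mem_range_succ j)
  have hsumm : ∀ j, Summable fun k => w k * occupation (trapMode ħ m om (gam N) j) (f k) :=
    fun j => Summable.of_nonneg_of_le (fun k => mul_nonneg (hw0 k) ((hbd k j).1 j)) (hocc j)
      (hws.summable.mul_right _)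
  have htot : HasSum (fun k => w k *
      ∑ j ∈ Finset.range (M + 1), occupation (trapMode ħ m om (gam N) j) (f k))
      (∑ j ∈ Finset.range (M + 1), meanOccupation ħ m om β U N j) := by
    simp only [Finset.mul_sum]
    exact hasSum_sum fun j _ => (hsumm j).hasSum
  set X := excitationBound ħ om β L (∫ x, U N x ∂(positionLaw ħ m β (osc c κ N))) N with hX
  have hle' : ∑' k, w k * e k ≤ X := by
    rw [hX, excitationBound, ← hsp]
    exact hle
  refine ⟨hT, le_trans (tsum_nonneg fun k => mul_nonneg (hw0 k) (he0 k)) hle', ?_, ?_⟩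
  · have h1 := hws.mul_right (N : ℝ)
    rw [one_mul] at h1
    exact hasSum_le (fun k => mul_le_mul_of_nonneg_left (hbd k M).2.1 (hw0 k)) htot h1
  · have h1 := (hws.mul_right (N : ℝ)).sub (hes.hasSum.div_const (ħ * om * gam N * (M + 1)))
    rw [one_mul] at h1
    refine le_trans ?_ (hasSum_le (fun k => ?_) h1 htot)
    · exact sub_le_sub_left (div_le_div_of_nonneg_right hle' (by positivity)) _
    · have h2 := mul_le_mul_of_nonneg_left (hbd k M).2.2 (hw0 k)
      rw [hsp] at h2
      refine le_trans (le_of_eq ?_) h2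
      simp only [hsp]
      ring

theorem tendsto_log_natCast : Tendsto (fun N : ℕ => Real.log N) atTop atTop :=
  Real.tendsto_log_atTop.comp tendsto_natCast_atTop_atTop

/-- The mean excitation energy is `o(N log N)`. -/
theorem tendsto_excitationBound (hħ : 0 < ħ) (hom : 0 < om) (hβ : 0 < β) (B : ℝ) {μ : ℕ → ℝ}
    (hμ : μ =o[atTop] fun N : ℕ => (N : ℝ) * Real.log N) :
    Tendsto (fun N : ℕ => excitationBound ħ om β (B * N) (μ N) N / (N * Real.log N)) atTop
      (𝓝 0) := by
  have hinv : Tendsto (fun N : ℕ => (Real.log N)⁻¹) atTop (𝓝 0) :=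
    tendsto_inv_atTop_zero.comp tendsto_log_natCast
  have h1 : Tendsto (fun N : ℕ => 2 / β * ((β / 2 * (ħ * om))⁻¹ *
      ((Real.log N)⁻¹ * (Real.log N)⁻¹ + (Real.log N)⁻¹) + β * B * (Real.log N)⁻¹ +
      β * (μ N / (N * Real.log N)))) atTop
      (𝓝 (2 / β * ((β / 2 * (ħ * om))⁻¹ * (0 * 0 + 0) + β * B * 0 + β * 0))) :=
    (((((hinv.mul hinv).add hinv).const_mul _).add (hinv.const_mul _)).add
      (hμ.tendsto_div_nhds_zero.const_mul _)).const_mul _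
  have h0 : 2 / β * ((β / 2 * (ħ * om))⁻¹ * (0 * 0 + 0) + β * B * 0 + β * 0) = 0 := by ring
  rw [h0] at h1
  refine h1.congr' ?_
  filter_upwards [eventually_ge_atTop 2] with N hN
  have hl := log_natCast_pos hN
  have hN0 : (0 : ℝ) < N := by exact_mod_cast (by omega : 0 < N)
  rw [excitationBound, gam]
  field_simp

/-- For every `s > 0` the fraction of the particles in the modes up to `s N` tends to `1`, as
`ħ * om * gam N * (⌊s N⌋ + 1)` is at least `ħ * om * s * log N`. -/
theorem completeGBEC_of_smallFreeMean (hħ : 0 < ħ) (hm : 0 < m) (hom : 0 < om) (hβ : 0 < β)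
    {U : (N : ℕ) → Conf N → ℝ} {B : ℝ} (hU : ∀ N, 2 ≤ N → AEMeasurable (U N))
    (hB : BoundedBelow B U) (hs : SmallFreeMean ħ m om β U) : CompleteGBEC ħ m om β U := by
  have key := fun (N : ℕ) (hN : 2 ≤ N) => sum_meanOccupation_bounds hħ hm hom hβ hN (hU N hN)
    (hB N hN) (hs.1 N hN)
  refine ⟨fun N hN => (key N hN 0).1, fun _ => 1, fun s hs0 => ?_, tendsto_const_nhds⟩
  have hX := tendsto_excitationBound hħ hom hβ B hs.2
  have hlow := (hX.const_mul (ħ * om * s)⁻¹).const_sub 1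
  rw [mul_zero, sub_zero] at hlow
  refine tendsto_of_tendsto_of_tendsto_of_le_of_le' hlow tendsto_const_nhds ?_ ?_
  · filter_upwards [eventually_ge_atTop 2] with N hN
    obtain ⟨-, h0, -, h1⟩ := key N hN ⌊s * N⌋₊
    set X := excitationBound ħ om β (B * N) (∫ x, U N x ∂(freeLaw ħ m om β N)) N
    have hN0 : (0 : ℝ) < N := by exact_mod_cast (by omega : 0 < N)
    have hl := log_natCast_pos hN
    have hγ := gam_pos hN
    have h2 : X / (ħ * om * gam N * (⌊s * N⌋₊ + 1)) ≤ X / (ħ * om * gam N * (s * N)) := by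
      refine div_le_div_of_nonneg_left h0 (by positivity) ?_
      exact mul_le_mul_of_nonneg_left (Nat.lt_floor_add_one _).le (by positivity)
    have h3 : 1 - (ħ * om * s)⁻¹ * (X / (N * Real.log N)) =
        1 / (N : ℝ) * (N - X / (ħ * om * gam N * (s * N))) := by
      rw [← gam_mul_natCast hN]
      field_simp
    rw [h3]
    exact mul_le_mul_of_nonneg_left (by linarith) (by positivity)
  · filter_upwards [eventually_ge_atTop 2] with N hN
    have hN0 : (0 : ℝ) < N := by exact_mod_cast (by omega : 0 < N)
    rw [one_div, inv_mul_le_iff₀ hN0, mul_one]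
    exact (key N hN _).2.2.1

end Condensation

/-! ### Pair interactions of finite combinations of Hermite functions -/

/-- Integration along the fibers of a coordinate, weighted with the unit interval. -/
theorem lintegral_eq_lintegral_fiber (i : Fin N) {H : Conf N → ℝ≥0∞} (hH : Measurable H) :
    ∫⁻ x, H x = ∫⁻ x : Conf N, (Set.Icc (0 : ℝ) 1).indicator 1 (x i) *
      ∫⁻ y, H (Function.update x i y) := by
  have hρ : Measurable ((Set.Icc (0 : ℝ) 1).indicator (1 : ℝ → ℝ≥0∞)) :=
    measurable_one.indicator measurableSet_Icc
  have h1 : ∫⁻ y, (Set.Icc (0 : ℝ) 1).indicator (1 : ℝ → ℝ≥0∞) y = 1 := by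
    rw [lintegral_indicator_one measurableSet_Icc]
    simp
  let F : Conf N × ℝ → ℝ≥0∞ := fun z => H z.1 * (Set.Icc (0 : ℝ) 1).indicator 1 z.2
  have hF : Measurable F := (hH.comp measurable_fst).mul (hρ.comp measurable_snd)
  have h2 : ∫⁻ z, F (exch i z) = ∫⁻ z, F z :=
    (measurePreserving_exch i).lintegral_comp_emb (measurableEmbedding_exch i) F
  have h3 := lintegral_prod (μ := (volume : Measure (Conf N))) (ν := (volume : Measure ℝ)) F
    hF.aemeasurable
  have h4 := lintegral_prod (μ := (volume : Measure (Conf N))) (ν := (volume : Measure ℝ))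
    (fun z => F (exch i z)) (hF.comp (measurePreserving_exch i).measurable).aemeasurable
  have h5 : ∫⁻ x, H x = ∫⁻ x, ∫⁻ y, F (x, y) := by
    refine lintegral_congr fun x => ?_
    simp only [F]
    rw [lintegral_const_mul _ hρ, h1, mul_one]
  rw [h5]
  refine h3.symm.trans (h2.symm.trans (h4.trans (lintegral_congr fun x => ?_)))
  have hm : Measurable fun y => H (Function.update x i y) := hH.comp (measurable_update x)
  simp only [F, exch]
  rw [lintegral_mul_const _ hm, mul_comm]

/-- On the line, an integrable function is bounded by the total variation. -/
theorem ofReal_le_lintegral_deriv {n n' : ℝ → ℝ} (hd : ∀ y, HasDerivAt n (n' y) y)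
    (hn : Integrable n) (hn' : Continuous n') (y : ℝ) :
    ENNReal.ofReal (n y) ≤ ∫⁻ z, ‖n' z‖ₑ := by
  by_cases htop : ∫⁻ z, ‖n' z‖ₑ = ∞
  · rw [htop]
    exact le_top
  have hi : Integrable n' := ⟨hn'.aestronglyMeasurable, lt_top_iff_ne_top.2 htop⟩
  have h0 := tendsto_zero_of_hasDerivAt_of_integrableOn_Iic (a := y) (fun x _ => hd x)
    hi.integrableOn hn.integrableOn
  have h1 := integral_Iic_of_hasDerivAt_of_tendsto (hd y).continuousAt.continuousWithinAt
    (fun x _ => hd x) hi.integrableOn h0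
  rw [sub_zero] at h1
  calc ENNReal.ofReal (n y) ≤ ‖n y‖ₑ := Real.ofReal_le_enorm _
    _ = ‖∫ z in Set.Iic y, n' z‖ₑ := by rw [h1]
    _ ≤ ∫⁻ z in Set.Iic y, ‖n' z‖ₑ := enorm_integral_le_lintegral_enorm _
    _ ≤ ∫⁻ z, ‖n' z‖ₑ := setLIntegral_le_lintegral _ _

/-- A finite linear combination of products of polynomials times Gaussians. -/
def gComb (κ : ℝ) {A : Type*} (s : Finset A) (t : A → ℂ) (P : A → Fin N → Polynomial ℝ)
    (x : Conf N) : ℂ := ∑ a ∈ s, t a * gprod κ (P a) x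

section Comb

variable {κ : ℝ} {A : Type*} (s : Finset A) (t : A → ℂ) (P : A → Fin N → Polynomial ℝ)

theorem coeFn_sum_gL2 (hκ : κ ≠ 0) :
    (∑ a ∈ s, t a • gL2 κ (P a) : L2 N) =ᵐ[volume] gComb κ s t P := by
  have h1 : ∀ᵐ x, ∀ a ∈ s, (t a • gL2 κ (P a)) x = t a * gprod κ (P a) x := by
    rw [Filter.eventually_all_finset]
    intro a _
    filter_upwards [Lp.coeFn_smul (t a) (gL2 κ (P a)), coeFn_gL2 hκ (P a)] with x h1 h2
    rw [h1, Pi.smul_apply, h2, smul_eq_mul]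
  filter_upwards [Lp.coeFn_finsetSum s fun a => t a • gL2 κ (P a), h1] with x h2 h3
  rw [h2, Finset.sum_apply, gComb]
  exact Finset.sum_congr rfl h3

theorem continuous_gComb (κ : ℝ) : Continuous (gComb κ s t P) :=
  continuous_finsetSum s fun a _ => continuous_const.mul
    (Complex.continuous_ofReal.comp (contDiff_gprod κ (P a) (n := 0)).continuous)

/-- The partial derivative of a linear combination, as a linear combination. -/
theorem hasDerivAt_gComb (κ : ℝ) (i : Fin N) (x : Conf N) (y : ℝ) :
    HasDerivAt (fun y => gComb κ s t P (Function.update x i y))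
      (gComb κ s (fun a => κ * t a) (fun a => Function.update (P a) i (gderiv (P a i)))
        (Function.update x i y)) y := by
  unfold gComb
  refine HasDerivAt.fun_sum fun a _ => ?_
  have h8 : ∀ (Q : Fin N → Polynomial ℝ) (y : ℝ),
      ∏ k ∈ Finset.univ.erase i, gpoly κ (Q k) (Function.update x i y k) =
      ∏ k ∈ Finset.univ.erase i, gpoly κ (Q k) (x k) := fun Q y =>
    Finset.prod_congr rfl fun k hk => by rw [Function.update_of_ne (Finset.ne_of_mem_erase hk)]
  have h1 := (((hasDerivAt_gpoly κ (P a i) y).mul_const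
    (∏ k ∈ Finset.univ.erase i, gpoly κ (P a k) (x k))).ofReal_comp).const_mul (t a)
  have h2 : ∀ y, gprod κ (P a) (Function.update x i y) =
      gpoly κ (P a i) y * ∏ k ∈ Finset.univ.erase i, gpoly κ (P a k) (x k) := fun y => by
    rw [gprod_eq_mul_erase κ (P a) i, Function.update_self, h8]
  have h3 : (κ * t a : ℂ) * gprod κ (Function.update (P a) i (gderiv (P a i)))
      (Function.update x i y) = t a * ((κ * gpoly κ (gderiv (P a i)) y *
        ∏ k ∈ Finset.univ.erase i, gpoly κ (P a k) (x k) : ℝ) : ℂ) := by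
    rw [gprod_update, Function.update_self, h8]
    push_cast
    ring
  simp only [h2]
  rw [h3]
  exact h1

theorem integrable_sq_gComb_update (hκ : κ ≠ 0) (i : Fin N) (x : Conf N) :
    Integrable fun y => ‖gComb κ s t P (Function.update x i y)‖ ^ 2 := by
  have hc : Continuous fun y : ℝ => Function.update x i y := continuous_const.update i continuous_id
  have hm : Continuous fun y => gComb κ s t P (Function.update x i y) :=
    (continuous_gComb s t P κ).comp hc
  rw [← memLp_two_iff_integrable_sq_norm hm.aestronglyMeasurable]
  refine memLp_finsetSum s fun a _ => ?_
  have h2 : ∀ y, gprod κ (P a) (Function.update x i y) =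
      (∏ k ∈ Finset.univ.erase i, gpoly κ (P a k) (x k)) * gpoly κ (P a i) y := fun y => by
    rw [gprod_eq_mul_erase κ (P a) i, Function.update_self, mul_comm]
    congr 1
    exact Finset.prod_congr rfl fun k hk => by
      rw [Function.update_of_ne (Finset.ne_of_mem_erase hk)]
  have h3 : MemLp (gpoly κ (P a i)) 2 := by
    rw [memLp_two_iff_integrable_sq
      (contDiff_gpoly κ (P a i) (n := 0)).continuous.aestronglyMeasurable]
    simpa [sq] using integrable_gpoly_mul hκ (P a i) (P a i)
  have h4 : MemLp (fun y => gprod κ (P a) (Function.update x i y)) 2 := by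
    simp only [h2]
    exact h3.const_mul _
  exact (h4.ofReal (K := ℂ)).const_mul (t a)

/-- A pair interaction is bounded by its integral: the density of a wave function along a
coordinate is at most `2 ∫ |F| |∂ᵢF|`. -/
theorem lintegral_pair_gComb_le (hκ : κ ≠ 0) {i j : Fin N} (hij : i ≠ j) {v : ℝ → ℝ≥0∞}
    (hv : Measurable v) :
    ∫⁻ x : Conf N, v (x i - x j) * ‖gComb κ s t P x‖ₑ ^ 2 ≤
      (∫⁻ y, v y) * ∫⁻ x, 2 * (‖gComb κ s t P x‖ₑ * ‖gComb κ s (fun a => κ * t a)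
        (fun a => Function.update (P a) i (gderiv (P a i))) x‖ₑ) := by
  set F := gComb κ s t P with hF
  set G := gComb κ s (fun a => κ * t a) (fun a => Function.update (P a) i (gderiv (P a i))) with hG
  have hFc : Continuous F := continuous_gComb s t P κ
  have hGc : Continuous G := continuous_gComb s _ _ κ
  have hm1 : Measurable fun x : Conf N => v (x i - x j) * ‖F x‖ₑ ^ 2 :=
    (hv.comp ((measurable_pi_apply i).sub (measurable_pi_apply j))).mul
      (hFc.measurable.enorm.pow_const 2)
  have hm2 : Measurable fun x : Conf N => 2 * (‖F x‖ₑ * ‖G x‖ₑ) :=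
    (hFc.measurable.enorm.mul hGc.measurable.enorm).const_mul 2
  rw [lintegral_eq_lintegral_fiber i hm1, lintegral_eq_lintegral_fiber i hm2,
    ← lintegral_const_mul]
  swap
  · have h1 : Measurable fun z : Conf N × ℝ => 2 * (‖F (Function.update z.1 i z.2)‖ₑ *
        ‖G (Function.update z.1 i z.2)‖ₑ) :=
      hm2.comp (measurable_fst.comp (measurePreserving_exch i).measurable)
    exact ((measurable_one.indicator measurableSet_Icc).comp (measurable_pi_apply i)).mul
      h1.lintegral_prod_right'
  refine lintegral_mono fun x => ?_
  simp only
  rw [mul_left_comm]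
  refine mul_le_mul_right ?_ _
  have hu : Continuous fun y : ℝ => Function.update x i y := continuous_const.update i continuous_id
  have hsup : ∀ y, ‖F (Function.update x i y)‖ₑ ^ 2 ≤
      ∫⁻ z, 2 * (‖F (Function.update x i z)‖ₑ * ‖G (Function.update x i z)‖ₑ) := by
    intro y
    have h1 := ofReal_le_lintegral_deriv (fun y => (hasDerivAt_gComb s t P κ i x y).norm_sq)
      (integrable_sq_gComb_update s t P hκ i x)
      (continuous_const.mul ((hFc.comp hu).inner (hGc.comp hu))) y
    refine le_trans (le_of_eq ?_) (h1.trans (lintegral_mono fun z => ?_))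
    · rw [ENNReal.ofReal_pow (norm_nonneg _), ofReal_norm]
    · rw [← ofReal_norm, ← ofReal_norm, ← ofReal_norm, ← ENNReal.ofReal_mul (norm_nonneg _),
        show (2 : ℝ≥0∞) = ENNReal.ofReal 2 by simp, ← ENNReal.ofReal_mul zero_le_two]
      refine ENNReal.ofReal_le_ofReal ?_
      rw [norm_mul, Real.norm_ofNat]
      exact mul_le_mul_of_nonneg_left (norm_inner_le_norm _ _) zero_le_two
  calc ∫⁻ y, v (Function.update x i y i - Function.update x i y j) *
        ‖F (Function.update x i y)‖ₑ ^ 2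
      ≤ ∫⁻ y, v (y - x j) *
        ∫⁻ z, 2 * (‖F (Function.update x i z)‖ₑ * ‖G (Function.update x i z)‖ₑ) := by
        refine lintegral_mono fun y => ?_
        simp only
        rw [Function.update_self, Function.update_of_ne hij.symm]
        exact mul_le_mul_right (hsup y) _
    _ = _ := by
        have hm : Measurable fun y => v (y - x j) := hv.comp (measurable_id.sub_const _)
        rw [lintegral_mul_const _ hm, lintegral_sub_right_eq_self]

end Comb

theorem lintegral_enorm_mul_le (φ ψ : L2 N) :
    ∫⁻ x, ‖φ x‖ₑ * ‖ψ x‖ₑ ≤ ENNReal.ofReal (‖φ‖ * ‖ψ‖) := by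
  have h1 : Integrable fun x => φ x * ψ x := (Lp.memLp φ).integrable_mul (Lp.memLp ψ)
  have h2 := ofReal_integral_norm_eq_lintegral_enorm h1
  simp only [norm_mul, enorm_mul] at h2
  rw [← h2]
  refine ENNReal.ofReal_le_ofReal (le_of_sq_le_sq ?_ (by positivity))
  rw [mul_pow, norm_sq_L2, norm_sq_L2]
  exact sq_integral_norm_mul_norm_le (Lp.memLp φ) (Lp.memLp ψ)

/-- Weak gradients are unique. -/
theorem HasWeakGrad.unique {φ : L2 N} {h g : Fin N → L2 N} (hh : HasWeakGrad φ h)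
    (hg : HasWeakGrad φ g) : h = g := by
  funext i
  rw [← sub_eq_zero]
  refine eq_zero_of_inner_hermL2 one_ne_zero fun a => ?_
  have h1 : ⟪h i - g i, hermL2 1 a⟫_ℂ = 0 := by
    rw [inner_sub_left, hermL2, hh.inner_gL2 one_ne_zero, hg.inner_gL2 one_ne_zero, sub_self]
  rw [← inner_conj_symm, h1, map_zero]

/-- The mean of a pair interaction in an eigenvector of the ideal gas. -/
theorem IsEigenbasis.lintegral_pair_le {c κ : ℝ} {f : ℕ → L2 N} {g : ℕ → Fin N → L2 N}
    {E : ℕ → ℝ} (B : IsEigenbasis c (osc c κ N) f g E) (hc : 0 < c) (hκ : κ ≠ 0) (k : ℕ)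
    {i j : Fin N} (hij : i ≠ j) {v : ℝ → ℝ≥0∞} (hv : Measurable v) :
    ∫⁻ x : Conf N, v (x i - x j) * ‖f k x‖ₑ ^ 2 ≤
      (∫⁻ y, v y) * ENNReal.ofReal (1 + ‖g k i‖ ^ 2) := by
  obtain ⟨s, t, hst⟩ := B.exists_eq_sum_hermL2 hc hκ k
  have hg : g k = ∑ a ∈ s, fun i => t a • hermGrad κ a i := by
    refine (B.eigen k).grad.unique ?_
    rw [hst]
    exact hasWeakGrad_sum s fun a _ => (hasWeakGrad_hermL2 hκ a).smul (t a)
  set P : (Fin N → ℕ) → Fin N → Polynomial ℝ := fun a k => hermN κ (a k) with hP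
  have hf' : f k =ᵐ[volume] gComb κ s t P := by
    rw [hst]
    exact coeFn_sum_gL2 s t P hκ
  have hg' : g k i =ᵐ[volume] gComb κ s (fun a => κ * t a)
      (fun a => Function.update (P a) i (gderiv (P a i))) := by
    have h1 : g k i = ∑ a ∈ s, (κ * t a : ℂ) •
        gL2 κ (Function.update (P a) i (gderiv (P a i))) := by
      rw [hg, Finset.sum_apply]
      refine Finset.sum_congr rfl fun a _ => ?_
      rw [hermGrad, gGrad, smul_smul, mul_comm]
    rw [h1]
    exact coeFn_sum_gL2 s _ _ hκ
  have h1 : ∫⁻ x : Conf N, v (x i - x j) * ‖f k x‖ₑ ^ 2 =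
      ∫⁻ x : Conf N, v (x i - x j) * ‖gComb κ s t P x‖ₑ ^ 2 := by
    refine lintegral_congr_ae ?_
    filter_upwards [hf'] with x hx
    rw [hx]
  rw [h1]
  refine (lintegral_pair_gComb_le s t P hκ hij hv).trans (mul_le_mul_right ?_ _)
  have h2 : ∫⁻ x, 2 * (‖gComb κ s t P x‖ₑ * ‖gComb κ s (fun a => κ * t a)
      (fun a => Function.update (P a) i (gderiv (P a i))) x‖ₑ) =
      2 * ∫⁻ x, ‖f k x‖ₑ * ‖g k i x‖ₑ := by
    rw [← lintegral_const_mul' _ _ (by simp)]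
    refine lintegral_congr_ae ?_
    filter_upwards [hf', hg'] with x hx1 hx2
    rw [hx1, hx2]
  rw [h2]
  refine (mul_le_mul_right (lintegral_enorm_mul_le (f k) (g k i)) 2).trans ?_
  have h3 : 2 * ENNReal.ofReal (‖f k‖ * ‖g k i‖) = ENNReal.ofReal (2 * (‖f k‖ * ‖g k i‖)) := by
    rw [ENNReal.ofReal_mul zero_le_two, ENNReal.ofReal_ofNat]
  rw [h3, B.norm_eq]
  refine ENNReal.ofReal_le_ofReal ?_
  nlinarith [sq_nonneg (‖g k i‖ - 1)]

/-! ### The free mean of a pair interaction -/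

theorem quasiMeasurePreserving_sub_coord {i j : Fin N} (hij : i ≠ j) :
    Measure.QuasiMeasurePreserving fun x : Conf N => x i - x j := by
  refine ⟨(measurable_pi_apply i).sub (measurable_pi_apply j), ?_⟩
  let D : Conf N →ₗ[ℝ] ℝ :=
    (LinearMap.proj i : Conf N →ₗ[ℝ] ℝ) - LinearMap.proj j
  have hs : Function.Surjective D := fun y => ⟨Pi.single i y, by
    simp [D, Pi.single_eq_of_ne hij.symm]⟩
  obtain ⟨c, -, hc⟩ := D.exists_map_addHaar_eq_smul_addHaar volume volume hs
  have h1 : Measure.map (fun x : Conf N => x i - x j) volume = c • volume := hc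
  rw [h1]
  exact Measure.AbsolutelyContinuous.rfl.smul_left c

theorem aemeasurable_pairInteraction {u : ℕ → ℝ → ℝ} (hu : Integrable (u N)) :
    AEMeasurable (pairInteraction u N) := by
  unfold pairInteraction
  refine Finset.aemeasurable_fun_sum _ fun i _ => Finset.aemeasurable_fun_sum _ fun j hj => ?_
  exact hu.1.aemeasurable.comp_quasiMeasurePreserving
    (quasiMeasurePreserving_sub_coord (Finset.mem_Ioi.1 hj).ne)

theorem lintegral_positionLaw {ħ m β : ℝ} {W U : Conf N → ℝ} (hU : AEMeasurable U) :
    ∫⁻ x, ‖U x‖ₑ ∂(positionLaw ħ m β W) = ∑' k, ENNReal.ofReal (thermalWeight ħ m β W k) *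
      ∫⁻ x, ‖U x‖ₑ * ‖(spectralPair ħ m β W).1 k x‖ₑ ^ 2 := by
  rw [positionLaw, lintegral_sum_measure]
  refine tsum_congr fun k => ?_
  rw [lintegral_smul_measure, lintegral_withDensity_eq_lintegral_mul₀
    (measurable_enorm_sq _).aemeasurable hU.enorm, smul_eq_mul]
  congr 1
  exact lintegral_congr fun x => by rw [Pi.mul_apply, mul_comm]

theorem positionLaw_absolutelyContinuous (ħ m β : ℝ) (W : Conf N → ℝ) :
    positionLaw ħ m β W ≪ volume :=
  Measure.absolutelyContinuous_sum_left fun _ =>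
    (withDensity_absolutelyContinuous _ _).smul_left _

/-- The mean of the modulus of a pair interaction in an eigenvector of the ideal gas, in terms of
the kinetic energy. -/
theorem IsEigenbasis.lintegral_pairInteraction_le {c κ : ℝ} {f : ℕ → L2 N}
    {g : ℕ → Fin N → L2 N} {E : ℕ → ℝ} (B : IsEigenbasis c (osc c κ N) f g E) (hc : 0 < c)
    (hκ : κ ≠ 0) (k : ℕ) {u : ℕ → ℝ → ℝ} (hu : Integrable (u N)) :
    ∫⁻ x, ‖pairInteraction u N x‖ₑ * ‖f k x‖ₑ ^ 2 ≤
      ENNReal.ofReal ((∫ x, |u N x|) * (N * (N + ∑ i, ‖g k i‖ ^ 2))) := by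
  -- a measurable representative of the interaction
  obtain ⟨v, hv, huv⟩ : ∃ v : ℝ → ℝ, Measurable v ∧ u N =ᵐ[volume] v :=
    ⟨hu.1.aemeasurable.mk _, hu.1.aemeasurable.measurable_mk, hu.1.aemeasurable.ae_eq_mk⟩
  have hint : ∫⁻ y, ‖v y‖ₑ = ENNReal.ofReal (∫ x, |u N x|) := by
    have h1 := ofReal_integral_norm_eq_lintegral_enorm hu
    simp only [Real.norm_eq_abs] at h1
    rw [h1]
    refine lintegral_congr_ae ?_
    filter_upwards [huv] with x hx
    rw [hx]
  have hae : ∀ᵐ x : Conf N, ∀ i, ∀ j ∈ Finset.Ioi i, u N (x i - x j) = v (x i - x j) := by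
    rw [ae_all_iff]
    intro i
    rw [Filter.eventually_all_finset]
    intro j hj
    exact (quasiMeasurePreserving_sub_coord (Finset.mem_Ioi.1 hj).ne).ae huv
  have hm : ∀ i j : Fin N, Measurable fun x : Conf N => ‖v (x i - x j)‖ₑ * ‖f k x‖ₑ ^ 2 :=
    fun i j => (hv.comp ((measurable_pi_apply i).sub (measurable_pi_apply j))).enorm.mul
      (measurable_enorm_sq _)
  calc ∫⁻ x, ‖pairInteraction u N x‖ₑ * ‖f k x‖ₑ ^ 2
      ≤ ∫⁻ x : Conf N, ∑ i, ∑ j ∈ Finset.Ioi i, ‖v (x i - x j)‖ₑ * ‖f k x‖ₑ ^ 2 := by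
        refine lintegral_mono_ae ?_
        filter_upwards [hae] with x hx
        simp only [← Finset.sum_mul]
        refine mul_le_mul_left ?_ _
        refine (enorm_sum_le _ _).trans (Finset.sum_le_sum fun i _ => ?_)
        refine (enorm_sum_le _ _).trans (Finset.sum_le_sum fun j hj => ?_)
        rw [hx i j hj]
    _ = ∑ i, ∑ j ∈ Finset.Ioi i, ∫⁻ x : Conf N, ‖v (x i - x j)‖ₑ * ‖f k x‖ₑ ^ 2 := by
        rw [lintegral_finsetSum _ fun i _ => Finset.measurable_fun_sum _ fun j _ => hm i j]
        exact Finset.sum_congr rfl fun i _ => lintegral_finsetSum _ fun j _ => hm i j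
    _ ≤ ∑ i : Fin N, ∑ j ∈ Finset.Ioi i,
        ENNReal.ofReal ((∫ x, |u N x|) * (1 + ‖g k i‖ ^ 2)) := by
        refine Finset.sum_le_sum fun i _ => Finset.sum_le_sum fun j hj => ?_
        have h1 := B.lintegral_pair_le hc hκ k (Finset.mem_Ioi.1 hj).ne hv.enorm
        rwa [hint, ← ENNReal.ofReal_mul (integral_nonneg fun x => abs_nonneg _)] at h1
    _ ≤ ∑ i : Fin N, ENNReal.ofReal (N * ((∫ x, |u N x|) * (1 + ‖g k i‖ ^ 2))) := by
        refine Finset.sum_le_sum fun i _ => ?_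
        rw [Finset.sum_const, nsmul_eq_mul, ENNReal.ofReal_mul (Nat.cast_nonneg N),
          ENNReal.ofReal_natCast]
        refine mul_le_mul_left ?_ _
        have h1 := Finset.card_le_univ (Finset.Ioi i)
        rw [Fintype.card_fin] at h1
        exact_mod_cast h1
    _ = _ := by
        have h0 : 0 ≤ ∫ x, |u N x| := integral_nonneg fun x => abs_nonneg _
        rw [← ENNReal.ofReal_sum_of_nonneg fun i _ => by positivity]
        congr 1
        rw [← Finset.mul_sum, ← Finset.mul_sum, Finset.sum_add_distrib, Finset.sum_const,
          Finset.card_univ, Fintype.card_fin, nsmul_eq_mul]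
        ring

section FreeMean

variable {ħ m om β : ℝ}

/-- A bound of the kinetic energy per particle of the ideal gas. -/
def kineticBound (ħ om β : ℝ) (N : ℕ) : ℝ :=
  2 / β * (1 + Real.log N) / (β / 2 * (ħ * om * Real.log N)) + ħ * om * gam N / 2

/-- The mean of the modulus of a pair interaction in the thermal state of the ideal gas. -/
theorem lintegral_freeLaw_pairInteraction_le (hħ : 0 < ħ) (hm : 0 < m) (hom : 0 < om) (hβ : 0 < β)
    (hN : 2 ≤ N) {u : ℕ → ℝ → ℝ} (hu : Integrable (u N)) :
    ∫⁻ x, ‖pairInteraction u N x‖ₑ ∂(freeLaw ħ m om β N) ≤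
      ENNReal.ofReal ((∫ x, |u N x|) *
        (N * (N + N * kineticBound ħ om β N / (ħ ^ 2 / (2 * m))))) := by
  have hγ := gam_pos hN
  have hN0 : 0 < N := by omega
  have hc : 0 < ħ ^ 2 / (2 * m) := by positivity
  have hκ := trapScale_ne_zero hħ hm hom hγ
  have hsp := spacing_eq hħ hm hom hγ
  rw [freeLaw_eq hħ hm hom hN]
  set κ := trapScale ħ m om (gam N) with hκdef
  set c := ħ ^ 2 / (2 * m) with hcdef
  have hT : HasThermalState ħ m β (osc c κ N) := hasThermalState_osc hN0 hc hβ hκ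
  obtain ⟨g, B⟩ : ∃ g, IsEigenbasis c (osc c κ N) _ g _ := exists_isEigenbasis hT
  obtain ⟨hfin, he0, hes, hle⟩ := mean_excitation_le (U := fun _ => 0) (L := 0) hN0 hc hβ hκ
    aemeasurable_const (ae_of_all _ fun x => by simp) (integrable_zero _ _ _)
    (W := osc c κ N) (by simp [hcdef]) B (fun _ => rfl)
  simp only [← hcdef] at hfin he0 hes hle
  set f := (spectralPair ħ m β (osc c κ N)).1 with hf
  set w := thermalWeight ħ m β (osc c κ N) with hw
  set e : ℕ → ℝ := fun k => energy c (osc c κ N) (f k) (g k) - c * κ ^ 2 * N / 2 with he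
  have hw0 : ∀ k, 0 ≤ w k := fun k => (thermalWeight_pos hT k).le
  have hws : HasSum w 1 := hasSum_thermalWeight hT
  have hu0 : 0 ≤ ∫ x, |u N x| := integral_nonneg fun x => abs_nonneg _
  rw [lintegral_positionLaw (aemeasurable_pairInteraction hu)]
  -- the kinetic energy is at most the total energy
  have hkin : ∀ k, ∑ i, ‖g k i‖ ^ 2 ≤ (e k + c * κ ^ 2 * N / 2) / c := by
    intro k
    rw [le_div_iff₀ hc]
    have h1 : 0 ≤ ∫ x, osc c κ N x * ‖f k x‖ ^ 2 :=
      integral_nonneg fun x => mul_nonneg (osc_nonneg hc.le κ x) (sq_nonneg _)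
    simp only [he, energy]
    linarith
  set b : ℕ → ℝ := fun k => (∫ x, |u N x|) * (N * (N + (e k + c * κ ^ 2 * N / 2) / c)) with hb
  have hb0 : ∀ k, 0 ≤ b k := fun k => by
    have := he0 k
    positivity
  have hsum : HasSum (fun k => w k * b k) ((∫ x, |u N x|) *
      (N * (N * 1 + (∑' k, w k * e k + c * κ ^ 2 * N / 2 * 1) / c))) := by
    have h1 := (((hws.mul_left (N : ℝ)).add ((hes.hasSum.add
      (hws.mul_left (c * κ ^ 2 * N / 2))).div_const c)).mul_left (N : ℝ)).mul_left (∫ x, |u N x|)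
    have h2 : (fun k => w k * b k) = fun k => (∫ x, |u N x|) *
        (N * (N * w k + (w k * e k + c * κ ^ 2 * N / 2 * w k) / c)) := funext fun k => by
      simp only [b]
      ring
    rw [h2]
    exact h1
  calc ∑' k, ENNReal.ofReal (w k) * ∫⁻ x, ‖pairInteraction u N x‖ₑ * ‖f k x‖ₑ ^ 2
      ≤ ∑' k, ENNReal.ofReal (w k * b k) := by
        refine ENNReal.tsum_le_tsum fun k => ?_
        rw [ENNReal.ofReal_mul (hw0 k)]
        refine mul_le_mul_right ((B.lintegral_pairInteraction_le hc hκ k hu).trans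
          (ENNReal.ofReal_le_ofReal ?_)) _
        exact mul_le_mul_of_nonneg_left (mul_le_mul_of_nonneg_left
          (add_le_add le_rfl (hkin k)) (Nat.cast_nonneg N)) hu0
    _ = ENNReal.ofReal (∑' k, w k * b k) :=
        (ENNReal.ofReal_tsum_of_nonneg (fun k => mul_nonneg (hw0 k) (hb0 k)) hsum.summable).symm
    _ ≤ _ := by
        rw [hsum.tsum_eq, mul_one, mul_one]
        refine ENNReal.ofReal_le_ofReal ?_
        have h1 : ∑' k, w k * e k + c * κ ^ 2 * N / 2 ≤ N * kineticBound ħ om β N := by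
          refine le_trans (add_le_add_left hle _) (le_of_eq ?_)
          have hl := log_natCast_pos hN
          rw [hsp, kineticBound, ← gam_mul_natCast hN, integral_zero]
          have : (0 : ℝ) < N := by exact_mod_cast hN0
          field_simp
          ring
        gcongr

theorem tendsto_kineticBound (hħ : 0 < ħ) (hom : 0 < om) (hβ : 0 < β) :
    ∃ K : ℝ, Tendsto (kineticBound ħ om β) atTop (𝓝 K) := by
  have hinv : Tendsto (fun N : ℕ => (Real.log N)⁻¹) atTop (𝓝 0) :=
    tendsto_inv_atTop_zero.comp tendsto_log_natCast
  have hγ : Tendsto gam atTop (𝓝 0) := by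
    have h1 := (Real.isLittleO_log_id_atTop.tendsto_div_nhds_zero).comp
      (tendsto_natCast_atTop_atTop (R := ℝ))
    exact h1
  refine ⟨_, Tendsto.congr' ?_ ((((hinv.add_const 1).const_mul (2 / β * (β / 2 * (ħ * om))⁻¹))).add
    ((hγ.const_mul (ħ * om)).div_const 2))⟩
  filter_upwards [eventually_ge_atTop 2] with N hN
  have hl := log_natCast_pos hN
  rw [kineticBound]
  congr 1
  field_simp

/-- The free mean of a pair interaction is `O(N² ‖u_N‖₁)`, as `kineticBound` stays bounded. -/
theorem smallFreeMean_pairInteraction (hħ : 0 < ħ) (hm : 0 < m) (hom : 0 < om) (hβ : 0 < β)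
    {u : ℕ → ℝ → ℝ} (hu : ∀ N, 2 ≤ N → Integrable (u N))
    (hs : (fun N : ℕ => ∫ x, |u N x|) =o[atTop] gam) :
    SmallFreeMean ħ m om β (pairInteraction u) := by
  have key := fun N hN => lintegral_freeLaw_pairInteraction_le hħ hm hom hβ hN (hu N hN)
  refine ⟨fun N hN => ⟨?_, (key N hN).trans_lt ENNReal.ofReal_lt_top⟩, ?_⟩
  · exact (aemeasurable_pairInteraction (hu N hN)).aestronglyMeasurable.mono_ac
      (positionLaw_absolutelyContinuous ħ m β _)
  · obtain ⟨K, hK⟩ := tendsto_kineticBound hħ hom hβ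
    -- the bound is `‖u_N‖₁` times `O(N²)`
    have h1 : (fun N : ℕ => (N : ℝ) * (N + N * kineticBound ħ om β N / (ħ ^ 2 / (2 * m))))
        =O[atTop] fun N : ℕ => (N : ℝ) * N := by
      have h2 : (fun N : ℕ => 1 + kineticBound ħ om β N / (ħ ^ 2 / (2 * m))) =O[atTop]
          fun _ => (1 : ℝ) := ((hK.div_const _).const_add 1).isBigO_one ℝ
      refine ((isBigO_refl (fun N : ℕ => (N : ℝ) * N) atTop).mul h2).congr (fun N => ?_)
        (fun N => mul_one _)
      ring
    have h2 := hs.mul_isBigO h1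
    refine IsBigO.trans_isLittleO (g := fun N : ℕ => (∫ x, |u N x|) *
      ((N : ℝ) * (N + N * kineticBound ħ om β N / (ħ ^ 2 / (2 * m))))) ?_
      (h2.congr' EventuallyEq.rfl ?_)
    · refine IsBigO.of_bound 1 ?_
      filter_upwards [eventually_ge_atTop 2] with N hN
      rw [one_mul]
      refine (norm_integral_le_lintegral_norm _).trans ?_
      simp only [ofReal_norm]
      refine (ENNReal.toReal_mono ENNReal.ofReal_ne_top (key N hN)).trans ?_
      rw [Real.norm_eq_abs, ENNReal.toReal_ofReal']
      exact max_le (le_abs_self _) (abs_nonneg _)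
    · filter_upwards [eventually_ge_atTop 2] with N hN
      rw [← mul_assoc, gam_mul_natCast hN, mul_comm]

end FreeMean

/-! ### Scaled pair interactions -/

theorem integral_abs_scaledPair (u : ℝ → ℝ) (b α : ℕ → ℝ) {N : ℕ} (hα : 0 < α N) :
    ∫ x, |scaledPair u b α N x| = (∫ x, |u x|) * (|b N| / α N) := by
  simp only [scaledPair, abs_mul]
  rw [integral_const_mul, Measure.integral_comp_mul_left (fun x => |u x|), abs_inv,
    abs_of_pos hα, smul_eq_mul, div_eq_mul_inv]
  ring

theorem isLittleO_abs_div_iff {b α γ : ℕ → ℝ} (hα : ∀ N, 2 ≤ N → 0 < α N) :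
    (fun N => |b N| / α N) =o[atTop] γ ↔ b =o[atTop] fun N => α N * γ N := by
  constructor
  · intro h
    have h1 := (isBigO_refl α atTop).mul_isLittleO h
    refine isLittleO_abs_left.1 (h1.congr' ?_ EventuallyEq.rfl)
    filter_upwards [eventually_ge_atTop 2] with N hN
    exact mul_div_cancel₀ _ (hα N hN).ne'
  · intro h
    have h1 := (isBigO_refl (fun N => (α N)⁻¹) atTop).mul_isLittleO (isLittleO_abs_left.2 h)
    refine h1.congr' ?_ ?_
    · filter_upwards with N
      rw [div_eq_inv_mul]
    · filter_upwards [eventually_ge_atTop 2] with N hN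
      exact inv_mul_cancel_left₀ (hα N hN).ne' _

theorem integral_abs_scaledPair_eventuallyEq (u : ℝ → ℝ) (b : ℕ → ℝ) {α : ℕ → ℝ}
    (hα : ∀ N, 2 ≤ N → 0 < α N) : (fun N : ℕ => ∫ x, |scaledPair u b α N x|) =ᶠ[atTop]
      fun N => (∫ x, |u x|) * (|b N| / α N) := by
  filter_upwards [eventually_ge_atTop 2] with N hN
  exact integral_abs_scaledPair u b α (hα N hN)

end TrappedBose

end

theorem theorem5 (ħ m om β : ℝ) (hħ : 0 < ħ) (hm : 0 < m) (hom : 0 < om) (hβ : 0 < β) :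
    -- general interactions
    (∀ (U : (N : ℕ) → TrappedBose.Conf N → ℝ) (B : ℝ),
      (∀ N, AEMeasurable (U N)) →
      TrappedBose.BoundedBelow B U →
      TrappedBose.SmallFreeMean ħ m om β U →
      TrappedBose.CompleteGBEC ħ m om β U) ∧
    -- stable pair interactions
    (∀ (u : ℕ → ℝ → ℝ) (B : ℝ),
      (∀ N, 2 ≤ N → Integrable (u N)) →
      TrappedBose.BoundedBelow B (TrappedBose.pairInteraction u) →
      (fun N : ℕ => ∫ x, |u N x|) =o[atTop] TrappedBose.gam →
      TrappedBose.SmallFreeMean ħ m om β (TrappedBose.pairInteraction u) ∧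
      TrappedBose.CompleteGBEC ħ m om β (TrappedBose.pairInteraction u)) ∧
    -- scaled stable pair interactions
    (∀ (u : ℝ → ℝ) (b α : ℕ → ℝ),
      Integrable u →
      (∀ N, 2 ≤ N → 0 < α N) →
      ((∫ x, |u x|) ≠ 0 →
        ((fun N : ℕ => ∫ x, |TrappedBose.scaledPair u b α N x|) =o[atTop] TrappedBose.gam ↔
          b =o[atTop] fun N : ℕ => α N * (Real.log N / N))) ∧
      ∀ B : ℝ,
        TrappedBose.BoundedBelow B
          (TrappedBose.pairInteraction (TrappedBose.scaledPair u b α)) →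
        (b =o[atTop] fun N : ℕ => α N * (Real.log N / N)) →
        TrappedBose.SmallFreeMean ħ m om β
          (TrappedBose.pairInteraction (TrappedBose.scaledPair u b α)) ∧
        TrappedBose.CompleteGBEC ħ m om β
          (TrappedBose.pairInteraction (TrappedBose.scaledPair u b α))) := by
  have pair : ∀ (u : ℕ → ℝ → ℝ) (B : ℝ), (∀ N, 2 ≤ N → Integrable (u N)) →
      TrappedBose.BoundedBelow B (TrappedBose.pairInteraction u) →
      (fun N : ℕ => ∫ x, |u N x|) =o[atTop] TrappedBose.gam →
      TrappedBose.SmallFreeMean ħ m om β (TrappedBose.pairInteraction u) ∧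
      TrappedBose.CompleteGBEC ħ m om β (TrappedBose.pairInteraction u) := by
    intro u B hu hB hs
    have h1 := TrappedBose.smallFreeMean_pairInteraction hħ hm hom hβ hu hs
    exact ⟨h1, TrappedBose.completeGBEC_of_smallFreeMean hħ hm hom hβ
      (fun N hN => TrappedBose.aemeasurable_pairInteraction (hu N hN)) hB h1⟩
  refine ⟨fun U B hU hB hs => TrappedBose.completeGBEC_of_smallFreeMean hħ hm hom hβ
    (fun N _ => hU N) hB hs, pair, fun u b α hu hα => ⟨fun h0 => ?_, fun B hB hb => ?_⟩⟩
  · rw [isLittleO_congr (TrappedBose.integral_abs_scaledPair_eventuallyEq u b hα)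
      EventuallyEq.rfl, isLittleO_const_mul_left_iff h0]
    exact TrappedBose.isLittleO_abs_div_iff hα
  · refine pair _ B (fun N hN => (hu.comp_mul_left' (hα N hN).ne').const_mul (b N)) hB ?_
    exact (((TrappedBose.isLittleO_abs_div_iff (γ := TrappedBose.gam) hα).2 hb).const_mul_left
      _).congr' (TrappedBose.integral_abs_scaledPair_eventuallyEq u b hα).symm EventuallyEq.rfl
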